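/- Let $n\ge 0$ be an integer, $a<b$ and $c\in[a,b]$ real, and let $V$ be a real symmetric $n\times n$ matrix function with integrable entries on $[a,b]$. Consider the boundary value problem $$Y''=(V(x)-E\,I)\,Y,\qquad A_1Y(a)+A_2Y'(a)=0,\qquad B_1Y(b)+B_2Y'(b)=0,$$ where $A_1,A_2,B_1,B_2$ are real $n\times n$ matrices with $A_1A_2^T-A_2A_1^T=0$, $B_1B_2^T-B_2B_1^T=0$ and $\operatorname{rank}(A_1|A_2)=\operatorname{rank}(B_1|B_2)=n$. (Solutions are $C^1$ functions with absolutely continuous derivative that satisfy the equation almost everywhere.) A real number $E$ is an eigenvalue if the problem has a nontrivial vector solution; its multiplicity is the dimension of the space of vector solutions. For $E\in\mathbb R$ let $Y_L,Y_R$ be the $n\times n$ matrix solutions of the differential equation with $$Y_L(a)=A_2^T,\ Y_L'(a)=-A_1^T,\qquad Y_R(b)=B_2^T,\ Y_R'(b)=-B_1^T,$$ and let $\Psi_L=Y_L(Y_L')^{-1}$, $\Psi_R=Y_R(Y_R')^{-1}$. The phase angles $\phi^L_1,\dots,\phi^L_n$ and $\phi^R_1,\dots,\phi^R_n$ are continuous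 functions of $x\in[a,b]$ such that $\tan\phi^L_j(x)$, $\tan\phi^R_j(x)$ are the eigenvalues, with multiplicity, of $\Psi_L(x)$, $\Psi_R(x)$, normalized by $$\phi^L_1\le\dots\le\phi^L_n\le\phi^L_1+\pi,\quad \phi^R_1\le\dots\le\phi^R_n\le\phi^R_1+\pi\quad\text{on }[a,b],$$ $$0\le\phi^L_j(a)<\pi,\qquad 0<\phi^R_j(b)\le\pi .$$ Let $\tan\omega_j$, with $0\le\omega_j<\pi$, $j=1,\dots,n$, be the eigenvalues, with multiplicity, of $[\Psi_L(c)-\Psi_R(c)][I+\Psi_L(c)\Psi_R(c)]^{-1}$. Here the eigenvalue $\infty=\tan(\pi/2)$ is allowed, so that everything makes sense where an inverse does not exist: that $\tan\theta_1,\dots,\tan\theta_n$ are the eigenvalues of "$PQ^{-1}$" means that for every real $\theta$ the number of $j$ with $\theta_j\equiv\theta\pmod\pi$ is $\dim\ker(\cos\theta\,P-\sin\theta\,Q)$. This is applied with $P=Y_L,\ Q=Y_L'$ for $\Psi_L$, with $P=Y_R,\ Q=Y_R'$ for $\Psi_R$, and for the $\omega_j$ with $P=Y_L^TY_R'-Y_L'^TY_R$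 and $Q=Y_L'^TY_R'+Y_L^TY_R$ at $c$ (by the symmetry of $\Psi_L$, $PQ^{-1}$ is similar to the matrix above when all inverses exist). Theorem. For every real $E$ such $\phi^L_j$, $\phi^R_j$, $\omega_j$ exist. For any such choice, the function $$\mathcal I(E)=\frac1\pi\Big(\sum_{j=1}^n\phi^L_j(c)-\sum_{j=1}^n\phi^R_j(c)-\sum_{j=1}^n\omega_j\Big)+n$$ is an integer-valued, nondecreasing step function of $E\in\mathbb R$ (every $E$ has a left and a right punctured one-sided neighbourhood on each of which $\mathcal I$ is constant). Its points of increase, i.e. the $E$ such that $\mathcal I$ is not constant on any neighbourhood of $E$, are exactly the eigenvalues of the problem. If $E$ is an eigenvalue of multiplicity $m$, then $\mathcal I(E_2)=\mathcal I(E_1)+m$ for all $E_1<E<E_2$ sufficiently close to $E$. -/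

import Mathlib

/-- A regular multichannel Schrödinger boundary value problem on `[a, b]`:
`Y'' = (V(x) - E) Y`, `A₁ Y(a) + A₂ Y'(a) = 0`, `B₁ Y(b) + B₂ Y'(b) = 0`,
with a symmetric integrable potential matrix and conjoined boundary conditions of full rank. -/
structure MultichannelProblem (n : ℕ) where
  a : ℝ
  b : ℝ
  a_lt_b : a < b
  V : ℝ → Matrix (Fin n) (Fin n) ℝ
  V_symm : ∀ x ∈ Set.Icc a b, (V x).IsSymm
  V_int : ∀ i j, IntervalIntegrable (fun x => V x i j) MeasureTheory.volume a b
  A₁ : Matrix (Fin n) (Fin n) ℝ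
  A₂ : Matrix (Fin n) (Fin n) ℝ
  B₁ : Matrix (Fin n) (Fin n) ℝ
  B₂ : Matrix (Fin n) (Fin n) ℝ
  conj_A : A₁ * A₂.transpose - A₂ * A₁.transpose = 0
  conj_B : B₁ * B₂.transpose - B₂ * B₁.transpose = 0
  rank_A : (Matrix.fromCols A₁ A₂).rank = n
  rank_B : (Matrix.fromCols B₁ B₂).rank = n

namespace MultichannelProblem

variable {n : ℕ} (p : MultichannelProblem n)

/-- `y` is a (Carathéodory) solution of `y'' = (V(x) - E) y` on `[a, b]` with derivative `dy`:
`y` is differentiable with derivative `dy`, and `dy` is the absolutely continuous function which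
is an indefinite integral of `(V - E) y`. For continuous `V` these are the classical solutions. -/
def IsSolution (E : ℝ) (y dy : ℝ → Fin n → ℝ) : Prop :=
  ∀ x ∈ Set.Icc p.a p.b,
    HasDerivWithinAt y (dy x) (Set.Icc p.a p.b) x ∧
    dy x = dy p.a + ∫ t in p.a..x, (p.V t - E • (1 : Matrix (Fin n) (Fin n) ℝ)).mulVec (y t)

/-- Matrix solutions: every column is a solution. -/
def IsMatrixSolution (E : ℝ) (Y dY : ℝ → Matrix (Fin n) (Fin n) ℝ) : Prop :=
  ∀ j, p.IsSolution E (fun x i => Y x i j) (fun x i => dY x i j)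

/-- The boundary conditions at both end points. -/
def SatisfiesBC (y dy : ℝ → Fin n → ℝ) : Prop :=
  p.A₁.mulVec (y p.a) + p.A₂.mulVec (dy p.a) = 0 ∧
  p.B₁.mulVec (y p.b) + p.B₂.mulVec (dy p.b) = 0

variable {p}

theorem IsSolution.intervalIntegrable {E : ℝ} {y dy : ℝ → Fin n → ℝ}
    (h : p.IsSolution E y dy) {x : ℝ} (hx : x ∈ Set.Icc p.a p.b) :
    IntervalIntegrable
      (fun t => (p.V t - E • (1 : Matrix (Fin n) (Fin n) ℝ)).mulVec (y t))
      MeasureTheory.volume p.a x := by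
  have hcont : ContinuousOn y (Set.Icc p.a p.b) := fun t ht => (h t ht).1.continuousWithinAt
  have hsub : Set.uIcc p.a x ⊆ Set.Icc p.a p.b := by
    rw [Set.uIcc_of_le hx.1]; exact Set.Icc_subset_Icc_right hx.2
  have hV : ∀ i j, IntervalIntegrable (fun t => p.V t i j) MeasureTheory.volume p.a x := by
    intro i j
    refine (p.V_int i j).mono_set ?_
    rw [Set.uIcc_of_le p.a_lt_b.le]; exact hsub
  have key : ∀ i, IntervalIntegrable
      (fun t => (p.V t - E • (1 : Matrix (Fin n) (Fin n) ℝ)).mulVec (y t) i)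
      MeasureTheory.volume p.a x := by
    intro i
    simp only [Matrix.mulVec, dotProduct]
    have : ∀ j ∈ Finset.univ, IntervalIntegrable
        (fun t => (p.V t - E • (1 : Matrix (Fin n) (Fin n) ℝ)) i j * y t j)
        MeasureTheory.volume p.a x := by
      intro j _
      refine IntervalIntegrable.mul_continuousOn ?_ ?_
      · simpa using (hV i j).sub intervalIntegrable_const
      · exact ((continuous_apply j).comp_continuousOn hcont).mono hsub
    simpa [Finset.sum_fn] using IntervalIntegrable.sum _ this
  rw [intervalIntegrable_iff]
  exact MeasureTheory.Integrable.of_eval fun i => intervalIntegrable_iff.1 (key i)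

variable (p)

/-- The space of all solutions of the boundary value problem for the value `E` (the eigenfunctions
together with `0`), as functions on `[a, b]`. -/
def eigenspace (E : ℝ) : Submodule ℝ (Set.Icc p.a p.b → Fin n → ℝ) where
  carrier := {u | ∃ y dy : ℝ → Fin n → ℝ,
    p.IsSolution E y dy ∧ p.SatisfiesBC y dy ∧ ∀ x : Set.Icc p.a p.b, u x = y x}
  zero_mem' := by
    refine ⟨0, 0, fun x hx => ⟨?_, ?_⟩, ⟨?_, ?_⟩, fun x => rfl⟩
    · exact hasDerivWithinAt_const x _ (0 : Fin n → ℝ)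
    · simp
    · simp
    · simp
  add_mem' := by
    rintro u v ⟨y, dy, hy, hyb, hu⟩ ⟨w, dw, hw, hwb, hv⟩
    refine ⟨y + w, dy + dw, fun x hx => ⟨(hy x hx).1.add (hw x hx).1, ?_⟩, ⟨?_, ?_⟩, fun x => ?_⟩
    · simp only [Pi.add_apply, Matrix.mulVec_add]
      rw [intervalIntegral.integral_add (hy.intervalIntegrable hx) (hw.intervalIntegrable hx),
        (hy x hx).2, (hw x hx).2]
      abel
    · have h1 := hyb.1
      have h2 := hwb.1
      simp only [Pi.add_apply, Matrix.mulVec_add]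
      rw [add_add_add_comm, h1, h2, add_zero]
    · have h1 := hyb.2
      have h2 := hwb.2
      simp only [Pi.add_apply, Matrix.mulVec_add]
      rw [add_add_add_comm, h1, h2, add_zero]
    · simp [hu, hv]
  smul_mem' := by
    rintro r u ⟨y, dy, hy, hyb, hu⟩
    refine ⟨r • y, r • dy, fun x hx => ⟨(hy x hx).1.const_smul r, ?_⟩, ⟨?_, ?_⟩, fun x => ?_⟩
    · simp only [Pi.smul_apply, Matrix.mulVec_smul]
      rw [intervalIntegral.integral_smul, (hy x hx).2, smul_add]
    · simp only [Pi.smul_apply, Matrix.mulVec_smul]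
      rw [← smul_add, hyb.1, smul_zero]
    · simp only [Pi.smul_apply, Matrix.mulVec_smul]
      rw [← smul_add, hyb.2, smul_zero]
    · simp [hu]

/-- `E` is an eigenvalue: there is a nontrivial solution of the boundary value problem. -/
def IsEigenvalue (E : ℝ) : Prop := p.eigenspace E ≠ ⊥

/-- The multiplicity of `E` as an eigenvalue of the boundary value problem. -/
noncomputable def multiplicity (E : ℝ) : ℕ := Module.finrank ℝ (p.eigenspace E)

/-- The left solution matrix: the columns of `(Y_L(a), Y_L'(a)) = (A₂ᵀ, -A₁ᵀ)` are a basis of the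
data satisfying the boundary condition at `a`. -/
def IsLeftSolution (E : ℝ) (Y dY : ℝ → Matrix (Fin n) (Fin n) ℝ) : Prop :=
  p.IsMatrixSolution E Y dY ∧ Y p.a = p.A₂.transpose ∧ dY p.a = -p.A₁.transpose

/-- The right solution matrix: the columns of `(Y_R(b), Y_R'(b)) = (B₂ᵀ, -B₁ᵀ)` are a basis of the
data satisfying the boundary condition at `b`. -/
def IsRightSolution (E : ℝ) (Y dY : ℝ → Matrix (Fin n) (Fin n) ℝ) : Prop :=
  p.IsMatrixSolution E Y dY ∧ Y p.b = p.B₂.transpose ∧ dY p.b = -p.B₁.transpose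

end MultichannelProblem

/-- `tan φ_j` are the eigenvalues of `P Q⁻¹` in `ℝ ∪ {∞}`, with multiplicity: every `θ` occurs among
the `φ_j`, modulo `π`, as often as the dimension of the kernel of `cos θ P - sin θ Q`.
Where `Q` is singular, its kernel accounts for the eigenvalue `∞ = tan (π / 2)`. -/
def HasEigenAngles {n : ℕ} (P Q : Matrix (Fin n) (Fin n) ℝ) (φ : Fin n → ℝ) : Prop :=
  ∀ θ : ℝ, {j | ∃ k : ℤ, φ j = θ + k * Real.pi}.ncard =
    Module.finrank ℝ (LinearMap.ker (Matrix.mulVecLin (Real.cos θ • P - Real.sin θ • Q)))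

/-- If `Q` is invertible, the kernels in `HasEigenAngles` have the dimensions of the eigenspaces of
`P Q⁻¹` for the eigenvalues `tan θ`, and `∞` is not an eigenvalue. -/
theorem finrank_ker_eq_finrank_eigenspace {n : ℕ} (P Q : Matrix (Fin n) (Fin n) ℝ)
    (hQ : IsUnit Q.det) (θ : ℝ) :
    Module.finrank ℝ (LinearMap.ker (Matrix.mulVecLin (Real.cos θ • P - Real.sin θ • Q))) =
      if Real.cos θ = 0 then 0 else
      Module.finrank ℝ (Module.End.eigenspace (Matrix.toLin' (P * Q⁻¹)) (Real.tan θ)) := by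
  have hQ1 : Q⁻¹ * Q = 1 := Matrix.nonsing_inv_mul Q hQ
  have hQ2 : Q * Q⁻¹ = 1 := Matrix.mul_nonsing_inv Q hQ
  split_ifs with hθ
  · have hs : Real.sin θ ≠ 0 := by
      intro h
      have := Real.sin_sq_add_cos_sq θ
      simp [h, hθ] at this
    rw [LinearMap.ker_eq_bot'.2, finrank_bot]
    intro v hv
    have h1 : Q.mulVec v = 0 := by
      simpa [hθ, Matrix.neg_mulVec, Matrix.smul_mulVec, hs] using hv
    calc v = (Q⁻¹ * Q).mulVec v := by rw [hQ1, Matrix.one_mulVec]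
      _ = 0 := by rw [← Matrix.mulVec_mulVec, h1, Matrix.mulVec_zero]
  · have hker : ∀ w : Fin n → ℝ,
        w ∈ LinearMap.ker (Matrix.mulVecLin (Real.cos θ • P - Real.sin θ • Q)) ↔
        P.mulVec w = Real.tan θ • Q.mulVec w := by
      intro w
      rw [LinearMap.mem_ker, Matrix.mulVecLin_apply, Matrix.sub_mulVec, Matrix.smul_mulVec,
        Matrix.smul_mulVec, sub_eq_zero, Real.tan_eq_sin_div_cos]
      constructor
      · intro h
        rw [div_eq_inv_mul, mul_smul, ← h, smul_smul, inv_mul_cancel₀ hθ, one_smul]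
      · intro h
        rw [h, smul_smul, mul_div_cancel₀ _ hθ]
    refine LinearEquiv.finrank_eq (LinearEquiv.ofSubmodules
      (Matrix.toLin'OfInv hQ1 hQ2) _ _ ?_)
    ext v
    rw [Submodule.mem_map, Module.End.mem_eigenspace_iff]
    constructor
    · rintro ⟨w, hw, rfl⟩
      have := (hker w).1 hw
      simpa [Matrix.toLin'OfInv, Matrix.mulVec_mulVec, Matrix.mul_assoc, hQ1] using this
    · intro hv
      refine ⟨Q⁻¹.mulVec v, (hker _).2 ?_, ?_⟩
      · simpa [Matrix.mulVec_mulVec, hQ2] using hv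
      · simp [Matrix.toLin'OfInv, Matrix.mulVec_mulVec, hQ2]

/-- For invertible `dYL`, `dYR` and symmetric `L = YL dYL⁻¹`, the matrix `(L - R) (1 + L R)⁻¹` with
`R = YR dYR⁻¹` is similar to `P Q⁻¹`, with the matrices `P`, `Q` of `AreMatchingAngles` below. -/
theorem matching_similar {n : ℕ} (YL dYL YR dYR : Matrix (Fin n) (Fin n) ℝ)
    (hL : IsUnit dYL.det) (hR : IsUnit dYR.det) (hs : (YL * dYL⁻¹).IsSymm) :
    (YL.transpose * dYR - dYL.transpose * YR) *
        (dYL.transpose * dYR + YL.transpose * YR)⁻¹ =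
      dYL.transpose * ((YL * dYL⁻¹ - YR * dYR⁻¹) * (1 + YL * dYL⁻¹ * (YR * dYR⁻¹))⁻¹) *
        dYL.transpose⁻¹ := by
  have hR1 : dYR⁻¹ * dYR = 1 := Matrix.nonsing_inv_mul dYR hR
  have hR2 : dYR * dYR⁻¹ = 1 := Matrix.mul_nonsing_inv dYR hR
  have hL1 : dYL⁻¹ * dYL = 1 := Matrix.nonsing_inv_mul dYL hL
  have hYL : YL.transpose = dYL.transpose * (YL * dYL⁻¹) := by
    conv_rhs => rw [← hs.eq]
    rw [← Matrix.transpose_mul, Matrix.mul_assoc, hL1, Matrix.mul_one]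
  have hP : YL.transpose * dYR - dYL.transpose * YR =
      dYL.transpose * (YL * dYL⁻¹ - YR * dYR⁻¹) * dYR := by
    rw [Matrix.mul_sub, ← hYL, Matrix.sub_mul]
    simp only [Matrix.mul_assoc, hR1, Matrix.mul_one]
  have hQ : dYL.transpose * dYR + YL.transpose * YR =
      dYL.transpose * (1 + YL * dYL⁻¹ * (YR * dYR⁻¹)) * dYR := by
    rw [Matrix.mul_add, ← Matrix.mul_assoc dYL.transpose (YL * dYL⁻¹), ← hYL, Matrix.add_mul]
    simp only [Matrix.mul_assoc, hR1, Matrix.mul_one]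
  rw [hP, hQ, Matrix.mul_inv_rev, Matrix.mul_inv_rev]
  simp only [Matrix.mul_assoc]
  rw [← Matrix.mul_assoc dYR, hR2, Matrix.one_mul]

namespace MultichannelProblem

variable {n : ℕ} (p : MultichannelProblem n)

/-- `φ_1, …, φ_n` are continuous, ordered phase angles on `[a, b]` of the matrix function
`Ψ = Y (Y')⁻¹`. -/
structure ArePhaseAngles (Y dY : ℝ → Matrix (Fin n) (Fin n) ℝ) (φ : Fin n → ℝ → ℝ) : Prop where
  continuousOn : ∀ j, ContinuousOn (φ j) (Set.Icc p.a p.b)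
  ordered : ∀ x ∈ Set.Icc p.a p.b, ∀ i j, i ≤ j → φ i x ≤ φ j x
  le_add_pi : ∀ x ∈ Set.Icc p.a p.b, ∀ i j, φ j x ≤ φ i x + Real.pi
  angles : ∀ x ∈ Set.Icc p.a p.b, HasEigenAngles (Y x) (dY x) (fun j => φ j x)

/-- `φ_1, …, φ_n` are the normalized phase angles of `Ψ_L = Y_L (Y_L')⁻¹`. -/
def AreLeftPhaseAngles (E : ℝ) (φ : Fin n → ℝ → ℝ) : Prop :=
  ∃ Y dY, p.IsLeftSolution E Y dY ∧ p.ArePhaseAngles Y dY φ ∧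
    ∀ j, 0 ≤ φ j p.a ∧ φ j p.a < Real.pi

/-- `φ_1, …, φ_n` are the normalized phase angles of `Ψ_R = Y_R (Y_R')⁻¹`. -/
def AreRightPhaseAngles (E : ℝ) (φ : Fin n → ℝ → ℝ) : Prop :=
  ∃ Y dY, p.IsRightSolution E Y dY ∧ p.ArePhaseAngles Y dY φ ∧
    ∀ j, 0 < φ j p.b ∧ φ j p.b ≤ Real.pi

/-- `ω_j ∈ [0, π)` and `tan ω_j` are the eigenvalues of `(Ψ_L - Ψ_R) (1 + Ψ_L Ψ_R)⁻¹` at `c`.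
Since `Ψ_L` is symmetric, `Ψ_L = (Y_L'ᵀ)⁻¹ Y_Lᵀ`, so that this matrix is similar to `P Q⁻¹` with
`P = Y_Lᵀ Y_R' - Y_L'ᵀ Y_R` and `Q = Y_L'ᵀ Y_R' + Y_Lᵀ Y_R`, which have no singularities. -/
def AreMatchingAngles (c E : ℝ) (ω : Fin n → ℝ) : Prop :=
  (∀ j, 0 ≤ ω j ∧ ω j < Real.pi) ∧
  ∃ YL dYL YR dYR, p.IsLeftSolution E YL dYL ∧ p.IsRightSolution E YR dYR ∧
    HasEigenAngles ((YL c).transpose * dYR c - (dYL c).transpose * YR c)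
      ((dYL c).transpose * dYR c + (YL c).transpose * YR c) ω

end MultichannelProblem

/-- A step function on `ℝ`: constant immediately to the left and immediately to the right of
every point (equivalently, piecewise constant with finitely many pieces on bounded intervals). -/
def IsStepFunction (f : ℝ → ℝ) : Prop :=
  ∀ E, ∃ ε > 0, (∃ l, ∀ E₁ ∈ Set.Ioo (E - ε) E, f E₁ = l) ∧
    (∃ r, ∀ E₂ ∈ Set.Ioo E (E + ε), f E₂ = r)

/-! Write the data (y, y') of solutions as vectors in the symplectic space ℝⁿ × ℝⁿ. The data at `c`
of the solutions satisfying the left (right) boundary condition form a Lagrangian subspace L_E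
(R_E), and the eigenfunctions correspond to the intersection of L_E and R_E. More generally, a
vector in the kernel of cos θ P - sin θ Q for the matching pair corresponds to a vector of R_E which
lands in L_E when rotated by θ. So the multiplicity of E is the number of `ω` equal to 0
(`multiplicity_eq`).

For a pair (P, Q) in diagonalized form, det (Q + iP) is a real number times exp (i Σ φ_j). The
complex frame of the matching pair is the transposed left frame times the conjugated right frame.
Hence Σ φ^L - Σ φ^R - Σ ω is an integer multiple of π (`exists_sum_sub_sum_eq`), and the function is
integer valued.

The sums Σ φ^L(c) and Σ φ^R(c) are continuous in E, since the frames are continuous in (E, x) and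
the angles are normalized at an end point where the data do not depend on E. Near a fixed E₀ the `ω`
are lifted to continuous angles Ω with Ω(E₀) in [0, π). Then Σ φ^L - Σ φ^R - Σ Ω is continuous with
values in πℤ, so constant, and reducing Ω modulo π shows that I is a constant plus Σ ⌊Ω_j / π⌋. Only
the Ω_j which vanish at E₀ can make this jump.

Their direction comes from Green's identity. Let solutions at E match at `c` up to a rotation by θ,
and pair them with matching solutions at E₀. This gives sin θ · T = (E - E₀) · G, where T and G are
positive near the matching data. By compactness of the unit sphere, small matching angles have the
sign of E - E₀ (`eventually_sin_mul_pos`). So each Ω_j with Ω_j(E₀) = 0 is negative to the left and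
positive to the right of E₀, and I jumps by the multiplicity (`exists_local_counting`); the
remaining assertions are elementary consequences. -/

/-! ### Volterra integral equations with integrable coefficients -/

section Volterra

open MeasureTheory Set

/-- The primitive of an integrable function satisfies the power rule. -/
theorem integral_mul_primitive_pow {g : ℝ → ℝ} {a b : ℝ} (hg : IntervalIntegrable g volume a b)
    (k : ℕ) :
    ∫ x in a..b, g x * (∫ t in a..x, g t) ^ k = (∫ t in a..b, g t) ^ (k + 1) / (k + 1) := by
  set G : ℝ → ℝ := fun x => ∫ t in a..x, g t with hG
  have hac : AbsolutelyContinuousOnInterval G a b :=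
    hg.absolutelyContinuousOnInterval_intervalIntegral (by simp)
  -- As g is only integrable, its primitive is differentiable only almost everywhere; absolute
  -- continuity of the powers is what allows the fundamental theorem of calculus.
  have hpow : ∀ m : ℕ, AbsolutelyContinuousOnInterval (fun x => G x ^ (m + 1)) a b := by
    intro m
    induction m with
    | zero => simpa using hac
    | succ m ih => simpa [pow_succ _ (m + 1)] using ih.fun_mul hac
  have h1 := (hpow k).integral_deriv_eq_sub
  have h2 : ∫ x in a..b, deriv (fun x => G x ^ (k + 1)) x =
      ∫ x in a..b, ((k : ℝ) + 1) * (g x * G x ^ k) := by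
    apply intervalIntegral.integral_congr_ae
    filter_upwards [hg.ae_hasDerivAt_integral] with x hx hxm
    have h3 := (hx (uIoc_subset_uIcc hxm) a (by simp)).pow (k + 1)
    refine HasDerivAt.deriv (f := fun x => G x ^ (k + 1)) (h3.congr_deriv ?_)
    simp only [Nat.add_sub_cancel, hG]
    push_cast
    ring
  rw [h2, intervalIntegral.integral_const_mul] at h1
  have h4 : ((k : ℝ) + 1) ≠ 0 := by positivity
  have h5 : G a = 0 := by simp [hG]
  rw [h5, zero_pow (Nat.succ_ne_zero k), sub_zero] at h1
  rw [eq_div_iff h4, mul_comm]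
  exact h1

variable {F : Type*} [NormedAddCommGroup F] [NormedSpace ℝ F] {a b : ℝ}

theorem IntervalIntegrable.clm_apply_of_continuous {A : ℝ → F →L[ℝ] F}
    (hA : IntervalIntegrable A volume a b) {z : ℝ → F} (hz : Continuous z) :
    IntervalIntegrable (fun t => A t (z t)) volume a b := by
  have h1 : IntervalIntegrable (fun t => ‖A t‖ * ‖z t‖) volume a b :=
    hA.norm.mul_continuousOn hz.norm.continuousOn
  refine h1.mono_fun ?_ ?_
  · exact (ContinuousLinearMap.id ℝ (F →L[ℝ] F)).aestronglyMeasurable_comp₂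
      hA.def'.aestronglyMeasurable hz.aestronglyMeasurable
  · filter_upwards with t
    rw [norm_mul, norm_norm, norm_norm]
    exact (A t).le_opNorm _

variable (hab : a ≤ b) {A : ℝ → F →L[ℝ] F}

theorem continuous_volterra (hA : IntervalIntegrable A volume a b) (z : C(Icc a b, F)) :
    Continuous fun x : Icc a b => ∫ t in a..x, A t (IccExtend hab z t) := by
  have h1 : IntervalIntegrable (fun t => A t (IccExtend hab z t)) volume a b :=
    hA.clm_apply_of_continuous z.continuous.Icc_extend'
  have h2 := intervalIntegral.continuousOn_primitive_interval
    ((intervalIntegrable_iff' (by simp)).1 h1)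
  rw [uIcc_of_le hab] at h2
  exact h2.domRestrict

theorem norm_volterra_le (hA : IntervalIntegrable A volume a b) (z : C(Icc a b, F)) (x : Icc a b) {h : ℝ → ℝ} (hh : Continuous h)
    (hz : ∀ t : Icc a b, ‖z t‖ ≤ h t) :
    ‖∫ t in a..x, A t (IccExtend hab z t)‖ ≤ ∫ t in a..x, ‖A t‖ * h t := by
  have hA' : IntervalIntegrable A volume a x := by
    refine hA.mono_set ?_
    rw [uIcc_of_le hab, uIcc_of_le x.2.1]
    exact Icc_subset_Icc_right x.2.2
  refine intervalIntegral.norm_integral_le_of_norm_le x.2.1 ?_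
    (hA'.norm.mul_continuousOn hh.continuousOn)
  filter_upwards with t ht
  have htm : t ∈ Icc a b := ⟨ht.1.le, ht.2.trans x.2.2⟩
  refine ((A t).le_opNorm _).trans (mul_le_mul_of_nonneg_left ?_ (norm_nonneg _))
  rw [IccExtend_of_mem hab z htm]
  exact hz ⟨t, htm⟩

variable (hA : IntervalIntegrable A volume a b)

/-- The Volterra operator `z ↦ ∫ₐˣ A z` on continuous functions. -/
noncomputable def volterra : C(Icc a b, F) →L[ℝ] C(Icc a b, F) :=
  LinearMap.mkContinuous
    { toFun := fun z => ⟨fun x => ∫ t in a..x, A t (IccExtend hab z t), continuous_volterra hab hA z⟩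
      map_add' := by
        intro z w
        ext x
        have hA' : IntervalIntegrable A volume a x := by
          refine hA.mono_set ?_
          rw [uIcc_of_le hab, uIcc_of_le x.2.1]
          exact Icc_subset_Icc_right x.2.2
        simp only [ContinuousMap.coe_mk, ContinuousMap.add_apply]
        rw [← intervalIntegral.integral_add
          (hA'.clm_apply_of_continuous z.continuous.Icc_extend')
          (hA'.clm_apply_of_continuous w.continuous.Icc_extend')]
        simp [IccExtend]
      map_smul' := by
        intro c z
        ext x
        simp only [ContinuousMap.coe_mk, ContinuousMap.smul_apply, RingHom.id_apply]
        rw [← intervalIntegral.integral_smul]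
        simp [IccExtend] }
    (∫ t in a..b, ‖A t‖) (by
      intro z
      have h0 : 0 ≤ ∫ t in a..b, ‖A t‖ :=
        intervalIntegral.integral_nonneg hab fun _ _ => norm_nonneg _
      rw [ContinuousMap.norm_le _ (mul_nonneg h0 (norm_nonneg _))]
      intro x
      refine (norm_volterra_le hab hA z x (h := fun _ => ‖z‖) continuous_const
        fun t => z.norm_coe_le_norm t).trans ?_
      rw [intervalIntegral.integral_mul_const]
      refine mul_le_mul_of_nonneg_right ?_ (norm_nonneg _)
      exact intervalIntegral.integral_mono_interval le_rfl x.2.1 x.2.2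
        (Filter.Eventually.of_forall fun _ => norm_nonneg _) hA.norm)

theorem volterra_apply (z : C(Icc a b, F)) (x : Icc a b) :
    volterra hab hA z x = ∫ t in a..x, A t (IccExtend hab z t) := rfl

/-- The bound is pointwise in x, so that the induction integrates ‖A‖ times the k-th power of its
own primitive. This produces the factorial. -/
theorem norm_volterra_pow_apply_le (k : ℕ) (z : C(Icc a b, F)) (x : Icc a b) :
    ‖(volterra hab hA ^ k) z x‖ ≤ ‖z‖ * ((∫ t in a..x, ‖A t‖) ^ k / k.factorial) := by
  have hcont : Continuous (fun x : ℝ => ∫ t in a..(projIcc a b hab x : ℝ), ‖A t‖) := by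
    have h2 := intervalIntegral.continuousOn_primitive_interval
      ((intervalIntegrable_iff' (by simp)).1 hA.norm)
    rw [uIcc_of_le hab] at h2
    exact h2.domRestrict.comp continuous_projIcc
  induction k generalizing x with
  | zero => simpa using z.norm_coe_le_norm x
  | succ k ih =>
    rw [pow_succ', mul_apply_eq_comp, volterra_apply]
    refine (norm_volterra_le hab hA _ x
      -- The upper limit is clamped to [a, b] because the majorant has to be continuous on all of ℝ.
      (h := fun x => ‖z‖ * ((∫ t in a..(projIcc a b hab x : ℝ), ‖A t‖) ^ k / k.factorial))
      (by fun_prop) ?_).trans ?_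
    · intro t
      simpa using ih t
    · have hA' : IntervalIntegrable A volume a x := by
        refine hA.mono_set ?_
        rw [uIcc_of_le hab, uIcc_of_le x.2.1]
        exact Icc_subset_Icc_right x.2.2
      have h3 : ∫ t in a..x, ‖A t‖ *
          (‖z‖ * ((∫ t in a..(projIcc a b hab t : ℝ), ‖A t‖) ^ k / k.factorial)) =
          ∫ t in a..x, (‖z‖ / k.factorial) * (‖A t‖ * (∫ s in a..t, ‖A s‖) ^ k) := by
        apply intervalIntegral.integral_congr
        intro t ht
        rw [uIcc_of_le x.2.1] at ht
        simp only
        rw [projIcc_of_mem hab ⟨ht.1, ht.2.trans x.2.2⟩]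
        ring
      rw [h3, intervalIntegral.integral_const_mul, integral_mul_primitive_pow hA'.norm,
        Nat.factorial_succ]
      apply le_of_eq
      push_cast
      field_simp

variable [CompleteSpace F]

/-- The operator K need not be small, but some power K^N has norm below 1. Then 1 - K^N is
invertible, and 1 - K is a factor of it which commutes with the cofactor. -/
theorem isUnit_one_sub_volterra : IsUnit (1 - volterra hab hA) := by
  obtain ⟨N, hN⟩ : ∃ N : ℕ, (∫ t in a..b, ‖A t‖) ^ N / N.factorial < 1 :=
    ((FloorSemiring.tendsto_pow_div_factorial_atTop (∫ t in a..b, ‖A t‖)).eventually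
      (gt_mem_nhds one_pos)).exists
  have h0 : 0 ≤ ∫ t in a..b, ‖A t‖ :=
    intervalIntegral.integral_nonneg hab fun _ _ => norm_nonneg _
  have h1 : ‖volterra hab hA ^ N‖ < 1 := by
    refine lt_of_le_of_lt (ContinuousLinearMap.opNorm_le_bound _ (by positivity) fun z => ?_) hN
    rw [ContinuousMap.norm_le _ (by positivity)]
    intro x
    refine (norm_volterra_pow_apply_le hab hA N z x).trans ?_
    rw [mul_comm]
    have h2 : 0 ≤ ∫ t in a..x, ‖A t‖ :=
      intervalIntegral.integral_nonneg x.2.1 fun _ _ => norm_nonneg _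
    have h3 : ∫ t in a..x, ‖A t‖ ≤ ∫ t in a..b, ‖A t‖ :=
      intervalIntegral.integral_mono_interval le_rfl x.2.1 x.2.2
        (Filter.Eventually.of_forall fun _ => norm_nonneg _) hA.norm
    gcongr
  have h2 : IsUnit (1 - volterra hab hA ^ N) := 
    isUnit_one_sub_of_norm_lt_one (R := C(Icc a b, F) →L[ℝ] C(Icc a b, F)) h1
  rw [← mul_neg_geom_sum] at h2
  refine ((Commute.isUnit_mul_iff ?_).1 h2).1
  exact (Commute.one_left _).sub_left
    (Commute.sum_right _ _ _ fun i _ => Commute.pow_right (Commute.refl _) i)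

end Volterra

open MeasureTheory in
theorem intervalIntegrable_linearMap_matrix {n : ℕ} {G : Type*} [NormedAddCommGroup G]
    [NormedSpace ℝ G] (T : Matrix (Fin n) (Fin n) ℝ →ₗ[ℝ] G) {V : ℝ → Matrix (Fin n) (Fin n) ℝ}
    {a b : ℝ} (hV : ∀ i j, IntervalIntegrable (fun x => V x i j) volume a b) :
    IntervalIntegrable (fun t => T (V t)) volume a b := by
  have h2 : (fun t => T (V t)) = fun t => ∑ i, ∑ j, V t i j • T (Matrix.single i j 1) := by
    ext1 t
    conv_lhs => rw [Matrix.matrix_eq_sum_single (V t)]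
    simp only [map_sum]
    refine Finset.sum_congr rfl fun i _ => Finset.sum_congr rfl fun j _ => ?_
    rw [← map_smul, Matrix.smul_single, smul_eq_mul, mul_one]
  rw [h2, intervalIntegrable_iff]
  exact integrable_finsetSum _ fun i _ => integrable_finsetSum _ fun j _ =>
    Integrable.smul_const (intervalIntegrable_iff.1 (hV i j)) _

/-! ### The flow of the first order system -/

namespace MultichannelProblem

open MeasureTheory Set

variable {n : ℕ} (p : MultichannelProblem n)

/-- The phase space `ℝⁿ × ℝⁿ` of pairs `(y, y')`. -/
abbrev PhaseSpace (n : ℕ) : Type := (Fin n → ℝ) × (Fin n → ℝ)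

/-- The operator `(y, y') ↦ (0, M y)` on the phase space. -/
noncomputable def forcing (n : ℕ) :
    Matrix (Fin n) (Fin n) ℝ →ₗ[ℝ] (PhaseSpace n →L[ℝ] PhaseSpace n) where
  toFun M := LinearMap.toContinuousLinearMap
    (LinearMap.inr ℝ (Fin n → ℝ) (Fin n → ℝ) ∘ₗ M.mulVecLin ∘ₗ LinearMap.fst ℝ _ _)
  map_add' M N := by
    refine ContinuousLinearMap.ext fun w => Prod.ext ?_ ?_ <;> simp
  map_smul' c M := by
    refine ContinuousLinearMap.ext fun w => Prod.ext ?_ ?_ <;> simp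

theorem forcing_apply (M : Matrix (Fin n) (Fin n) ℝ) (w : PhaseSpace n) :
    forcing n M w = (0, M.mulVec w.1) := rfl

/-- The coefficient of the first order system for `(y, y')`. -/
noncomputable def coeff (E t : ℝ) : PhaseSpace n →L[ℝ] PhaseSpace n :=
  (ContinuousLinearMap.snd ℝ (Fin n → ℝ) (Fin n → ℝ)).prod 0 + forcing n (p.V t) - E • forcing n 1

theorem coeff_apply (E t : ℝ) (w : PhaseSpace n) :
    p.coeff E t w = (w.2, (p.V t - E • (1 : Matrix (Fin n) (Fin n) ℝ)).mulVec w.1) := by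
  rw [coeff, ← map_smul]
  refine Prod.ext ?_ ?_
  · simp [forcing_apply]
  · simp [forcing_apply, Matrix.sub_mulVec, Matrix.smul_mulVec]

theorem intervalIntegrable_coeff (E : ℝ) : IntervalIntegrable (p.coeff E) volume p.a p.b := by
  have h1 : IntervalIntegrable (fun t => forcing n (p.V t)) volume p.a p.b :=
    intervalIntegrable_linearMap_matrix (forcing n) p.V_int
  exact (intervalIntegrable_const.add h1).sub intervalIntegrable_const

/-- The Volterra operator of the first order system. -/
noncomputable def systemVolterra (E : ℝ) :
    C(Icc p.a p.b, PhaseSpace n) →L[ℝ] C(Icc p.a p.b, PhaseSpace n) :=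
  volterra p.a_lt_b.le (p.intervalIntegrable_coeff E)

theorem intervalIntegrable_coeff_apply (E : ℝ) (z : C(Icc p.a p.b, PhaseSpace n)) {x : ℝ}
    (hx : x ∈ Icc p.a p.b) :
    IntervalIntegrable (fun t => p.coeff E t (IccExtend p.a_lt_b.le z t)) volume p.a x := by
  refine IntervalIntegrable.mono_set
    ((p.intervalIntegrable_coeff E).clm_apply_of_continuous z.continuous.Icc_extend') ?_
  rw [uIcc_of_le hx.1, uIcc_of_le p.a_lt_b.le]
  exact Icc_subset_Icc_right hx.2

/-- E enters affinely, with a bounded coefficient. Norm continuity of the resolvent in E rests on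
this. -/
theorem systemVolterra_eq (E : ℝ) :
    p.systemVolterra E = p.systemVolterra 0 -
      E • volterra p.a_lt_b.le (A := fun _ => forcing n 1) intervalIntegrable_const := by
  ext1 z
  ext1 x
  have h1 := p.intervalIntegrable_coeff_apply 0 z x.2
  have h2 : IntervalIntegrable (fun t => E • forcing n 1 (IccExtend p.a_lt_b.le z t))
      volume p.a x :=
    (((forcing n 1).continuous.comp z.continuous.Icc_extend').const_smul E).intervalIntegrable _ _
  simp only [systemVolterra, volterra_apply, sub_apply, smul_apply, ContinuousMap.sub_apply,
    ContinuousMap.smul_apply]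
  rw [← intervalIntegral.integral_smul, ← intervalIntegral.integral_sub h1 h2]
  simp [coeff]

/-- The resolvent of the Volterra operator, mapping the constant function `w` to the solution
with initial value `w`. -/
noncomputable def resolvent (E : ℝ) :
    C(Icc p.a p.b, PhaseSpace n) →L[ℝ] C(Icc p.a p.b, PhaseSpace n) :=
  Ring.inverse (1 - p.systemVolterra E)

theorem continuous_resolvent : Continuous p.resolvent := by
  rw [continuous_iff_continuousAt]
  intro E
  have h1 : Continuous fun E => 1 - p.systemVolterra E := by
    have h2 : (fun E => 1 - p.systemVolterra E) = fun E : ℝ => 1 - (p.systemVolterra 0 -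
        E • volterra p.a_lt_b.le (A := fun _ => forcing n 1) intervalIntegrable_const) := by
      funext E
      rw [← systemVolterra_eq]
    rw [h2]
    fun_prop
  obtain ⟨u, hu⟩ := isUnit_one_sub_volterra p.a_lt_b.le (p.intervalIntegrable_coeff E)
  have h3 := NormedRing.inverse_continuousAt
    (R := C(Icc p.a p.b, PhaseSpace n) →L[ℝ] C(Icc p.a p.b, PhaseSpace n)) u
  rw [hu] at h3
  exact ContinuousAt.comp (f := fun E => 1 - p.systemVolterra E) h3 h1.continuousAt

/-- The flow of the first order system, from `a` to `x` (clamped to `[a, b]`). -/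
noncomputable def flow (E x : ℝ) : PhaseSpace n →L[ℝ] PhaseSpace n :=
  ContinuousMap.evalCLM ℝ (projIcc p.a p.b p.a_lt_b.le x) ∘L p.resolvent E ∘L
    ContinuousLinearMap.const ℝ (Icc p.a p.b)

theorem flow_apply (E x : ℝ) (w : PhaseSpace n) :
    p.flow E x w = p.resolvent E (ContinuousMap.const _ w) (projIcc p.a p.b p.a_lt_b.le x) := rfl

theorem continuous_flow (x : ℝ) : Continuous fun E => p.flow E x := by
  have := p.continuous_resolvent
  unfold flow
  fun_prop

/-- Joint continuity in energy, position and data. Since the position is clamped to [a, b], it holds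
on the whole plane, where arguments of determinants can be lifted. -/
theorem continuous_flow_apply {X : Type*} [TopologicalSpace X] {E x : X → ℝ}
    {w : X → PhaseSpace n} (hE : Continuous E) (hx : Continuous x) (hw : Continuous w) :
    Continuous fun q => p.flow (E q) (x q) (w q) := by
  have h1 : Continuous fun q => p.resolvent (E q) (ContinuousMap.const _ (w q)) :=
    (p.continuous_resolvent.comp hE).clm_apply
      ((ContinuousLinearMap.const ℝ (Icc p.a p.b)).continuous.comp hw)
  exact h1.eval (continuous_projIcc.comp hx)

theorem flow_eq (E : ℝ) (w : PhaseSpace n) {x : ℝ} (hx : x ∈ Icc p.a p.b) :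
    p.flow E x w = w + ∫ t in p.a..x, p.coeff E t (p.flow E t w) := by
  have h1 : IsUnit (1 - p.systemVolterra E) :=
    isUnit_one_sub_volterra p.a_lt_b.le (p.intervalIntegrable_coeff E)
  have h2 := DFunLike.congr_fun (Ring.mul_inverse_cancel _ h1) (ContinuousMap.const _ w)
  have h3 := DFunLike.congr_fun h2 ⟨x, hx⟩
  change p.resolvent E (ContinuousMap.const _ w) ⟨x, hx⟩ -
    p.systemVolterra E (p.resolvent E (ContinuousMap.const _ w)) ⟨x, hx⟩ = w at h3
  rw [flow_apply, projIcc_of_mem _ hx]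
  rw [sub_eq_iff_eq_add] at h3
  exact h3

/-- Uniqueness: restricted to [a, b], the function solves (1 - K) z = w, and 1 - K is invertible. -/
theorem eq_flow (E : ℝ) (w : PhaseSpace n) {z : ℝ → PhaseSpace n}
    (hz : ContinuousOn z (Icc p.a p.b))
    (h : ∀ x ∈ Icc p.a p.b, z x = w + ∫ t in p.a..x, p.coeff E t (z t))
    {x : ℝ} (hx : x ∈ Icc p.a p.b) : z x = p.flow E x w := by
  have h1 : IsUnit (1 - p.systemVolterra E) :=
    isUnit_one_sub_volterra p.a_lt_b.le (p.intervalIntegrable_coeff E)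
  set ζ : C(Icc p.a p.b, PhaseSpace n) := ⟨(Icc p.a p.b).domRestrict z, hz.domRestrict⟩ with hζ
  have h2 : (1 - p.systemVolterra E) ζ = ContinuousMap.const _ w := by
    ext1 y
    change z y - ∫ t in p.a..y, p.coeff E t (IccExtend p.a_lt_b.le ζ t) = w
    rw [sub_eq_iff_eq_add, h y y.2]
    congr 1
    refine intervalIntegral.integral_congr fun t ht => ?_
    rw [uIcc_of_le y.2.1] at ht
    rw [IccExtend_of_mem _ _ ⟨ht.1, ht.2.trans y.2.2⟩]
    rfl
  have h3 := DFunLike.congr_fun (Ring.inverse_mul_cancel _ h1) ζ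
  have h4 : p.resolvent E (ContinuousMap.const _ w) = ζ := by
    rw [← h2]
    exact h3
  rw [flow_apply, h4, projIcc_of_mem _ hx]
  rfl

theorem flow_left (E : ℝ) (w : PhaseSpace n) : p.flow E p.a w = w := by
  simpa using p.flow_eq E w (left_mem_Icc.2 p.a_lt_b.le)

theorem isSolution_flow (E : ℝ) (w : PhaseSpace n) :
    p.IsSolution E (fun x => (p.flow E x w).1) (fun x => (p.flow E x w).2) := by
  have hc : Continuous fun x => p.flow E x w :=
    p.continuous_flow_apply continuous_const continuous_id continuous_const
  have hint : ∀ x ∈ Icc p.a p.b,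
      IntervalIntegrable (fun t => p.coeff E t (p.flow E t w)) volume p.a x := fun x hx =>
    p.intervalIntegrable_coeff_apply E (p.resolvent E (ContinuousMap.const _ w)) hx
  intro x hx
  constructor
  · have h1 : HasDerivAt (fun x => w.1 + ∫ t in p.a..x, (p.flow E t w).2) (p.flow E x w).2 x :=
      ((continuous_snd.comp hc).integral_hasStrictDerivAt p.a x).hasDerivAt.const_add _
    have h2 : ∀ x ∈ Icc p.a p.b, (p.flow E x w).1 = w.1 + ∫ t in p.a..x, (p.flow E t w).2 := by
      intro x hx
      rw [p.flow_eq E w hx, Prod.fst_add]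
      congr 1
      have h3 := (ContinuousLinearMap.fst ℝ (Fin n → ℝ) (Fin n → ℝ)).intervalIntegral_comp_comm
        (hint x hx)
      simp only [ContinuousLinearMap.coe_fst', coeff_apply] at h3
      rw [h3]
      simp only [coeff_apply]
    exact h1.hasDerivWithinAt.congr h2 (h2 x hx)
  · simp only [flow_left]
    conv_lhs => rw [p.flow_eq E w hx]
    rw [Prod.snd_add]
    congr 1
    have h3 := (ContinuousLinearMap.snd ℝ (Fin n → ℝ) (Fin n → ℝ)).intervalIntegral_comp_comm
      (hint x hx)
    simp only [ContinuousLinearMap.coe_snd', coeff_apply] at h3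
    rw [h3]
    simp only [coeff_apply]

variable {p} in
theorem IsSolution.continuousOn {E : ℝ} {y dy : ℝ → Fin n → ℝ} (h : p.IsSolution E y dy) :
    ContinuousOn y (Icc p.a p.b) := fun t ht => (h t ht).1.continuousWithinAt

variable {p} in
theorem IsSolution.continuousOn_deriv {E : ℝ} {y dy : ℝ → Fin n → ℝ} (h : p.IsSolution E y dy) :
    ContinuousOn dy (Icc p.a p.b) := by
  have h1 := intervalIntegral.continuousOn_primitive_interval
    ((intervalIntegrable_iff' (by simp)).1 (h.intervalIntegrable (right_mem_Icc.2 p.a_lt_b.le)))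
  rw [uIcc_of_le p.a_lt_b.le] at h1
  exact (continuousOn_const.add h1).congr fun x hx => (h x hx).2

variable {p} in
theorem IsSolution.eq_integral {E : ℝ} {y dy : ℝ → Fin n → ℝ} (h : p.IsSolution E y dy) {x : ℝ}
    (hx : x ∈ Icc p.a p.b) : y x = y p.a + ∫ t in p.a..x, dy t := by
  have hsub : Icc p.a x ⊆ Icc p.a p.b := Icc_subset_Icc_right hx.2
  rw [intervalIntegral.integral_eq_sub_of_hasDerivAt_of_le hx.1 (h.continuousOn.mono hsub)
    (fun t ht => (h t (hsub (Ioo_subset_Icc_self ht))).1.hasDerivAt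
      (Icc_mem_nhds ht.1 (ht.2.trans_le hx.2)))]
  · abel
  · refine ContinuousOn.intervalIntegrable ?_
    rw [uIcc_of_le hx.1]
    exact h.continuousOn_deriv.mono hsub

variable {p} in
theorem IsSolution.eq_flow {E : ℝ} {y dy : ℝ → Fin n → ℝ} (h : p.IsSolution E y dy) {x : ℝ}
    (hx : x ∈ Icc p.a p.b) : (y x, dy x) = p.flow E x (y p.a, dy p.a) := by
  refine p.eq_flow E _ (z := fun x => (y x, dy x)) (h.continuousOn.prodMk h.continuousOn_deriv)
    ?_ hx
  intro x hx
  have h1 : IntervalIntegrable dy volume p.a x := by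
    refine ContinuousOn.intervalIntegrable ?_
    rw [uIcc_of_le hx.1]
    exact h.continuousOn_deriv.mono (Icc_subset_Icc_right hx.2)
  simp only [coeff_apply]
  have h2 := h.intervalIntegrable hx
  have h3 : ∫ t in p.a..x, (dy t, (p.V t - E • (1 : Matrix (Fin n) (Fin n) ℝ)).mulVec (y t)) =
      (∫ t in p.a..x, dy t,
        ∫ t in p.a..x, (p.V t - E • (1 : Matrix (Fin n) (Fin n) ℝ)).mulVec (y t)) := by
    rw [intervalIntegral.integral_of_le hx.1, intervalIntegral.integral_of_le hx.1,
      intervalIntegral.integral_of_le hx.1]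
    exact integral_pair h1.1 h2.1
  rw [h3, Prod.mk_add_mk, ← h.eq_integral hx, ← (h x hx).2]

end MultichannelProblem

open MeasureTheory Set in
/-- Integration by parts for indefinite integrals. -/
theorem integral_mul_add_mul_eq_sub_of_primitive {f g F G : ℝ → ℝ} {a b : ℝ} (hab : a ≤ b)
    (hf : IntervalIntegrable f volume a b) (hg : IntervalIntegrable g volume a b)
    (hF : ∀ x ∈ Icc a b, F x = F a + ∫ t in a..x, f t)
    (hG : ∀ x ∈ Icc a b, G x = G a + ∫ t in a..x, g t) :
    ∫ x in a..b, (f x * G x + F x * g x) = F b * G b - F a * G a := by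
  -- `F` and `G` are controlled only on [a, b]; the explicit primitives that replace them are
  -- absolutely continuous.
  have hac : ∀ {f : ℝ → ℝ} (c : ℝ), IntervalIntegrable f volume a b →
      AbsolutelyContinuousOnInterval (fun x => c + ∫ t in a..x, f t) a b := fun {f} c hf =>
    ((LipschitzWith.const c).lipschitzOnWith.absolutelyContinuousOnInterval (K := 0)).fun_add
      (hf.absolutelyContinuousOnInterval_intervalIntegral (by simp))
  have h1 := (hac (F a) hf).integral_deriv_mul_eq_sub (hac (G a) hg)
  rw [← hF b (right_mem_Icc.2 hab), ← hG b (right_mem_Icc.2 hab), ← hF a (left_mem_Icc.2 hab),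
    ← hG a (left_mem_Icc.2 hab)] at h1
  rw [← h1]
  refine intervalIntegral.integral_congr_ae ?_
  filter_upwards [hf.ae_hasDerivAt_integral, hg.ae_hasDerivAt_integral] with x hx hx' hxm
  have hxm' := uIoc_subset_uIcc hxm
  rw [((hx hxm' a (by simp)).const_add (F a)).deriv, ((hx' hxm' a (by simp)).const_add (G a)).deriv]
  rw [uIcc_of_le hab] at hxm'
  rw [← hF x hxm', ← hG x hxm']

/-! ### Green's identity and the Lagrangian subspaces of boundary data -/

namespace MultichannelProblem

open MeasureTheory Set Matrix

variable {n : ℕ}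

/-- The symplectic form on the phase space. -/
def symp (w w' : PhaseSpace n) : ℝ := w.2 ⬝ᵥ w'.1 - w.1 ⬝ᵥ w'.2

theorem eq_zero_of_symp_eq_zero {w : PhaseSpace n} (h : ∀ w', symp w w' = 0) : w = 0 := by
  have h1 : w.2 = 0 := dotProduct_eq_zero _ fun u => by simpa [symp] using h (u, 0)
  have h2 : w.1 = 0 := dotProduct_eq_zero _ fun u => by simpa [symp] using h (0, u)
  exact Prod.ext h2 h1

variable (p : MultichannelProblem n)

/-- Green's identity. -/
theorem IsSolution.green {p : MultichannelProblem n} {E₁ E₂ : ℝ} {y dy z dz : ℝ → Fin n → ℝ}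
    (hy : p.IsSolution E₁ y dy) (hz : p.IsSolution E₂ z dz) {x : ℝ} (hx : x ∈ Icc p.a p.b) :
    symp (y x, dy x) (z x, dz x) - symp (y p.a, dy p.a) (z p.a, dz p.a) =
      (E₂ - E₁) * ∫ t in p.a..x, y t ⬝ᵥ z t := by
  have hsub : uIcc p.a x ⊆ Icc p.a p.b := by
    rw [uIcc_of_le hx.1]; exact Icc_subset_Icc_right hx.2
  have hsub' : Icc p.a x ⊆ Icc p.a p.b := Icc_subset_Icc_right hx.2
  -- Integration by parts for y' · z. Subtracting the same formula with the two solutions exchanged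
  -- cancels y' · z' and, by symmetry of V, the potential; only the difference of the energies
  -- remains.
  have key : ∀ {E₁ E₂ : ℝ} {y dy z dz : ℝ → Fin n → ℝ} (_ : p.IsSolution E₁ y dy)
      (_ : p.IsSolution E₂ z dz),
      IntervalIntegrable (fun t => (p.V t - E₁ • (1 : Matrix (Fin n) (Fin n) ℝ)).mulVec (y t) ⬝ᵥ
        z t + dy t ⬝ᵥ dz t) volume p.a x ∧
      ∫ t in p.a..x, ((p.V t - E₁ • (1 : Matrix (Fin n) (Fin n) ℝ)).mulVec (y t) ⬝ᵥ z t +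
        dy t ⬝ᵥ dz t) = dy x ⬝ᵥ z x - dy p.a ⬝ᵥ z p.a := by
    intro E₁ E₂ y dy z dz hy hz
    have hf : ∀ {x}, x ∈ Icc p.a p.b → ∀ i, IntervalIntegrable
        (fun t => (p.V t - E₁ • (1 : Matrix (Fin n) (Fin n) ℝ)).mulVec (y t) i)
        volume p.a x := fun {x} hx i => by
      have h1 := hy.intervalIntegrable hx
      exact ⟨h1.1.eval i, h1.2.eval i⟩
    have hdz : ∀ {x}, x ∈ Icc p.a p.b → IntervalIntegrable dz volume p.a x := fun {x} hx => by
      refine ContinuousOn.intervalIntegrable ?_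
      rw [uIcc_of_le hx.1]
      exact hz.continuousOn_deriv.mono (Icc_subset_Icc_right hx.2)
    have hev : ∀ {g : ℝ → Fin n → ℝ} {x : ℝ} (i : Fin n), IntervalIntegrable g volume p.a x →
        (∫ t in p.a..x, g t) i = ∫ t in p.a..x, g t i := fun {g x} i hg =>
      ((ContinuousLinearMap.proj (R := ℝ) (φ := fun _ : Fin n => ℝ) i).intervalIntegral_comp_comm
        hg).symm
    have hi : ∀ i, IntervalIntegrable
        (fun t => (p.V t - E₁ • (1 : Matrix (Fin n) (Fin n) ℝ)).mulVec (y t) i * z t i +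
          dy t i * dz t i) volume p.a x := by
      intro i
      refine IntervalIntegrable.add ((hf hx i).mul_continuousOn ?_)
        (ContinuousOn.intervalIntegrable ?_)
      · exact ((continuous_apply i).comp_continuousOn hz.continuousOn).mono hsub
      · exact (((continuous_apply i).comp_continuousOn hy.continuousOn_deriv).mul
          ((continuous_apply i).comp_continuousOn hz.continuousOn_deriv)).mono hsub
    have heq : (fun t => (p.V t - E₁ • (1 : Matrix (Fin n) (Fin n) ℝ)).mulVec (y t) ⬝ᵥ z t +
        dy t ⬝ᵥ dz t) = fun t => ∑ i,
          ((p.V t - E₁ • (1 : Matrix (Fin n) (Fin n) ℝ)).mulVec (y t) i * z t i +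
          dy t i * dz t i) := by
      funext t
      simp only [dotProduct, Finset.sum_add_distrib]
    rw [heq]
    constructor
    · rw [intervalIntegrable_iff]
      exact integrable_finsetSum _ fun i _ => intervalIntegrable_iff.1 (hi i)
    · rw [intervalIntegral.integral_finsetSum fun i _ => hi i]
      simp only [dotProduct]
      rw [← Finset.sum_sub_distrib]
      refine Finset.sum_congr rfl fun i _ => ?_
      refine integral_mul_add_mul_eq_sub_of_primitive (F := fun t => dy t i)
        (G := fun t => z t i) hx.1 (hf hx i) ⟨(hdz hx).1.eval i, (hdz hx).2.eval i⟩ ?_ ?_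
      · intro t ht
        rw [← hev i (hy.intervalIntegrable (hsub' ht)), ← Pi.add_apply, ← (hy t (hsub' ht)).2]
      · intro t ht
        rw [← hev i (hdz (hsub' ht)), ← Pi.add_apply, ← hz.eq_integral (hsub' ht)]
  obtain ⟨i1, h1⟩ := key hy hz
  obtain ⟨i2, h2⟩ := key hz hy
  have h3 : symp (y x, dy x) (z x, dz x) - symp (y p.a, dy p.a) (z p.a, dz p.a) =
      (dy x ⬝ᵥ z x - dy p.a ⬝ᵥ z p.a) - (dz x ⬝ᵥ y x - dz p.a ⬝ᵥ y p.a) := by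
    simp only [symp, dotProduct_comm (y _) (dz _)]
    ring
  rw [h3, ← h1, ← h2, ← intervalIntegral.integral_sub i1 i2, ← intervalIntegral.integral_const_mul]
  refine intervalIntegral.integral_congr fun t ht => ?_
  have hV : (p.V t).mulVec (y t) ⬝ᵥ z t = (p.V t).mulVec (z t) ⬝ᵥ y t := by
    rw [dotProduct_comm, dotProduct_mulVec, ← mulVec_transpose, (p.V_symm t (hsub ht)).eq]
  simp only [sub_mulVec, smul_mulVec, one_mulVec, sub_dotProduct, smul_dotProduct, smul_eq_mul, hV,
    dotProduct_comm (dy t), dotProduct_comm (z t) (y t)]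
  ring

theorem symp_flow (E₁ E₂ : ℝ) (w w' : PhaseSpace n) {x : ℝ} (hx : x ∈ Icc p.a p.b) :
    symp (p.flow E₁ x w) (p.flow E₂ x w') = symp w w' +
      (E₂ - E₁) * ∫ t in p.a..x, (p.flow E₁ t w).1 ⬝ᵥ (p.flow E₂ t w').1 := by
  have h := (p.isSolution_flow E₁ w).green (p.isSolution_flow E₂ w') hx
  simp only [flow_left] at h
  linarith

theorem symp_flow_self (E : ℝ) (w w' : PhaseSpace n) {x : ℝ} (hx : x ∈ Icc p.a p.b) :
    symp (p.flow E x w) (p.flow E x w') = symp w w' := by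
  simpa using p.symp_flow E E w w' hx

/-- The flow preserves a nondegenerate form, so it is injective; the dimension is finite. -/
theorem isUnit_flow (E : ℝ) {x : ℝ} (hx : x ∈ Icc p.a p.b) : IsUnit (p.flow E x) := by
  have h1 : Function.Injective (p.flow E x) := by
    refine (injective_iff_map_eq_zero _).2 fun w hw => eq_zero_of_symp_eq_zero fun w' => ?_
    rw [← p.symp_flow_self E w w' hx, hw]
    simp [symp]
  rw [ContinuousLinearMap.isUnit_iff_bijective]
  exact ⟨h1, LinearMap.injective_iff_surjective (f := (p.flow E x : PhaseSpace n →ₗ[ℝ] _)).1 h1⟩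

/-- The flow from `b` to `a`. -/
noncomputable def backFlow (E : ℝ) : PhaseSpace n →L[ℝ] PhaseSpace n := Ring.inverse (p.flow E p.b)

theorem flow_backFlow (E : ℝ) (w : PhaseSpace n) : p.flow E p.b (p.backFlow E w) = w :=
  DFunLike.congr_fun
    (Ring.mul_inverse_cancel _ (p.isUnit_flow E (right_mem_Icc.2 p.a_lt_b.le))) w

theorem backFlow_flow (E : ℝ) (w : PhaseSpace n) : p.backFlow E (p.flow E p.b w) = w :=
  DFunLike.congr_fun
    (Ring.inverse_mul_cancel _ (p.isUnit_flow E (right_mem_Icc.2 p.a_lt_b.le))) w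

theorem continuous_backFlow : Continuous p.backFlow := by
  rw [continuous_iff_continuousAt]
  intro E
  obtain ⟨u, hu⟩ := p.isUnit_flow E (right_mem_Icc.2 p.a_lt_b.le)
  have h3 := NormedRing.inverse_continuousAt (R := PhaseSpace n →L[ℝ] PhaseSpace n) u
  rw [hu] at h3
  exact ContinuousAt.comp (f := fun E => p.flow E p.b) h3 (p.continuous_flow p.b).continuousAt

/-- The frame of the Lagrangian subspace of data with `A₁ y + A₂ y' = 0`. -/
noncomputable def boundaryFrame (A₁ A₂ : Matrix (Fin n) (Fin n) ℝ) :
    (Fin n → ℝ) →L[ℝ] PhaseSpace n :=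
  LinearMap.toContinuousLinearMap (A₂ᵀ.mulVecLin.prod (-A₁ᵀ).mulVecLin)

theorem boundaryFrame_apply (A₁ A₂ : Matrix (Fin n) (Fin n) ℝ) (v : Fin n → ℝ) :
    boundaryFrame A₁ A₂ v = (A₂ᵀ *ᵥ v, (-A₁ᵀ) *ᵥ v) := rfl

/-- Consequently a vector satisfies the boundary condition exactly when it is symplectically
orthogonal to the frame. -/
theorem symp_boundaryFrame {A₁ A₂ : Matrix (Fin n) (Fin n) ℝ} (w : PhaseSpace n) (v : Fin n → ℝ) :
    symp (boundaryFrame A₁ A₂ v) w = - (v ⬝ᵥ (A₁ *ᵥ w.1 + A₂ *ᵥ w.2)) := by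
  simp only [symp, boundaryFrame_apply, neg_mulVec, neg_dotProduct, dotProduct_add,
    mulVec_transpose, dotProduct_mulVec]
  ring

theorem boundary_boundaryFrame {A₁ A₂ : Matrix (Fin n) (Fin n) ℝ}
    (h : A₁ * A₂ᵀ - A₂ * A₁ᵀ = 0) (v : Fin n → ℝ) :
    A₁ *ᵥ (boundaryFrame A₁ A₂ v).1 + A₂ *ᵥ (boundaryFrame A₁ A₂ v).2 = 0 := by
  simp only [boundaryFrame_apply, mulVec_mulVec, neg_mulVec, mulVec_neg]
  rw [← sub_eq_add_neg, ← sub_mulVec, h, zero_mulVec]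

/-- The kernel of the frame is that of the transpose of (A₁ | A₂), which has rank n on an
n-dimensional space. -/
theorem boundaryFrame_injective {A₁ A₂ : Matrix (Fin n) (Fin n) ℝ}
    (hr : (fromCols A₁ A₂).rank = n) : Function.Injective (boundaryFrame A₁ A₂) := by
  refine (injective_iff_map_eq_zero _).2 fun v hv => ?_
  have h1 : A₂ᵀ *ᵥ v = 0 := congrArg Prod.fst hv
  have h2 : A₁ᵀ *ᵥ v = 0 := by
    have := congrArg Prod.snd hv
    rw [boundaryFrame_apply] at this
    simpa [neg_mulVec] using this
  have h3 : (fromCols A₁ A₂)ᵀ *ᵥ v = 0 := by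
    rw [transpose_fromCols, fromRows_mulVec, h1, h2]
    ext (i | i) <;> rfl
  have h4 : (fromCols A₁ A₂)ᵀ.rank = n := by rw [rank_transpose, hr]
  have h5 := LinearMap.finrank_range_add_finrank_ker ((fromCols A₁ A₂)ᵀ).mulVecLin
  rw [← Matrix.rank, h4, Module.finrank_fin_fun] at h5
  have h6 : Module.finrank ℝ (LinearMap.ker ((fromCols A₁ A₂)ᵀ).mulVecLin) = 0 := by omega
  have h7 := Submodule.finrank_eq_zero.1 h6
  have h8 : v ∈ LinearMap.ker ((fromCols A₁ A₂)ᵀ).mulVecLin := h3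
  rw [h7] at h8
  exact h8

/-- Dimension count: the boundary condition has rank n on a space of dimension 2n, and its kernel
contains the n-dimensional range of the frame. -/
theorem exists_boundaryFrame_eq {A₁ A₂ : Matrix (Fin n) (Fin n) ℝ}
    (h : A₁ * A₂ᵀ - A₂ * A₁ᵀ = 0) (hr : (fromCols A₁ A₂).rank = n) {w : PhaseSpace n}
    (hw : A₁ *ᵥ w.1 + A₂ *ᵥ w.2 = 0) : ∃ v, boundaryFrame A₁ A₂ v = w := by
  set T : PhaseSpace n →ₗ[ℝ] (Fin n → ℝ) :=
    A₁.mulVecLin ∘ₗ LinearMap.fst ℝ _ _ + A₂.mulVecLin ∘ₗ LinearMap.snd ℝ _ _ with hT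
  have hTr : LinearMap.range T = LinearMap.range (fromCols A₁ A₂).mulVecLin := by
    ext u
    simp only [LinearMap.mem_range]
    constructor
    · rintro ⟨w, rfl⟩
      exact ⟨Sum.elim w.1 w.2, by simp [hT, fromCols_mulVec]⟩
    · rintro ⟨w, rfl⟩
      exact ⟨(w ∘ Sum.inl, w ∘ Sum.inr), by simp [hT, fromCols_mulVec]⟩
  have h1 := LinearMap.finrank_range_add_finrank_ker T
  rw [hTr, ← Matrix.rank, hr, Module.finrank_prod, Module.finrank_fin_fun] at h1
  have h2 : LinearMap.range (boundaryFrame A₁ A₂ : (Fin n → ℝ) →ₗ[ℝ] PhaseSpace n) ≤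
      LinearMap.ker T := by
    rintro _ ⟨v, rfl⟩
    exact boundary_boundaryFrame h v
  have h3 := LinearMap.finrank_range_of_inj
    (f := (boundaryFrame A₁ A₂ : (Fin n → ℝ) →ₗ[ℝ] PhaseSpace n)) (boundaryFrame_injective hr)
  rw [Module.finrank_fin_fun] at h3
  have h4 := Submodule.eq_of_le_of_finrank_eq h2 (by omega)
  have h5 : w ∈ LinearMap.ker T := hw
  rw [← h4] at h5
  exact h5

/-- The data at `x` of the solutions which satisfy the boundary condition at `a`. -/
noncomputable def leftMap (E x : ℝ) : (Fin n → ℝ) →L[ℝ] PhaseSpace n :=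
  p.flow E x ∘L boundaryFrame p.A₁ p.A₂

/-- The data at `x` of the solutions which satisfy the boundary condition at `b`. -/
noncomputable def rightMap (E x : ℝ) : (Fin n → ℝ) →L[ℝ] PhaseSpace n :=
  p.flow E x ∘L p.backFlow E ∘L boundaryFrame p.B₁ p.B₂

theorem leftMap_apply (E x : ℝ) (v : Fin n → ℝ) :
    p.leftMap E x v = p.flow E x (boundaryFrame p.A₁ p.A₂ v) := rfl

theorem rightMap_apply (E x : ℝ) (v : Fin n → ℝ) :
    p.rightMap E x v = p.flow E x (p.backFlow E (boundaryFrame p.B₁ p.B₂ v)) := rfl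

theorem leftMap_left (E : ℝ) (v : Fin n → ℝ) : p.leftMap E p.a v = boundaryFrame p.A₁ p.A₂ v := by
  rw [leftMap_apply, flow_left]

theorem rightMap_right (E : ℝ) (v : Fin n → ℝ) :
    p.rightMap E p.b v = boundaryFrame p.B₁ p.B₂ v := by
  rw [rightMap_apply, flow_backFlow]

theorem continuous_leftMap {X : Type*} [TopologicalSpace X] {E x : X → ℝ} {v : X → Fin n → ℝ}
    (hE : Continuous E) (hx : Continuous x) (hv : Continuous v) :
    Continuous fun q => p.leftMap (E q) (x q) (v q) :=
  p.continuous_flow_apply hE hx ((boundaryFrame p.A₁ p.A₂).continuous.comp hv)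

theorem continuous_rightMap {X : Type*} [TopologicalSpace X] {E x : X → ℝ} {v : X → Fin n → ℝ}
    (hE : Continuous E) (hx : Continuous x) (hv : Continuous v) :
    Continuous fun q => p.rightMap (E q) (x q) (v q) :=
  p.continuous_flow_apply hE hx ((p.continuous_backFlow.comp hE).clm_apply
    ((boundaryFrame p.B₁ p.B₂).continuous.comp hv))

theorem leftMap_injective (E : ℝ) {x : ℝ} (hx : x ∈ Icc p.a p.b) :
    Function.Injective (p.leftMap E x) :=
  (ContinuousLinearMap.isUnit_iff_bijective.1 (p.isUnit_flow E hx)).1.comp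
    (boundaryFrame_injective p.rank_A)

theorem rightMap_injective (E : ℝ) {x : ℝ} (hx : x ∈ Icc p.a p.b) :
    Function.Injective (p.rightMap E x) := by
  have h1 : Function.Injective (p.backFlow E) :=
    Function.LeftInverse.injective (g := p.flow E p.b) (p.flow_backFlow E)
  exact (ContinuousLinearMap.isUnit_iff_bijective.1 (p.isUnit_flow E hx)).1.comp
    (h1.comp (boundaryFrame_injective p.rank_B))

/-- The boundary term at `a` vanishes, because both data lie in the same Lagrangian subspace,
independent of the energy. Equal energies give isotropy; distinct ones give the monotonicity in E.
-/
theorem symp_leftMap (E₁ E₂ : ℝ) (v w : Fin n → ℝ) {x : ℝ} (hx : x ∈ Icc p.a p.b) :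
    symp (p.leftMap E₁ x v) (p.leftMap E₂ x w) =
      (E₂ - E₁) * ∫ t in p.a..x, (p.leftMap E₁ t v).1 ⬝ᵥ (p.leftMap E₂ t w).1 := by
  simp only [leftMap_apply]
  rw [symp_flow p _ _ _ _ hx, symp_boundaryFrame, boundary_boundaryFrame p.conj_A]
  simp

/-- Here the term at `b` vanishes. The flow starts at `a`, so Green's identity is used up to x and
up to `b` and subtracted; hence the sign opposite to that on the left. -/
theorem symp_rightMap (E₁ E₂ : ℝ) (v w : Fin n → ℝ) {x : ℝ} (hx : x ∈ Icc p.a p.b) :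
    symp (p.rightMap E₁ x v) (p.rightMap E₂ x w) =
      (E₁ - E₂) * ∫ t in x..p.b, (p.rightMap E₁ t v).1 ⬝ᵥ (p.rightMap E₂ t w).1 := by
  have hb : p.b ∈ Icc p.a p.b := right_mem_Icc.2 p.a_lt_b.le
  have hc : Continuous fun t => (p.rightMap E₁ t v).1 ⬝ᵥ (p.rightMap E₂ t w).1 :=
    Continuous.dotProduct
      (continuous_fst.comp (p.continuous_rightMap continuous_const continuous_id continuous_const))
      (continuous_fst.comp (p.continuous_rightMap continuous_const continuous_id continuous_const))
  have h1 := p.symp_flow E₁ E₂ (p.backFlow E₁ (boundaryFrame p.B₁ p.B₂ v))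
    (p.backFlow E₂ (boundaryFrame p.B₁ p.B₂ w)) hx
  have h2 := p.symp_flow E₁ E₂ (p.backFlow E₁ (boundaryFrame p.B₁ p.B₂ v))
    (p.backFlow E₂ (boundaryFrame p.B₁ p.B₂ w)) hb
  simp only [← rightMap_apply] at h1 h2
  rw [rightMap_right, rightMap_right, symp_boundaryFrame, boundary_boundaryFrame p.conj_B,
    ← intervalIntegral.integral_add_adjacent_intervals (hc.intervalIntegrable _ x)
      (hc.intervalIntegrable x _)] at h2
  simp only [dotProduct_zero, neg_zero] at h2
  rw [h1]
  linarith

end MultichannelProblem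

/-! ### Angles of a pair of matrices and the determinant of Q + iP -/

namespace EigenAngles

open Matrix Complex

variable {n : ℕ}

/-- The complex matrix `Q + i P` of a pair of real matrices. -/
noncomputable def complexFrame (P Q : Matrix (Fin n) (Fin n) ℝ) : Matrix (Fin n) (Fin n) ℂ :=
  ofRealHom.mapMatrix Q + I • ofRealHom.mapMatrix P

/-- `P Q⁻¹` is diagonalizable over `ℝ`, with eigenvalues `tan φ_j`. -/
def Factorizes (P Q : Matrix (Fin n) (Fin n) ℝ) (φ : Fin n → ℝ) : Prop :=
  ∃ A B : Matrix (Fin n) (Fin n) ℝ, IsUnit A.det ∧ IsUnit B.det ∧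
    P = A * diagonal (fun j => Real.sin (φ j)) * B ∧ Q = A * diagonal (fun j => Real.cos (φ j)) * B

/-- The determinant of Q + tP is a real polynomial in t. Its value at t = i is nonzero, so it is not
the zero polynomial. -/
theorem exists_isUnit_det_add_smul {P Q : Matrix (Fin n) (Fin n) ℝ}
    (h : (complexFrame P Q).det ≠ 0) : ∃ t : ℝ, IsUnit (Q + t • P).det := by
  set f : Polynomial ℝ :=
    (Polynomial.C.mapMatrix Q + (Polynomial.X : Polynomial ℝ) • Polynomial.C.mapMatrix P).det with hf
  have h1 : ∀ t : ℝ, f.eval t = (Q + t • P).det := by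
    intro t
    rw [← Polynomial.coe_evalRingHom, hf, RingHom.map_det]
    congr 1
    ext i j
    simpa using mul_comm _ _
  have h2 : Polynomial.aeval I f = (complexFrame P Q).det := by
    rw [hf, AlgHom.map_det]
    congr 1
    ext i j
    simpa [complexFrame] using mul_comm _ _
  by_contra! hcon
  refine h ?_
  have h3 : f = 0 := Polynomial.funext fun t => by
    rw [h1, Polynomial.eval_zero]
    by_contra h4
    exact hcon t (isUnit_iff_ne_zero.2 h4)
  rw [← h2, h3, map_zero]

/-- Q may be singular, so the pair is first rotated to (N, M) with M invertible. The symmetry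
hypothesis survives the rotation and makes N M⁻¹ symmetric; the spectral theorem then supplies the
orthogonal factor. -/
theorem exists_orthogonal_factorization {P Q : Matrix (Fin n) (Fin n) ℝ} (hs : Pᵀ * Q = Qᵀ * P)
    (h : (complexFrame P Q).det ≠ 0) :
    ∃ (φ : Fin n → ℝ) (A B : Matrix (Fin n) (Fin n) ℝ), Aᵀ * A = 1 ∧ IsUnit B.det ∧
      P = A * diagonal (fun j => Real.sin (φ j)) * B ∧
      Q = A * diagonal (fun j => Real.cos (φ j)) * B := by
  obtain ⟨t, ht⟩ := exists_isUnit_det_add_smul h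
  -- With this angle, M below is cos α times the invertible matrix Q + tP.
  set α := Real.arctan t with hα
  have hc : Real.cos α ≠ 0 := (Real.cos_arctan_pos t).ne'
  have htan : t = Real.sin α / Real.cos α := by
    rw [← Real.tan_eq_sin_div_cos, hα, Real.tan_arctan]
  set M := Real.cos α • Q + Real.sin α • P with hM
  set N := Real.cos α • P - Real.sin α • Q with hN
  have hMu : IsUnit M.det := by
    have : M = Real.cos α • (Q + t • P) := by
      rw [hM, smul_add, smul_smul, htan, mul_div_cancel₀ _ hc]
    rw [this, det_smul]
    exact (isUnit_iff_ne_zero.2 (pow_ne_zero _ hc)).mul ht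
  have hMN : Mᵀ * N = Nᵀ * M := by
    simp only [hM, hN, transpose_add, transpose_sub, transpose_smul, add_mul, mul_add, mul_sub,
      sub_mul, smul_mul_assoc, mul_smul_comm, hs]
    module
  have hPeq : P = Real.sin α • M + Real.cos α • N := by
    have h1 : Real.sin α • M + Real.cos α • N =
        (Real.sin α ^ 2 + Real.cos α ^ 2) • P := by
      rw [hM, hN]; module
    rw [h1, Real.sin_sq_add_cos_sq, one_smul]
  have hQeq : Q = Real.cos α • M - Real.sin α • N := by
    have h1 : Real.cos α • M - Real.sin α • N =
        (Real.sin α ^ 2 + Real.cos α ^ 2) • Q := by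
      rw [hM, hN]; module
    rw [h1, Real.sin_sq_add_cos_sq, one_smul]
  have hS : (N * M⁻¹).IsHermitian := by
    rw [IsHermitian, conjTranspose_eq_transpose_of_trivial, transpose_mul, transpose_nonsing_inv]
    have h2 : IsUnit Mᵀ.det := by rwa [det_transpose]
    calc Mᵀ⁻¹ * Nᵀ = Mᵀ⁻¹ * (Nᵀ * M) * M⁻¹ := by
          rw [← Matrix.mul_assoc, Matrix.mul_assoc, mul_nonsing_inv M hMu, Matrix.mul_one]
      _ = N * M⁻¹ := by
          rw [← hMN, ← Matrix.mul_assoc, nonsing_inv_mul _ h2, Matrix.one_mul]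
  obtain ⟨U, V, μ, hVU, hUV, hμ⟩ : ∃ (U V : Matrix (Fin n) (Fin n) ℝ) (μ : Fin n → ℝ),
      Uᵀ = V ∧ U * V = 1 ∧ N * M⁻¹ = U * diagonal μ * V := by
    refine ⟨hS.eigenvectorUnitary, star (hS.eigenvectorUnitary : Matrix (Fin n) (Fin n) ℝ),
      hS.eigenvalues, ?_, Unitary.mul_star_self_of_mem hS.eigenvectorUnitary.2, ?_⟩
    · rw [star_eq_conjTranspose, conjTranspose_eq_transpose_of_trivial]
    conv_lhs => rw [hS.spectral_theorem]
    rw [Unitary.conjStarAlgAut_apply]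
    rfl
  have hNeq : N = U * diagonal μ * V * M := by
    rw [← hμ, Matrix.mul_assoc, nonsing_inv_mul M hMu, Matrix.mul_one]
  have hdet : U.det * V.det = 1 := by rw [← det_mul, hUV, det_one]
  set β : Fin n → ℝ := fun j => Real.arctan (μ j) with hβ
  have hcβ : ∀ j, Real.cos (β j) ≠ 0 := fun j => (Real.cos_arctan_pos _).ne'
  have hμβ : ∀ j, μ j = Real.sin (β j) / Real.cos (β j) := fun j => by
    rw [← Real.tan_eq_sin_div_cos, hβ, Real.tan_arctan]
  have hscal : ∀ c : ℝ, c • M = U * diagonal (fun _ => c) * V * M := by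
    intro c
    rw [← smul_one_eq_diagonal, mul_smul_comm, Matrix.mul_one, smul_mul_assoc, smul_mul_assoc, hUV,
      Matrix.one_mul]
  -- The eigenvalues of N M⁻¹ are tan β_j; undoing the rotation adds α to each angle. The factor 1 /
  -- cos β_j, which turns tangents into sines and cosines, is absorbed in B.
  refine ⟨fun j => α + β j, U, diagonal (fun j => (Real.cos (β j))⁻¹) * V * M,
    by rw [hVU]; exact mul_eq_one_comm.1 hUV, ?_, ?_, ?_⟩
  · rw [det_mul, det_mul, det_diagonal]
    refine (IsUnit.mul ?_ (IsUnit.of_mul_eq_one _ ((mul_comm _ _).trans hdet))).mul hMu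
    exact isUnit_iff_ne_zero.2 (Finset.prod_ne_zero_iff.2 fun j _ => inv_ne_zero (hcβ j))
  · calc P = U * (diagonal (fun _ => Real.sin α) + Real.cos α • diagonal μ) * V * M := by
          conv_lhs => rw [hPeq, hscal, hNeq]
          simp only [mul_add, add_mul, mul_smul_comm, smul_mul_assoc]
      _ = _ := by
          rw [← Matrix.mul_assoc, ← Matrix.mul_assoc, Matrix.mul_assoc U (diagonal _) (diagonal _),
            diagonal_mul_diagonal, ← diagonal_smul, diagonal_add]
          congr 4
          funext j
          have := hcβ j
          rw [Pi.smul_apply, hμβ, Real.sin_add, smul_eq_mul]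
          field_simp
  · calc Q = U * (diagonal (fun _ => Real.cos α) - Real.sin α • diagonal μ) * V * M := by
          conv_lhs => rw [hQeq, hscal, hNeq]
          simp only [mul_sub, sub_mul, mul_smul_comm, smul_mul_assoc]
      _ = _ := by
          rw [← Matrix.mul_assoc, ← Matrix.mul_assoc, Matrix.mul_assoc U (diagonal _) (diagonal _),
            diagonal_mul_diagonal, ← diagonal_smul, diagonal_sub]
          congr 4
          funext j
          have := hcβ j
          rw [Pi.smul_apply, hμβ, Real.cos_add, smul_eq_mul]
          field_simp

theorem exists_factorizes {P Q : Matrix (Fin n) (Fin n) ℝ} (hs : Pᵀ * Q = Qᵀ * P)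
    (h : (complexFrame P Q).det ≠ 0) : ∃ φ, Factorizes P Q φ := by
  obtain ⟨φ, A, B, hA, hB, hP, hQ⟩ := exists_orthogonal_factorization hs h
  refine ⟨φ, A, B, IsUnit.of_mul_eq_one Aᵀ.det ?_, hB, hP, hQ⟩
  rw [mul_comm, ← det_mul, hA, det_one]

theorem Factorizes.of_mul_left {P Q R : Matrix (Fin n) (Fin n) ℝ} {φ : Fin n → ℝ}
    (hR : IsUnit R.det) (h : Factorizes (R * P) (R * Q) φ) : Factorizes P Q φ := by
  obtain ⟨A, B, hA, hB, hP, hQ⟩ := h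
  have h1 : R⁻¹ * R = 1 := nonsing_inv_mul R hR
  refine ⟨R⁻¹ * A, B, ?_, hB, ?_, ?_⟩
  · rw [det_mul]
    exact (isUnit_nonsing_inv_det R hR).mul hA
  · rw [Matrix.mul_assoc, Matrix.mul_assoc, ← Matrix.mul_assoc A, ← hP, ← Matrix.mul_assoc, h1,
      Matrix.one_mul]
  · rw [Matrix.mul_assoc, Matrix.mul_assoc, ← Matrix.mul_assoc A, ← hQ, ← Matrix.mul_assoc, h1,
      Matrix.one_mul]

theorem cos_smul_sub_sin_smul (A B : Matrix (Fin n) (Fin n) ℝ) (φ : Fin n → ℝ) (θ : ℝ) :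
    Real.cos θ • (A * diagonal (fun j => Real.sin (φ j)) * B) -
      Real.sin θ • (A * diagonal (fun j => Real.cos (φ j)) * B) =
      A * diagonal (fun j => Real.sin (φ j - θ)) * B := by
  rw [← smul_mul_assoc, ← mul_smul_comm, ← smul_mul_assoc, ← mul_smul_comm, ← sub_mul, ← mul_sub,
    ← diagonal_smul, ← diagonal_smul, diagonal_sub]
  congr 3
  funext j
  simp only [Pi.smul_apply, smul_eq_mul, Real.sin_sub]
  ring

/-- The invertible outer factors do not affect the rank, so the kernel has as many dimensions as
there are zeros among the sin (φ_j - θ). -/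
theorem Factorizes.hasEigenAngles {P Q : Matrix (Fin n) (Fin n) ℝ} {φ : Fin n → ℝ}
    (h : Factorizes P Q φ) : HasEigenAngles P Q φ := by
  classical
  obtain ⟨A, B, hA, hB, rfl, rfl⟩ := h
  intro θ
  rw [cos_smul_sub_sin_smul]
  set D : Matrix (Fin n) (Fin n) ℝ := diagonal (fun j => Real.sin (φ j - θ)) with hD
  have h1 := LinearMap.finrank_range_add_finrank_ker (A * D * B).mulVecLin
  rw [← Matrix.rank, rank_mul_eq_left_of_isUnit_det _ _ hB, rank_mul_eq_right_of_isUnit_det _ _ hA,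
    show D.rank = _ from rank_diagonal _, Module.finrank_fin_fun] at h1
  have h3 : {j | ∃ k : ℤ, φ j = θ + k * Real.pi}.ncard =
      Fintype.card {j // Real.sin (φ j - θ) = 0} := by
    rw [← Nat.card_coe_set_eq, ← Nat.card_eq_fintype_card]
    refine Nat.card_congr (Equiv.subtypeEquivRight fun j => ?_)
    rw [Set.mem_ofPred_eq, Real.sin_eq_zero_iff]
    refine exists_congr fun k => ?_
    constructor <;> intro h <;> linarith
  have h4 : Fintype.card {j // Real.sin (φ j - θ) = 0} ≤ n := by
    simpa using Fintype.card_subtype_le (fun j => Real.sin (φ j - θ) = 0)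
  rw [h3]
  simp only [ne_eq, Fintype.card_subtype_compl, Fintype.card_fin] at h1
  omega

/-- The `π`-periodic factor `exp (- i x) sin (x - θ)`. -/
noncomputable def detFactor (θ x : ℝ) : ℂ := exp (-(I * x)) * Real.sin (x - θ)

theorem continuous_detFactor (θ : ℝ) : Continuous (detFactor θ) := by
  unfold detFactor
  fun_prop

/-- The factor is affine in exp (-2ix). This gives the period π, and makes the product over j a
polynomial evaluated at exp (-2iθ), up to a nonzero scalar. -/
theorem detFactor_eq (θ x : ℝ) :
    detFactor θ x = exp (I * θ) / (2 * I) * (exp (-(2 * I * θ)) - exp (-(2 * I * x))) := by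
  rw [detFactor, ofReal_sin, Complex.sin]
  have h1 : exp (I * θ) * exp (-(2 * I * θ)) = exp (-(I * θ)) := by
    rw [← Complex.exp_add]; ring_nf
  have h2 : exp (-(I * x)) * exp (((x - θ : ℝ) : ℂ) * I) = exp (-(I * θ)) := by
    rw [← Complex.exp_add]; push_cast; ring_nf
  have h3 : exp (-(I * x)) * exp (-((x - θ : ℝ) : ℂ) * I) = exp (I * θ) * exp (-(2 * I * x)) := by
    rw [← Complex.exp_add, ← Complex.exp_add]; push_cast; ring_nf
  calc exp (-(I * x)) * ((exp (-((x - θ : ℝ) : ℂ) * I) - exp (((x - θ : ℝ) : ℂ) * I)) * I / 2)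
      = (exp (-(I * x)) * exp (-((x - θ : ℝ) : ℂ) * I) -
          exp (-(I * x)) * exp (((x - θ : ℝ) : ℂ) * I)) * I / 2 := by ring
    _ = (exp (-(I * θ)) - exp (I * θ) * exp (-(2 * I * x))) / (2 * I) := by
        rw [h2, h3]
        field_simp
        rw [I_sq]
        ring
    _ = _ := by rw [← h1]; ring

theorem exp_neg_two_mul_eq_iff (x y : ℝ) :
    exp (-(2 * I * x)) = exp (-(2 * I * y)) ↔ ∃ k : ℤ, x = y + k * Real.pi := by
  rw [Complex.exp_eq_exp_iff_exists_int]
  constructor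
  · rintro ⟨k, hk⟩
    refine ⟨-k, ?_⟩
    have h1 : (2 * I) * (x : ℂ) = (2 * I) * ((y + (-k : ℤ) * Real.pi : ℝ) : ℂ) := by
      push_cast
      linear_combination -hk
    exact_mod_cast mul_left_cancel₀ (by simp) h1
  · rintro ⟨k, rfl⟩
    refine ⟨-k, ?_⟩
    push_cast
    ring

theorem detFactor_add_int_mul_pi (θ x : ℝ) (k : ℤ) :
    detFactor θ (x + k * Real.pi) = detFactor θ x := by
  rw [detFactor_eq, detFactor_eq, (exp_neg_two_mul_eq_iff _ x).2 ⟨k, rfl⟩]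

/-- The determinants of `cos θ P - sin θ Q` are those given by the angles `φ`. -/
def DetEq (P Q : Matrix (Fin n) (Fin n) ℝ) (φ : Fin n → ℝ) : Prop :=
  ∀ θ : ℝ, (((Real.cos θ • P - Real.sin θ • Q).det : ℝ) : ℂ) =
    (complexFrame P Q).det * ∏ j, detFactor θ (φ j)

theorem det_complexFrame (A B : Matrix (Fin n) (Fin n) ℝ) (φ : Fin n → ℝ) :
    (complexFrame (A * diagonal (fun j => Real.sin (φ j)) * B)
      (A * diagonal (fun j => Real.cos (φ j)) * B)).det =
      ((A.det * B.det : ℝ) : ℂ) * exp (I * (∑ j, φ j : ℝ)) := by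
  have h1 : complexFrame (A * diagonal (fun j => Real.sin (φ j)) * B)
      (A * diagonal (fun j => Real.cos (φ j)) * B) =
      ofRealHom.mapMatrix A * diagonal (fun j => exp (I * φ j)) * ofRealHom.mapMatrix B := by
    rw [complexFrame, map_mul, map_mul, map_mul, map_mul, ← smul_mul_assoc, ← mul_smul_comm,
      ← add_mul, ← mul_add]
    congr 2
    ext i j
    by_cases hij : i = j
    · subst hij
      simp [Complex.exp_mul_I, mul_comm I]
    · simp [hij]
  rw [h1, det_mul, det_mul, det_diagonal, ← RingHom.map_det, ← RingHom.map_det, ← Complex.exp_sum,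
    ← Finset.mul_sum]
  push_cast
  simp only [ofRealHom_eq_coe]
  ring

/-- The phase exp (i Σ φ_j) of det (Q + iP) cancels the exponentials in the factors. Unlike the
kernel dimensions in `HasEigenAngles`, this identity passes to limits, which is what the continuity
proof needs. -/
theorem Factorizes.detEq {P Q : Matrix (Fin n) (Fin n) ℝ} {φ : Fin n → ℝ}
    (h : Factorizes P Q φ) : DetEq P Q φ := by
  obtain ⟨A, B, hA, hB, rfl, rfl⟩ := h
  intro θ
  rw [cos_smul_sub_sin_smul, det_complexFrame, det_mul, det_mul, det_diagonal]
  simp only [detFactor, Finset.prod_mul_distrib, ← Complex.exp_sum]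
  have h1 : exp (I * (∑ j, φ j : ℝ)) * exp (∑ j, -(I * (φ j : ℂ))) = 1 := by
    rw [← Complex.exp_add, ofReal_sum, Finset.mul_sum, ← Finset.sum_add_distrib]
    simp
  push_cast
  rw [ofReal_sum] at h1
  linear_combination (-(A.det : ℂ) * B.det * ∏ j, Complex.sin (φ j - θ)) * h1

theorem Factorizes.det_ne_zero {P Q : Matrix (Fin n) (Fin n) ℝ} {φ : Fin n → ℝ}
    (h : Factorizes P Q φ) : (complexFrame P Q).det ≠ 0 := by
  obtain ⟨A, B, hA, hB, rfl, rfl⟩ := h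
  rw [det_complexFrame]
  refine mul_ne_zero ?_ (Complex.exp_ne_zero _)
  exact_mod_cast mul_ne_zero hA.ne_zero hB.ne_zero

/-- Two families of angles agree modulo `π`, with multiplicities. -/
def SameAngles (φ ψ : Fin n → ℝ) : Prop :=
  ∀ θ : ℝ, {j | ∃ k : ℤ, φ j = θ + k * Real.pi}.ncard = {j | ∃ k : ℤ, ψ j = θ + k * Real.pi}.ncard

theorem SameAngles.trans {φ ψ χ : Fin n → ℝ} (h : SameAngles φ ψ) (h' : SameAngles ψ χ) :
    SameAngles φ χ := fun θ => (h θ).trans (h' θ)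

theorem sameAngles_of_hasEigenAngles {P Q : Matrix (Fin n) (Fin n) ℝ} {φ ψ : Fin n → ℝ}
    (h : HasEigenAngles P Q φ) (h' : HasEigenAngles P Q ψ) : SameAngles φ ψ :=
  fun θ => (h θ).trans (h' θ).symm

theorem SameAngles.hasEigenAngles {P Q : Matrix (Fin n) (Fin n) ℝ} {φ ψ : Fin n → ℝ}
    (h : SameAngles φ ψ) (h' : HasEigenAngles P Q φ) : HasEigenAngles P Q ψ :=
  fun θ => (h θ).symm.trans (h' θ)

theorem sameAngles_of_perm {φ ψ : Fin n → ℝ} (σ : Equiv.Perm (Fin n)) (k : Fin n → ℤ)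
    (h : ∀ j, ψ j = φ (σ j) + k j * Real.pi) : SameAngles φ ψ := by
  intro θ
  rw [← Nat.card_coe_set_eq, ← Nat.card_coe_set_eq]
  refine (Nat.card_congr (σ.subtypeEquiv fun j => ?_)).symm
  simp only [Set.mem_ofPred_eq]
  constructor
  · rintro ⟨l, hl⟩
    exact ⟨l - k j, by push_cast; linarith [h j]⟩
  · rintro ⟨l, hl⟩
    exact ⟨l + k j, by push_cast; linarith [h j]⟩

theorem coe_addCircle_pi_eq_iff (x y : ℝ) :
    (x : AddCircle Real.pi) = y ↔ ∃ k : ℤ, x = y + k * Real.pi := by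
  rw [QuotientAddGroup.eq_iff_sub_mem, AddSubgroup.mem_zmultiples_iff]
  refine exists_congr fun k => ?_
  rw [zsmul_eq_mul]
  constructor <;> intro h <;> linarith

/-- The fibres of both families over each point of the circle ℝ / πℤ are equinumerous; bijections of
the fibres glue to a permutation. -/
theorem SameAngles.exists_perm {φ ψ : Fin n → ℝ} (h : SameAngles φ ψ) :
    ∃ (σ : Equiv.Perm (Fin n)) (k : Fin n → ℤ), ∀ j, ψ j = φ (σ j) + k j * Real.pi := by
  have h1 : ∀ c : AddCircle Real.pi, Nonempty
      ({j // (ψ j : AddCircle Real.pi) = c} ≃ {j // (φ j : AddCircle Real.pi) = c}) := by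
    intro c
    obtain ⟨θ, rfl⟩ := QuotientAddGroup.mk_surjective c
    have h2 : ∀ χ : Fin n → ℝ, {j | ∃ k : ℤ, χ j = θ + k * Real.pi}.ncard =
        Nat.card {j // (χ j : AddCircle Real.pi) = θ} := fun χ => by
      rw [← Nat.card_coe_set_eq]
      exact Nat.card_congr (Equiv.subtypeEquivRight fun j => (coe_addCircle_pi_eq_iff _ _).symm)
    have h3 := h θ
    rw [h2, h2] at h3
    exact Finite.card_eq.1 h3.symm
  have e := fun c => (h1 c).some
  have h4 := fun j => (coe_addCircle_pi_eq_iff _ _).1 (Equiv.ofFiberEquiv_map e j).symm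
  choose k hk using h4
  exact ⟨Equiv.ofFiberEquiv e, k, hk⟩

theorem SameAngles.detEq {P Q : Matrix (Fin n) (Fin n) ℝ} {φ ψ : Fin n → ℝ}
    (h : SameAngles φ ψ) (h' : DetEq P Q φ) : DetEq P Q ψ := by
  obtain ⟨σ, k, hk⟩ := h.exists_perm
  intro θ
  rw [h' θ]
  congr 1
  simp only [hk, detFactor_add_int_mul_pi]
  exact (Equiv.prod_comp σ fun j => detFactor θ (φ j)).symm

/-- The monic polynomials with roots exp (-2iφ_j) and exp (-2iψ_j) agree at infinitely many points
of the unit circle, so they are equal. Root multiplicities count the angles in each class modulo π.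
-/
theorem sameAngles_of_detEq {P Q : Matrix (Fin n) (Fin n) ℝ} {φ ψ : Fin n → ℝ}
    (h0 : (complexFrame P Q).det ≠ 0) (h : DetEq P Q φ) (h' : DetEq P Q ψ) : SameAngles φ ψ := by
  classical
  set f : (Fin n → ℝ) → Polynomial ℂ := fun χ =>
    ∏ j, (Polynomial.X - Polynomial.C (exp (-(2 * I * χ j)))) with hf
  have hroots : ∀ χ, (f χ).roots = Finset.univ.val.map fun j => exp (-(2 * I * χ j)) := by
    intro χ
    have := Polynomial.roots_multiset_prod_X_sub_C
      (Finset.univ.val.map fun j => exp (-(2 * I * (χ j : ℂ))))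
    rwa [Multiset.map_map] at this
  have hcount : ∀ (χ : Fin n → ℝ) (θ : ℝ), (f χ).roots.count (exp (-(2 * I * θ))) =
      {j | ∃ k : ℤ, χ j = θ + k * Real.pi}.ncard := by
    intro χ θ
    rw [hroots, Multiset.count_map, ← Finset.filter_val, Finset.card_val, ← Set.ncard_coe_finset]
    congr 1
    ext j
    simp only [Finset.coe_filter, Finset.mem_univ, true_and, Set.mem_ofPred_eq]
    rw [eq_comm, exp_neg_two_mul_eq_iff]
  have heq : f φ = f ψ := by
    have hinf : (Set.range fun θ : Set.Ico 0 Real.pi => exp (-(2 * I * (θ : ℝ)))).Infinite := by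
      have : Infinite (Set.Ico 0 Real.pi) := (Set.Ico_infinite Real.pi_pos).to_subtype
      refine Set.infinite_range_of_injective fun x y hxy => ?_
      obtain ⟨k, hk⟩ := (exp_neg_two_mul_eq_iff _ _).1 hxy
      have hx := x.2
      have hy := y.2
      have h1 : k < 1 := by
        by_contra hk1
        have : (1 : ℝ) ≤ k := by exact_mod_cast not_lt.1 hk1
        nlinarith [hx.2, hy.1, Real.pi_pos]
      have h2 : -1 < k := by
        by_contra hk1
        have : (k : ℝ) ≤ -1 := by exact_mod_cast not_lt.1 hk1
        nlinarith [hx.1, hy.2, Real.pi_pos]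
      have h3 : k = 0 := by omega
      rw [h3] at hk
      exact Subtype.ext (by simpa using hk)
    refine Polynomial.eq_of_infinite_eval_eq _ _ (hinf.mono ?_)
    rintro _ ⟨θ, rfl⟩
    have h1 := mul_left_cancel₀ h0 ((h θ).symm.trans (h' θ))
    simp only [detFactor_eq, Finset.prod_mul_distrib, Finset.prod_const] at h1
    have h2 := mul_left_cancel₀ (pow_ne_zero _ (by simp)) h1
    simpa [hf, Polynomial.eval_prod] using h2
  intro θ
  rw [← hcount, ← hcount, heq]

theorem Factorizes.detEq_of_hasEigenAngles {P Q : Matrix (Fin n) (Fin n) ℝ} {φ ψ : Fin n → ℝ}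
    (h : Factorizes P Q φ) (h' : HasEigenAngles P Q ψ) : DetEq P Q ψ :=
  (sameAngles_of_hasEigenAngles h.hasEigenAngles h').detEq h.detEq

theorem Factorizes.hasEigenAngles_of_detEq {P Q : Matrix (Fin n) (Fin n) ℝ} {φ ψ : Fin n → ℝ}
    (h : Factorizes P Q φ) (h' : DetEq P Q ψ) : HasEigenAngles P Q ψ :=
  (sameAngles_of_detEq h.det_ne_zero h.detEq h').hasEigenAngles h.hasEigenAngles

/-- The argument of `det (Q + i P)` is the sum of the angles, modulo `π`. -/
theorem Factorizes.exists_sum_eq {P Q : Matrix (Fin n) (Fin n) ℝ} {φ ψ : Fin n → ℝ}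
    (h : Factorizes P Q φ) (h' : HasEigenAngles P Q ψ) {r s : ℝ}
    (hs : (complexFrame P Q).det = r * exp (I * s)) : ∃ k : ℤ, s = ∑ j, ψ j + k * Real.pi := by
  obtain ⟨σ, l, hl⟩ := (sameAngles_of_hasEigenAngles h.hasEigenAngles h').exists_perm
  have h0 := h.det_ne_zero
  obtain ⟨A, B, hA, hB, rfl, rfl⟩ := h
  have hsum : ∑ j, ψ j = ∑ j, φ j + (∑ j, l j : ℤ) * Real.pi := by
    simp only [hl, Finset.sum_add_distrib, Equiv.sum_comp σ φ, Int.cast_sum, Finset.sum_mul]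
  set S := ∑ j, φ j
  rw [hs] at h0
  have hr : r ≠ 0 := by
    rintro rfl
    simp at h0
  rw [det_complexFrame] at hs
  -- Both amplitudes are real but of unknown sign, so the arguments agree only modulo π.
  have h1 : ((A.det * B.det : ℝ) : ℂ) = r * exp (I * (s - S : ℝ)) := by
    have : exp (I * (s - S : ℝ)) * exp (I * S) = exp (I * s) := by
      rw [← Complex.exp_add]; push_cast; ring_nf
    rw [← this, ← mul_assoc] at hs
    exact mul_right_cancel₀ (Complex.exp_ne_zero _) hs
  have h2 := congrArg Complex.im h1
  rw [ofReal_im, im_ofReal_mul, mul_comm I, exp_ofReal_mul_I_im] at h2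
  have h3 : Real.sin (s - S) = 0 := by
    rcases mul_eq_zero.1 h2.symm with h | h
    · exact absurd h hr
    · exact h
  obtain ⟨k, hk⟩ := Real.sin_eq_zero_iff.1 h3
  refine ⟨k - ∑ j, l j, ?_⟩
  rw [hsum]
  push_cast
  push_cast at hsum
  linarith

end EigenAngles

/-! ### Ordered angles and their continuity -/

namespace EigenAngles

open Matrix Complex Filter Topology

variable {n : ℕ}

/-- Angles in increasing order which spread over an interval of length at most `π`. -/
structure IsOrdered (φ : Fin n → ℝ) : Prop where
  mono : ∀ i j, i ≤ j → φ i ≤ φ j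
  le_add_pi : ∀ i j, φ j ≤ φ i + Real.pi

/-- If φ_i ≤ t, the terms with j ≤ i are at least 1 and the others at least 0. If t < φ_i, the terms
with j < i are at most 1 and the others at most 0. Both use that the angles spread over at most π.
The sum depends only on the classes modulo π and the total of the angles, hence so does φ_i. -/
theorem IsOrdered.le_iff {φ : Fin n → ℝ} (h : IsOrdered φ) (i : Fin n) (t : ℝ) :
    φ i ≤ t ↔ (i : ℤ) + 1 ≤ ∑ j, (⌊(t - φ j) / Real.pi⌋ + 1) := by
  have hpi := Real.pi_pos
  constructor
  · intro ht
    have h1 : ∑ j, (if j ∈ Finset.Iic i then (1 : ℤ) else 0) = i + 1 := by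
      rw [Finset.sum_ite_mem, Finset.univ_inter, Finset.sum_const, Fin.card_Iic]
      simp
    rw [← h1]
    refine Finset.sum_le_sum fun j _ => ?_
    split_ifs with hj
    · have h2 : (0 : ℤ) ≤ ⌊(t - φ j) / Real.pi⌋ := Int.floor_nonneg.2
        (div_nonneg (by linarith [h.mono j i (Finset.mem_Iic.1 hj)]) hpi.le)
      omega
    · have h2 : (-1 : ℤ) ≤ ⌊(t - φ j) / Real.pi⌋ := Int.le_floor.2 (by
        rw [le_div_iff₀ hpi]; push_cast; linarith [h.le_add_pi i j])
      omega
  · intro hle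
    by_contra! ht
    have h1 : ∑ j, (if j ∈ Finset.Iio i then (1 : ℤ) else 0) = i := by
      rw [Finset.sum_ite_mem, Finset.univ_inter, Finset.sum_const, Fin.card_Iio]
      simp
    have h3 : ∑ j, (⌊(t - φ j) / Real.pi⌋ + 1) ≤ i := by
      rw [← h1]
      refine Finset.sum_le_sum fun j _ => ?_
      split_ifs with hj
      · have h2 : ⌊(t - φ j) / Real.pi⌋ < 1 := Int.floor_lt.2 (by
          rw [div_lt_iff₀ hpi]; push_cast; linarith [h.le_add_pi j i])
        omega
      · have h2 : ⌊(t - φ j) / Real.pi⌋ < 0 := Int.floor_lt.2 (by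
          rw [div_lt_iff₀ hpi]; push_cast
          linarith [h.mono i j (not_lt.1 fun hlt => hj (Finset.mem_Iio.2 hlt))])
        omega
    omega

/-- Ordered angles are determined by their classes modulo `π` and their sum. -/
theorem IsOrdered.eq_of_sameAngles {φ ψ : Fin n → ℝ} (hφ : IsOrdered φ) (hψ : IsOrdered ψ)
    (h : SameAngles φ ψ) (hsum : ∑ j, φ j = ∑ j, ψ j) : φ = ψ := by
  obtain ⟨σ, k, hk⟩ := h.exists_perm
  have hk0 : ∑ j, k j = 0 := by
    have h1 : ∑ j, ψ j = ∑ j, φ j + (∑ j, k j : ℤ) * Real.pi := by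
      simp only [hk, Finset.sum_add_distrib, Equiv.sum_comp σ φ, Int.cast_sum, Finset.sum_mul]
    have h2 : ((∑ j, k j : ℤ) : ℝ) * Real.pi = 0 := by linarith
    exact_mod_cast (mul_eq_zero.1 h2).resolve_right Real.pi_ne_zero
  -- Passing from φ to ψ permutes the terms and shifts them by integers k_j, whose sum is 0 because
  -- the totals agree.
  have hN : ∀ t : ℝ, ∑ j, (⌊(t - ψ j) / Real.pi⌋ + 1) = ∑ j, (⌊(t - φ j) / Real.pi⌋ + 1) := by
    intro t
    have h1 : ∀ j, ⌊(t - ψ j) / Real.pi⌋ + 1 = ⌊(t - φ (σ j)) / Real.pi⌋ + 1 - k j := fun j => by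
      have h2 : (t - ψ j) / Real.pi = (t - φ (σ j)) / Real.pi - (k j : ℤ) := by
        rw [hk]
        field_simp [Real.pi_ne_zero]
        ring
      rw [h2, Int.floor_sub_intCast]
      ring
    rw [Finset.sum_congr rfl fun j _ => h1 j, Finset.sum_sub_distrib, hk0, sub_zero]
    exact Equiv.sum_comp σ fun j => ⌊(t - φ j) / Real.pi⌋ + 1
  funext i
  have h1 : ∀ t, φ i ≤ t ↔ ψ i ≤ t := fun t => by rw [hφ.le_iff, hψ.le_iff, hN]
  exact le_antisymm ((h1 _).2 le_rfl) ((h1 _).1 le_rfl)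

theorem isOrdered_sort {φ : Fin n → ℝ} (h : ∀ i j, φ j ≤ φ i + Real.pi) :
    IsOrdered (φ ∘ Tuple.sort φ) :=
  ⟨fun _ _ hij => Tuple.monotone_sort φ hij, fun _ _ => h _ _⟩

theorem exists_isOrdered_Ico (φ : Fin n → ℝ) :
    ∃ ψ, IsOrdered ψ ∧ SameAngles φ ψ ∧ ∀ j, 0 ≤ ψ j ∧ ψ j < Real.pi := by
  set χ : Fin n → ℝ := fun j => toIcoMod Real.pi_pos 0 (φ j) with hχ
  have hmem : ∀ j, 0 ≤ χ j ∧ χ j < Real.pi := fun j => by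
    simpa using toIcoMod_mem_Ico Real.pi_pos 0 (φ j)
  refine ⟨χ ∘ Tuple.sort χ, isOrdered_sort fun i j => by linarith [(hmem i).1, (hmem j).2],
    sameAngles_of_perm (Tuple.sort χ)
      (fun j => - toIcoDiv Real.pi_pos 0 (φ (Tuple.sort χ j))) fun j => ?_, fun j => hmem _⟩
  simp only [Function.comp_apply, hχ, toIcoMod, zsmul_eq_mul]
  push_cast
  ring

theorem exists_isOrdered_Ioc (φ : Fin n → ℝ) :
    ∃ ψ, IsOrdered ψ ∧ SameAngles φ ψ ∧ ∀ j, 0 < ψ j ∧ ψ j ≤ Real.pi := by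
  set χ : Fin n → ℝ := fun j => toIocMod Real.pi_pos 0 (φ j) with hχ
  have hmem : ∀ j, 0 < χ j ∧ χ j ≤ Real.pi := fun j => by
    simpa using toIocMod_mem_Ioc Real.pi_pos 0 (φ j)
  refine ⟨χ ∘ Tuple.sort χ, isOrdered_sort fun i j => by linarith [(hmem i).1, (hmem j).2],
    sameAngles_of_perm (Tuple.sort χ)
      (fun j => - toIocDiv Real.pi_pos 0 (φ (Tuple.sort χ j))) fun j => ?_, fun j => hmem _⟩
  simp only [Function.comp_apply, hχ, toIocMod, zsmul_eq_mul]
  push_cast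
  ring

/-- Moving the smallest angle up by `π` makes it the largest one. -/
theorem IsOrdered.shift {m : ℕ} {φ : Fin (m + 1) → ℝ} (h : IsOrdered φ) :
    ∃ ψ, IsOrdered ψ ∧ SameAngles φ ψ ∧ ∑ j, ψ j = ∑ j, φ j + Real.pi := by
  refine ⟨Fin.snoc (α := fun _ => ℝ) (fun i : Fin m => φ i.succ) (φ 0 + Real.pi), ⟨?_, ?_⟩,
    sameAngles_of_perm (finRotate (m + 1)) (Fin.snoc (α := fun _ => ℤ) (fun _ : Fin m => 0) 1) ?_,
    ?_⟩
  · intro i j hij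
    induction j using Fin.lastCases with
    | last =>
      induction i using Fin.lastCases with
      | last => exact le_rfl
      | cast i => simpa using h.le_add_pi 0 i.succ
    | cast j =>
      induction i using Fin.lastCases with
      | last =>
        exact absurd hij (not_le.2 (Fin.castSucc_lt_last j))
      | cast i => simpa using h.mono _ _ (Fin.succ_le_succ_iff.2 (Fin.castSucc_le_castSucc_iff.1 hij))
  · intro i j
    induction j using Fin.lastCases with
    | last =>
      induction i using Fin.lastCases with
      | last => linarith [Real.pi_pos]
      | cast i => simpa using h.mono 0 i.succ (Fin.zero_le _)
    | cast j =>
      induction i using Fin.lastCases with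
      | last =>
        simp only [Fin.snoc_castSucc, Fin.snoc_last]
        linarith [h.le_add_pi 0 j.succ, Real.pi_pos]
      | cast i => simpa using h.le_add_pi i.succ j.succ
  · intro j
    induction j using Fin.lastCases with
    | last => simp
    | cast j => simp
  · rw [Fin.sum_univ_castSucc, Fin.sum_univ_succ]
    simp only [Fin.snoc_castSucc, Fin.snoc_last]
    ring

/-- Start from ordered representatives in [0, π), whose sum misses the target by lπ. The quotient of
l by n is realized by moving all angles, the remainder by repeated use of `IsOrdered.shift`. For n =
0 the sum cannot be prescribed. -/
theorem exists_isOrdered_sum_eq {φ : Fin n → ℝ} (hn : n ≠ 0) {k : ℤ} {s : ℝ}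
    (hs : s = ∑ j, φ j + k * Real.pi) :
    ∃ ψ, IsOrdered ψ ∧ SameAngles φ ψ ∧ ∑ j, ψ j = s := by
  obtain ⟨m, rfl⟩ := Nat.exists_eq_succ_of_ne_zero hn
  obtain ⟨ψ, hψ, hφψ, _⟩ := exists_isOrdered_Ico φ
  obtain ⟨l, hl⟩ : ∃ l : ℤ, s = ∑ j, ψ j + l * Real.pi := by
    obtain ⟨σ, l, hl⟩ := hφψ.exists_perm
    refine ⟨k - ∑ j, l j, ?_⟩
    have h1 : ∑ j, ψ j = ∑ j, φ j + (∑ j, l j : ℤ) * Real.pi := by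
      simp only [hl, Finset.sum_add_distrib, Equiv.sum_comp σ φ, Int.cast_sum, Finset.sum_mul]
    rw [h1, hs]
    push_cast
    ring
  set χ : Fin (m + 1) → ℝ := fun j => ψ j + (l / (m + 1 : ℕ) : ℤ) * Real.pi with hχ
  have hχo : IsOrdered χ := ⟨fun i j hij => by simpa [hχ] using hψ.mono i j hij, fun i j => by
    simp only [hχ]; linarith [hψ.le_add_pi i j]⟩
  have hχs : SameAngles φ χ := hφψ.trans
    (sameAngles_of_perm (Equiv.refl _) (fun _ => (l / (m + 1 : ℕ) : ℤ)) fun j => rfl)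
  have hshift : ∀ r : ℕ, ∃ ψ, IsOrdered ψ ∧ SameAngles φ ψ ∧
      ∑ j, ψ j = ∑ j, χ j + r * Real.pi := by
    intro r
    induction r with
    | zero => exact ⟨χ, hχo, hχs, by simp⟩
    | succ r ih =>
      obtain ⟨ψ, h1, h2, h3⟩ := ih
      obtain ⟨ψ', h1', h2', h3'⟩ := h1.shift
      refine ⟨ψ', h1', h2.trans h2', ?_⟩
      rw [h3', h3]
      push_cast
      ring
  obtain ⟨ψ', h1, h2, h3⟩ := hshift (l % (m + 1 : ℕ)).toNat
  refine ⟨ψ', h1, h2, ?_⟩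
  have h4 : (((l % (m + 1 : ℕ)).toNat : ℤ) : ℝ) = ((l % (m + 1 : ℕ) : ℤ) : ℝ) := by
    rw [Int.toNat_of_nonneg (Int.emod_nonneg _ (by positivity))]
  have h5 : (l : ℝ) = ((l % (m + 1 : ℕ) : ℤ) : ℝ) + ((m + 1 : ℕ) : ℝ) * ((l / (m + 1 : ℕ) : ℤ) : ℝ) := by
    exact_mod_cast (Int.emod_add_mul_ediv l (m + 1 : ℕ)).symm
  rw [h3, hl, ← Int.cast_natCast, h4, h5]
  simp only [hχ, Finset.sum_add_distrib, Finset.sum_const, Finset.card_univ, Fintype.card_fin,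
    nsmul_eq_mul]
  ring

/-- Each angle lies within π of the mean. This keeps ordered angles with convergent sum in a compact
set. -/
theorem IsOrdered.abs_le {φ : Fin n → ℝ} (h : IsOrdered φ) (i : Fin n) :
    |φ i| ≤ |∑ j, φ j| + Real.pi := by
  have hn : (1 : ℝ) ≤ n := by exact_mod_cast i.pos
  have h1 : (n : ℝ) * φ i ≤ ∑ j, φ j + n * Real.pi := by
    have := Finset.sum_le_sum fun j (_ : j ∈ Finset.univ) => h.le_add_pi j i
    simpa [Finset.sum_add_distrib] using this
  have h2 : ∑ j, φ j ≤ n * φ i + n * Real.pi := by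
    have := Finset.sum_le_sum fun j (_ : j ∈ Finset.univ) => h.le_add_pi i j
    simpa [Finset.sum_add_distrib, mul_add] using this
  have h3 := abs_nonneg (∑ j, φ j)
  have h4 : |∑ j, φ j| ≤ n * |∑ j, φ j| := by nlinarith
  have h5 := le_abs_self (∑ j, φ j)
  have h6 := neg_abs_le (∑ j, φ j)
  have hn0 : (0 : ℝ) < n := by linarith
  rw [_root_.abs_le]
  constructor
  · refine le_of_mul_le_mul_left (a := (n : ℝ)) ?_ hn0
    linarith
  · refine le_of_mul_le_mul_left (a := (n : ℝ)) ?_ hn0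
    linarith

theorem isClosed_isOrdered : IsClosed {φ : Fin n → ℝ | IsOrdered φ} := by
  have h1 : {φ : Fin n → ℝ | IsOrdered φ} =
      {φ | (∀ i j, i ≤ j → φ i ≤ φ j) ∧ ∀ i j, φ j ≤ φ i + Real.pi} := by
    ext φ
    exact ⟨fun h => ⟨h.1, h.2⟩, fun h => ⟨h.1, h.2⟩⟩
  rw [h1]
  refine IsClosed.and ?_ ?_
  · simp only [Set.ofPred_forall]
    exact isClosed_iInter fun i => isClosed_iInter fun j => isClosed_iInter fun _ =>
      isClosed_le (continuous_apply i) (continuous_apply j)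
  · simp only [Set.ofPred_forall]
    exact isClosed_iInter fun i => isClosed_iInter fun j =>
      isClosed_le (continuous_apply j) ((continuous_apply i).add continuous_const)

/-- Ordered angles with continuous sum, of a continuous pair of matrices, are continuous. -/
theorem continuous_of_isOrdered {X : Type*} [TopologicalSpace X]
    {P Q : X → Matrix (Fin n) (Fin n) ℝ} (hP : Continuous P) (hQ : Continuous Q)
    (hf : ∀ x, ∃ ψ, Factorizes (P x) (Q x) ψ) {φ : X → Fin n → ℝ} (ho : ∀ x, IsOrdered (φ x))
    (ha : ∀ x, HasEigenAngles (P x) (Q x) (φ x)) (hs : Continuous fun x => ∑ j, φ x j) :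
    Continuous φ := by
  rw [continuous_iff_continuousAt]
  intro x₀
  set M : ℝ := |∑ j, φ x₀ j| + 1 + Real.pi with hM
  have hM0 : 0 ≤ M := by positivity
  -- Near x₀ the angles stay in a compact ball, so it suffices to identify the cluster points. Each
  -- is ordered, satisfies the determinant identity at x₀ and has the right sum; these properties
  -- determine it.
  refine (isCompact_closedBall (0 : Fin n → ℝ) M).tendsto_nhds_of_unique_mapClusterPt ?_ ?_
  · have h1 : ∀ᶠ x in 𝓝 x₀, |∑ j, φ x j| < |∑ j, φ x₀ j| + 1 :=
      hs.abs.continuousAt.eventually_lt continuousAt_const (by simp)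
    filter_upwards [h1] with x hx
    rw [mem_closedBall_zero_iff, pi_norm_le_iff_of_nonneg hM0]
    intro i
    rw [Real.norm_eq_abs]
    linarith [(ho x).abs_le i]
  · intro χ _ hχ
    obtain ⟨U, hU, hUχ⟩ := mapClusterPt_iff_ultrafilter.1 hχ
    have hPU : Tendsto P U (𝓝 (P x₀)) := hP.continuousAt.tendsto.mono_left hU
    have hQU : Tendsto Q U (𝓝 (Q x₀)) := hQ.continuousAt.tendsto.mono_left hU
    have hdC : Continuous fun q : Matrix (Fin n) (Fin n) ℝ × Matrix (Fin n) (Fin n) ℝ =>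
        (complexFrame q.1 q.2).det := by
      refine Continuous.matrix_det ?_
      unfold complexFrame
      exact (continuous_snd.matrix_map continuous_ofReal).add
        ((continuous_fst.matrix_map continuous_ofReal).const_smul I)
    have hχo : IsOrdered χ :=
      isClosed_isOrdered.mem_of_tendsto hUχ (Eventually.of_forall ho)
    have hχd : DetEq (P x₀) (Q x₀) χ := by
      intro θ
      have h1 : Tendsto (fun x => (((Real.cos θ • P x - Real.sin θ • Q x).det : ℝ) : ℂ)) U
          (𝓝 (((Real.cos θ • P x₀ - Real.sin θ • Q x₀).det : ℝ) : ℂ)) := by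
        have h2 : Continuous fun x => (((Real.cos θ • P x - Real.sin θ • Q x).det : ℝ) : ℂ) :=
          continuous_ofReal.comp (Continuous.matrix_det
            ((hP.const_smul (Real.cos θ)).sub (hQ.const_smul (Real.sin θ)) :))
        exact h2.continuousAt.tendsto.mono_left hU
      have h3 : Tendsto (fun x => (complexFrame (P x) (Q x)).det * ∏ j, detFactor θ (φ x j)) U
          (𝓝 ((complexFrame (P x₀) (Q x₀)).det * ∏ j, detFactor θ (χ j))) := by
        refine Tendsto.mul ((hdC.tendsto _).comp (hPU.prodMk_nhds hQU)) ?_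
        exact tendsto_finsetProd _ fun j _ => ((continuous_detFactor θ).tendsto _).comp
          ((tendsto_pi_nhds.1 hUχ) j)
      refine tendsto_nhds_unique h1 (h3.congr fun x => ?_)
      obtain ⟨ψ, hψ⟩ := hf x
      exact (hψ.detEq_of_hasEigenAngles (ha x) θ).symm
    have hsum : ∑ j, χ j = ∑ j, φ x₀ j := by
      refine tendsto_nhds_unique (tendsto_finsetSum _ fun j _ => (tendsto_pi_nhds.1 hUχ) j)
        (hs.continuousAt.tendsto.mono_left hU)
    obtain ⟨ψ, hψ⟩ := hf x₀
    exact hχo.eq_of_sameAngles (ho x₀)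
      (sameAngles_of_hasEigenAngles (hψ.hasEigenAngles_of_detEq hχd) (ha x₀)) hsum

/-- Continuous ordered angles with a prescribed continuous sum. -/
theorem exists_continuous_angles {X : Type*} [TopologicalSpace X]
    {P Q : X → Matrix (Fin n) (Fin n) ℝ} (hP : Continuous P) (hQ : Continuous Q)
    {s : X → ℝ} (hs : Continuous s)
    (hf : ∀ x, ∃ ψ, Factorizes (P x) (Q x) ψ ∧ ∃ k : ℤ, s x = ∑ j, ψ j + k * Real.pi)
    (h0 : n = 0 → ∀ x, s x = 0) :
    ∃ φ : X → Fin n → ℝ, Continuous φ ∧ (∀ x, IsOrdered (φ x)) ∧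
      (∀ x, HasEigenAngles (P x) (Q x) (φ x)) ∧ ∀ x, ∑ j, φ x j = s x := by
  have h1 : ∀ x, ∃ φ, IsOrdered φ ∧ HasEigenAngles (P x) (Q x) φ ∧ ∑ j, φ j = s x := by
    intro x
    obtain ⟨ψ, hψ, k, hk⟩ := hf x
    rcases eq_or_ne n 0 with rfl | hn
    · exact ⟨ψ, ⟨fun i => i.elim0, fun i => i.elim0⟩, hψ.hasEigenAngles, by simp [h0 rfl x]⟩
    · obtain ⟨φ, h1, h2, h3⟩ := exists_isOrdered_sum_eq hn hk
      exact ⟨φ, h1, h2.hasEigenAngles hψ.hasEigenAngles, h3⟩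
  choose φ ho ha hsum using h1
  exact ⟨φ, continuous_of_isOrdered hP hQ (fun x => ⟨_, (hf x).choose_spec.1⟩) ho ha
    (by simpa only [hsum] using hs), ho, ha, hsum⟩

/-- A continuous nowhere zero complex function on the plane has a continuous argument. -/
theorem exists_continuous_arg {d : ℝ × ℝ → ℂ} (hd : Continuous d) (h0 : ∀ q, d q ≠ 0) :
    ∃ s : ℝ × ℝ → ℝ, Continuous s ∧ ∀ q, d q = (‖d q‖ : ℝ) * exp (I * s q) := by
  -- The plane is simply connected and exp is a covering of ℂ without 0, so d has a continuous
  -- logarithm.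
  obtain ⟨F, ⟨_, hF⟩, _⟩ := Complex.isCoveringMapOn_exp.existsUnique_continuousMap_lifts
    (⟨d, hd⟩ : C(ℝ × ℝ, ℂ)) (a₀ := (0, 0)) (e₀ := Complex.log (d (0, 0)))
    (Complex.exp_log (h0 _)) (fun q => h0 q)
  refine ⟨fun q => (F q).im, continuous_im.comp F.continuous, fun q => ?_⟩
  have h1 : exp (F q) = d q := congrFun hF q
  rw [← h1, Complex.norm_exp, ofReal_exp, ← Complex.exp_add]
  congr 1
  rw [mul_comm]
  exact (Complex.re_add_im (F q)).symm

end EigenAngles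

/-! ### Curves of pairs, isotropic frames and the matching pair -/

namespace EigenAngles

open Matrix Complex Filter Topology

variable {n : ℕ}

/-- Rounding h / π gives a continuous integer-valued function on a preconnected set. This rigidity
fixes all sums of angles below. -/
theorem continuousOn_int_mul_pi_eq {X : Type*} [TopologicalSpace X] {S : Set X}
    (hS : IsPreconnected S) {h : X → ℝ} (hc : ContinuousOn h S)
    (hk : ∀ x ∈ S, ∃ k : ℤ, h x = k * Real.pi) {x y : X} (hx : x ∈ S) (hy : y ∈ S) : h x = h y := by
  have h1 : ContinuousOn (fun x => (round (h x / Real.pi) : ℤ)) S := by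
    rw [Int.isClosedEmbedding_coe_real.isInducing.continuousOn_iff]
    refine (hc.div_const Real.pi).congr fun z hz => ?_
    obtain ⟨k, hk⟩ := hk z hz
    simp [hk, Real.pi_ne_zero]
  obtain ⟨k, hkx⟩ := hk x hx
  obtain ⟨l, hly⟩ := hk y hy
  have h2 := hS.constant h1 hx hy
  simp only [hkx, hly, mul_div_cancel_right₀ _ Real.pi_ne_zero, round_intCast] at h2
  rw [hkx, hly, h2]

/-- Ordered angles at one point extend continuously along a continuous curve of matrix pairs. -/
theorem exists_continuous_angles_of_base {P Q : ℝ → Matrix (Fin n) (Fin n) ℝ}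
    (hP : Continuous P) (hQ : Continuous Q) (hf : ∀ x, ∃ ψ, Factorizes (P x) (Q x) ψ) (x₀ : ℝ)
    {φ₀ : Fin n → ℝ} (ho : IsOrdered φ₀) (ha : HasEigenAngles (P x₀) (Q x₀) φ₀) :
    ∃ φ : ℝ → Fin n → ℝ, Continuous φ ∧ (∀ x, IsOrdered (φ x)) ∧
      (∀ x, HasEigenAngles (P x) (Q x) (φ x)) ∧ φ x₀ = φ₀ := by
  have hd : Continuous fun q : ℝ × ℝ => (complexFrame (P q.1) (Q q.1)).det := by
    refine Continuous.matrix_det ?_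
    unfold complexFrame
    exact ((hQ.comp continuous_fst).matrix_map continuous_ofReal).add
      (((hP.comp continuous_fst).matrix_map continuous_ofReal).const_smul I)
  obtain ⟨s, hs, hds⟩ := exists_continuous_arg hd fun q => (hf q.1).choose_spec.det_ne_zero
  obtain ⟨ψ, hψ⟩ := hf x₀
  obtain ⟨k, hk⟩ := hψ.exists_sum_eq ha (hds (x₀, 0))
  obtain ⟨φ, h1, h2, h3, h4⟩ := exists_continuous_angles hP hQ
    -- The continuous argument is corrected by the multiple of π that gives the sum of `φ₀` at `x₀`.
    -- For n = 0 the empty sum forces 0.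
    (s := fun x => if n = 0 then 0 else s (x, 0) - k * Real.pi)
    (by
      split_ifs
      · exact continuous_const
      · fun_prop)
    (fun x => by
      obtain ⟨ψ, hψ⟩ := hf x
      refine ⟨ψ, hψ, ?_⟩
      rcases eq_or_ne n 0 with rfl | hn
      · exact ⟨0, by simp⟩
      · obtain ⟨l, hl⟩ := hψ.exists_sum_eq hψ.hasEigenAngles (hds (x, 0))
        exact ⟨l - k, by rw [if_neg hn, hl]; push_cast; ring⟩)
    (fun h => by simp [h])
  refine ⟨φ, h1, h2, h3, (h2 x₀).eq_of_sameAngles ho (sameAngles_of_hasEigenAngles (h3 x₀) ha) ?_⟩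
  rw [h4]
  rcases eq_or_ne n 0 with rfl | hn
  · simp
  · rw [if_neg hn, hk]
    ring

/-- The matrix of the first component of a linear map into the phase space. -/
noncomputable def valMat (T : (Fin n → ℝ) →L[ℝ] MultichannelProblem.PhaseSpace n) :
    Matrix (Fin n) (Fin n) ℝ :=
  LinearMap.toMatrix' (LinearMap.fst ℝ (Fin n → ℝ) (Fin n → ℝ) ∘ₗ (T : (Fin n → ℝ) →ₗ[ℝ] _))

/-- The matrix of the second component of a linear map into the phase space. -/
noncomputable def derMat (T : (Fin n → ℝ) →L[ℝ] MultichannelProblem.PhaseSpace n) :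
    Matrix (Fin n) (Fin n) ℝ :=
  LinearMap.toMatrix' (LinearMap.snd ℝ (Fin n → ℝ) (Fin n → ℝ) ∘ₗ (T : (Fin n → ℝ) →ₗ[ℝ] _))

variable (T : (Fin n → ℝ) →L[ℝ] MultichannelProblem.PhaseSpace n)

theorem valMat_mulVec (v : Fin n → ℝ) : valMat T *ᵥ v = (T v).1 := LinearMap.toMatrix'_mulVec _ _

theorem derMat_mulVec (v : Fin n → ℝ) : derMat T *ᵥ v = (T v).2 := LinearMap.toMatrix'_mulVec _ _

theorem eq_of_mulVec_eq {M N : Matrix (Fin n) (Fin n) ℝ} (h : ∀ v, M *ᵥ v = N *ᵥ v) : M = N := by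
  ext i j
  simpa using congrFun (h (Pi.single j 1)) i

theorem eq_of_dotProduct_mulVec_eq {M N : Matrix (Fin n) (Fin n) ℝ}
    (h : ∀ v w, v ⬝ᵥ M *ᵥ w = v ⬝ᵥ N *ᵥ w) : M = N :=
  eq_of_mulVec_eq fun w => dotProduct_eq _ _ fun v => by
    rw [dotProduct_comm, h, dotProduct_comm]

variable {T}

theorem transpose_mul_comm_of_isotropic (h : ∀ v w, MultichannelProblem.symp (T v) (T w) = 0) :
    (valMat T)ᵀ * derMat T = (derMat T)ᵀ * valMat T := by
  refine eq_of_dotProduct_mulVec_eq fun v w => ?_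
  have h1 := h v w
  have h2 : ∀ (M : Matrix (Fin n) (Fin n) ℝ) (u : Fin n → ℝ), v ⬝ᵥ Mᵀ *ᵥ u = (M *ᵥ v) ⬝ᵥ u :=
    fun M u => by rw [dotProduct_mulVec, vecMul_transpose]
  rw [← mulVec_mulVec, ← mulVec_mulVec, h2, h2, valMat_mulVec, valMat_mulVec, derMat_mulVec,
    derMat_mulVec]
  rw [MultichannelProblem.symp] at h1
  linarith

/-- If (Q + iP)(u + iw) = 0, then Qu = Pw and Pu = -Qw, so the symplectic product of the images of u
and w is |Qu|² + |Pu|². Isotropy makes it vanish, and injectivity then kills u and w. -/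
theorem det_complexFrame_ne_zero_of_isotropic
    (h : ∀ v w, MultichannelProblem.symp (T v) (T w) = 0) (hT : Function.Injective T) :
    (complexFrame (valMat T) (derMat T)).det ≠ 0 := by
  intro hdet
  obtain ⟨z, hz0, hz⟩ := exists_mulVec_eq_zero_iff.2 hdet
  set u : Fin n → ℝ := fun j => (z j).re with hu
  set w : Fin n → ℝ := fun j => (z j).im with hw
  have hre : (T u).2 = (T w).1 := by
    rw [← valMat_mulVec, ← derMat_mulVec]
    funext i
    have h1 := congrArg Complex.re (congrFun hz i)
    simp only [complexFrame, mulVec, dotProduct, re_sum] at h1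
    simp [add_mul, Finset.sum_add_distrib] at h1
    simp only [mulVec, dotProduct]
    linarith
  have him : (T u).1 = - (T w).2 := by
    rw [← valMat_mulVec, ← derMat_mulVec]
    funext i
    have h1 := congrArg Complex.im (congrFun hz i)
    simp only [complexFrame, mulVec, dotProduct, im_sum] at h1
    simp [add_mul, Finset.sum_add_distrib] at h1
    simp only [mulVec, dotProduct, Pi.neg_apply]
    linarith
  have h1 := h u w
  rw [MultichannelProblem.symp, ← hre, show (T w).2 = - (T u).1 by rw [him, neg_neg]] at h1
  have h2 : (T u).2 ⬝ᵥ (T u).2 + (T u).1 ⬝ᵥ (T u).1 = 0 := by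
    rw [dotProduct_neg] at h1
    linarith
  have h3 : ∀ x : Fin n → ℝ, 0 ≤ x ⬝ᵥ x := fun x => Finset.sum_nonneg fun i _ => mul_self_nonneg _
  have h4 : (T u).2 = 0 := dotProduct_self_eq_zero.1 (by linarith [h3 (T u).1, h3 (T u).2])
  have h5 : (T u).1 = 0 := dotProduct_self_eq_zero.1 (by linarith [h3 (T u).1, h3 (T u).2])
  have hu0 : u = 0 := hT (by rw [map_zero]; exact Prod.ext h5 h4)
  have hw0 : w = 0 := hT (by
    rw [map_zero]
    exact Prod.ext (hre.symm.trans h4) (neg_eq_zero.1 (him.symm.trans h5)))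
  exact hz0 (funext fun j => Complex.ext (congrFun hu0 j) (congrFun hw0 j))

theorem continuous_valMat {X : Type*} [TopologicalSpace X]
    {T : X → (Fin n → ℝ) →L[ℝ] MultichannelProblem.PhaseSpace n}
    (hT : ∀ v, Continuous fun x => T x v) : Continuous fun x => valMat (T x) :=
  continuous_matrix fun i j => by
    simp only [valMat, LinearMap.toMatrix'_apply]
    exact (continuous_apply i).comp (continuous_fst.comp (hT _))

theorem continuous_derMat {X : Type*} [TopologicalSpace X]
    {T : X → (Fin n → ℝ) →L[ℝ] MultichannelProblem.PhaseSpace n}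
    (hT : ∀ v, Continuous fun x => T x v) : Continuous fun x => derMat (T x) :=
  continuous_matrix fun i j => by
    simp only [derMat, LinearMap.toMatrix'_apply]
    exact (continuous_apply i).comp (continuous_snd.comp (hT _))

/-- The complex frame of the matching pair. -/
theorem complexFrame_matching (YL dYL YR dYR : Matrix (Fin n) (Fin n) ℝ) :
    complexFrame (YLᵀ * dYR - dYLᵀ * YR) (dYLᵀ * dYR + YLᵀ * YR) =
      (complexFrame YL dYL)ᵀ * (complexFrame YR dYR).map (starRingEnd ℂ) := by
  have h1 : (complexFrame YL dYL)ᵀ = ofRealHom.mapMatrix dYLᵀ + I • ofRealHom.mapMatrix YLᵀ := by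
    ext i j
    simp [complexFrame]
  have h2 : (complexFrame YR dYR).map (starRingEnd ℂ) =
      ofRealHom.mapMatrix dYR - I • ofRealHom.mapMatrix YR := by
    ext i j
    simp [complexFrame, sub_eq_add_neg]
  rw [h1, h2, complexFrame]
  simp only [map_add, map_sub, map_mul, add_mul, mul_sub, smul_mul_assoc, mul_smul_comm, smul_sub,
    smul_add, smul_smul, I_mul_I, neg_smul, one_smul]
  abel

/-- Up to real factors, the argument of the matching pair is the left argument minus the right one.
-/
theorem det_complexFrame_matching (YL dYL YR dYR : Matrix (Fin n) (Fin n) ℝ) :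
    (complexFrame (YLᵀ * dYR - dYLᵀ * YR) (dYLᵀ * dYR + YLᵀ * YR)).det =
      (complexFrame YL dYL).det * starRingEnd ℂ (complexFrame YR dYR).det := by
  rw [complexFrame_matching, det_mul, det_transpose]
  congr 1
  exact ((starRingEnd ℂ).map_det _).symm

/-- The matching pair need not satisfy the symmetry condition itself. Multiplication from the left
by the inverse of Bᵀ replaces the left frame by the orthonormal one (A sin φ, A cos φ). The
resulting pair is the right frame moved by an orthogonal change of basis and rotations by φ_j, which
are symplectic, so it inherits the symmetry. The multiplier does not change the angles. -/
theorem exists_factorizes_matching {YL dYL YR dYR : Matrix (Fin n) (Fin n) ℝ}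
    (hL : YLᵀ * dYL = dYLᵀ * YL) (hL' : (complexFrame YL dYL).det ≠ 0)
    (hR : YRᵀ * dYR = dYRᵀ * YR) (hR' : (complexFrame YR dYR).det ≠ 0) :
    ∃ ψ, Factorizes (YLᵀ * dYR - dYLᵀ * YR) (dYLᵀ * dYR + YLᵀ * YR) ψ := by
  obtain ⟨φ, A, B, hA, hB, rfl, rfl⟩ := exists_orthogonal_factorization hL hL'
  have hAA : A * Aᵀ = 1 := mul_eq_one_comm.1 hA
  have hBt : IsUnit Bᵀ.det := by rwa [det_transpose]
  have hinv : (Bᵀ)⁻¹ * Bᵀ = 1 := nonsing_inv_mul _ hBt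
  set s : Matrix (Fin n) (Fin n) ℝ := diagonal fun j => Real.sin (φ j) with hs
  set c : Matrix (Fin n) (Fin n) ℝ := diagonal fun j => Real.cos (φ j) with hc
  have hsc : s * s + c * c = 1 := by
    rw [hs, hc, diagonal_mul_diagonal, diagonal_mul_diagonal, diagonal_add, ← diagonal_one]
    congr 1
    funext j
    linarith [Real.sin_sq_add_cos_sq (φ j)]
  have hst : sᵀ = s := diagonal_transpose _
  have hct : cᵀ = c := diagonal_transpose _
  have hcomm : s * c = c * s := by
    rw [hs, hc, diagonal_mul_diagonal, diagonal_mul_diagonal]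
    simp only [mul_comm]
  have hd := det_complexFrame_matching (A * s * B) (A * c * B) YR dYR
  set P := (A * s * B)ᵀ * dYR - (A * c * B)ᵀ * YR with hP
  set Q := (A * c * B)ᵀ * dYR + (A * s * B)ᵀ * YR with hQ
  have hP' : (Bᵀ)⁻¹ * P = s * (Aᵀ * dYR) - c * (Aᵀ * YR) := by
    rw [hP, transpose_mul, transpose_mul, transpose_mul, transpose_mul, hst, hct]
    simp only [mul_sub, ← Matrix.mul_assoc, hinv, Matrix.one_mul]
  have hQ' : (Bᵀ)⁻¹ * Q = c * (Aᵀ * dYR) + s * (Aᵀ * YR) := by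
    rw [hQ, transpose_mul, transpose_mul, transpose_mul, transpose_mul, hst, hct]
    simp only [mul_add, ← Matrix.mul_assoc, hinv, Matrix.one_mul]
  have hsymm : ((Bᵀ)⁻¹ * P)ᵀ * ((Bᵀ)⁻¹ * Q) = ((Bᵀ)⁻¹ * Q)ᵀ * ((Bᵀ)⁻¹ * P) := by
    have hpq : (Aᵀ * dYR)ᵀ * (Aᵀ * YR) = (Aᵀ * YR)ᵀ * (Aᵀ * dYR) := by
      have h1 : ∀ X Y : Matrix (Fin n) (Fin n) ℝ, (Aᵀ * X)ᵀ * (Aᵀ * Y) = Xᵀ * Y := fun X Y => by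
        rw [transpose_mul, transpose_transpose, Matrix.mul_assoc, ← Matrix.mul_assoc A, hAA,
          Matrix.one_mul]
      rw [h1, h1, hR]
    rw [hP', hQ']
    generalize Aᵀ * dYR = p at *
    generalize Aᵀ * YR = q at *
    simp only [transpose_sub, transpose_add, transpose_mul, hst, hct]
    have e1 : (pᵀ * s - qᵀ * c) * (c * p + s * q) - (pᵀ * c + qᵀ * s) * (s * p - c * q) =
        pᵀ * (s * c - c * s) * p + pᵀ * (s * s + c * c) * q - qᵀ * (s * s + c * c) * p +
          qᵀ * (s * c - c * s) * q := by
      noncomm_ring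
    rw [hsc, hcomm, sub_self, Matrix.mul_zero, Matrix.mul_zero, Matrix.zero_mul, Matrix.zero_mul,
      Matrix.mul_one, Matrix.mul_one, hpq, zero_add, add_zero, sub_self] at e1
    exact sub_eq_zero.1 e1
  have hdet : (complexFrame ((Bᵀ)⁻¹ * P) ((Bᵀ)⁻¹ * Q)).det ≠ 0 := by
    have h1 : complexFrame ((Bᵀ)⁻¹ * P) ((Bᵀ)⁻¹ * Q) =
        ofRealHom.mapMatrix (Bᵀ)⁻¹ * complexFrame P Q := by
      rw [complexFrame, complexFrame, map_mul, map_mul, mul_add, mul_smul_comm]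
    rw [h1, det_mul, hd, ← RingHom.map_det]
    refine mul_ne_zero ?_ (mul_ne_zero hL' ?_)
    · exact (map_ne_zero _).2 (isUnit_nonsing_inv_det _ hBt).ne_zero
    · exact (map_ne_zero _).2 hR'
  obtain ⟨ψ, hψ⟩ := exists_factorizes hsymm hdet
  exact ⟨ψ, hψ.of_mul_left (isUnit_nonsing_inv_det _ hBt)⟩

end EigenAngles

namespace EigenAngles

open Matrix

variable {n : ℕ}

/-- Angles less than π apart cannot differ by a nonzero multiple of π. With the half-open
normalizations at the end points, this fixes the sum there. -/
theorem SameAngles.sum_eq {φ ψ : Fin n → ℝ} (h : SameAngles φ ψ)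
    (h' : ∀ i j, |ψ j - φ i| < Real.pi) : ∑ j, φ j = ∑ j, ψ j := by
  obtain ⟨σ, k, hk⟩ := h.exists_perm
  have h1 : ∀ j, ψ j = φ (σ j) := fun j => by
    have h2 := h' (σ j) j
    rw [hk, add_sub_cancel_left, abs_mul, abs_of_pos Real.pi_pos] at h2
    have h3 : |(k j : ℝ)| < 1 := by
      by_contra! h4
      nlinarith [Real.pi_pos]
    have h5 : k j = 0 := Int.abs_lt_one_iff.1 (by exact_mod_cast h3)
    rw [hk, h5]
    simp
  simp only [h1]
  exact (Equiv.sum_comp σ φ).symm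

theorem valMat_apply (T : (Fin n → ℝ) →L[ℝ] MultichannelProblem.PhaseSpace n) (i j : Fin n) :
    valMat T i j = (T (Pi.single j 1)).1 i := by
  simpa using congrFun (valMat_mulVec T (Pi.single j 1)) i

theorem derMat_apply (T : (Fin n → ℝ) →L[ℝ] MultichannelProblem.PhaseSpace n) (i j : Fin n) :
    derMat T i j = (T (Pi.single j 1)).2 i := by
  simpa using congrFun (derMat_mulVec T (Pi.single j 1)) i

end EigenAngles

/-! ### Phase angles and matching angles of the boundary value problem -/

namespace MultichannelProblem

open MeasureTheory Set Matrix EigenAngles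

variable {n : ℕ} {p : MultichannelProblem n}

theorem IsMatrixSolution.mulVec_eq_flow {E : ℝ} {Y dY : ℝ → Matrix (Fin n) (Fin n) ℝ}
    (h : p.IsMatrixSolution E Y dY) {x : ℝ} (hx : x ∈ Icc p.a p.b) (v : Fin n → ℝ) :
    (Y x *ᵥ v, dY x *ᵥ v) = p.flow E x (Y p.a *ᵥ v, dY p.a *ᵥ v) := by
  have h1 : ∀ x, ((Y x *ᵥ v, dY x *ᵥ v) : PhaseSpace n) =
      ∑ j, v j • ((fun i => Y x i j, fun i => dY x i j) : PhaseSpace n) := by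
    intro x
    refine Prod.ext ?_ ?_ <;> funext i <;>
      simp [Prod.fst_sum, Prod.snd_sum, mulVec, dotProduct, Finset.sum_apply, mul_comm]
  rw [h1, h1, map_sum]
  refine Finset.sum_congr rfl fun j _ => ?_
  rw [map_smul, (h j).eq_flow hx]

variable (p)

theorem isMatrixSolution_flow (E : ℝ) (C : (Fin n → ℝ) →L[ℝ] PhaseSpace n) :
    p.IsMatrixSolution E (fun x => valMat (p.flow E x ∘L C)) (fun x => derMat (p.flow E x ∘L C)) := by
  intro j
  have := p.isSolution_flow E (C (Pi.single j 1))
  simpa only [valMat_apply, derMat_apply, ContinuousLinearMap.comp_apply] using this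

theorem isLeftSolution_leftMap (E : ℝ) :
    p.IsLeftSolution E (fun x => valMat (p.leftMap E x)) (fun x => derMat (p.leftMap E x)) := by
  refine ⟨p.isMatrixSolution_flow E _, eq_of_mulVec_eq fun v => ?_, eq_of_mulVec_eq fun v => ?_⟩
  · rw [valMat_mulVec, leftMap_left, boundaryFrame_apply]
  · rw [derMat_mulVec, leftMap_left, boundaryFrame_apply]

theorem isRightSolution_rightMap (E : ℝ) :
    p.IsRightSolution E (fun x => valMat (p.rightMap E x)) (fun x => derMat (p.rightMap E x)) := by
  refine ⟨p.isMatrixSolution_flow E _, eq_of_mulVec_eq fun v => ?_, eq_of_mulVec_eq fun v => ?_⟩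
  · rw [valMat_mulVec, rightMap_right, boundaryFrame_apply]
  · rw [derMat_mulVec, rightMap_right, boundaryFrame_apply]

variable {p}

/-- By uniqueness, every matrix solution allowed in the definitions of the angles is the concrete
frame on [a, b]. -/
theorem IsLeftSolution.eq_leftMap {E : ℝ} {Y dY : ℝ → Matrix (Fin n) (Fin n) ℝ}
    (h : p.IsLeftSolution E Y dY) {x : ℝ} (hx : x ∈ Icc p.a p.b) :
    Y x = valMat (p.leftMap E x) ∧ dY x = derMat (p.leftMap E x) := by
  have h1 : ∀ v, (Y x *ᵥ v, dY x *ᵥ v) = p.leftMap E x v := fun v => by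
    rw [h.1.mulVec_eq_flow hx, h.2.1, h.2.2, leftMap_apply, boundaryFrame_apply]
  exact ⟨eq_of_mulVec_eq fun v => by rw [valMat_mulVec, ← h1],
    eq_of_mulVec_eq fun v => by rw [derMat_mulVec, ← h1]⟩

theorem IsRightSolution.eq_rightMap {E : ℝ} {Y dY : ℝ → Matrix (Fin n) (Fin n) ℝ}
    (h : p.IsRightSolution E Y dY) {x : ℝ} (hx : x ∈ Icc p.a p.b) :
    Y x = valMat (p.rightMap E x) ∧ dY x = derMat (p.rightMap E x) := by
  have h1 : ∀ v, (Y x *ᵥ v, dY x *ᵥ v) = p.rightMap E x v := fun v => by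
    have h2 := h.1.mulVec_eq_flow (right_mem_Icc.2 p.a_lt_b.le) v
    rw [h.2.1, h.2.2] at h2
    rw [h.1.mulVec_eq_flow hx, rightMap_apply, boundaryFrame_apply, h2, backFlow_flow]
  exact ⟨eq_of_mulVec_eq fun v => by rw [valMat_mulVec, ← h1],
    eq_of_mulVec_eq fun v => by rw [derMat_mulVec, ← h1]⟩

variable (p)

theorem symp_leftMap_self (E x : ℝ) (hx : x ∈ Icc p.a p.b) (v w : Fin n → ℝ) :
    symp (p.leftMap E x v) (p.leftMap E x w) = 0 := by
  simpa using p.symp_leftMap E E v w hx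

theorem symp_rightMap_self (E x : ℝ) (hx : x ∈ Icc p.a p.b) (v w : Fin n → ℝ) :
    symp (p.rightMap E x v) (p.rightMap E x w) = 0 := by
  simpa using p.symp_rightMap E E v w hx

theorem flow_projIcc (E x : ℝ) : p.flow E (projIcc p.a p.b p.a_lt_b.le x) = p.flow E x := by
  simp only [flow, projIcc_val]

/-- No restriction on x is needed: outside [a, b] the clamped frame is that of an end point. -/
theorem exists_factorizes_leftMap (E x : ℝ) :
    ∃ ψ, Factorizes (valMat (p.leftMap E x)) (derMat (p.leftMap E x)) ψ := by
  have hx := (projIcc p.a p.b p.a_lt_b.le x).2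
  rw [leftMap, ← flow_projIcc]
  exact exists_factorizes (transpose_mul_comm_of_isotropic (p.symp_leftMap_self E _ hx))
    (det_complexFrame_ne_zero_of_isotropic (p.symp_leftMap_self E _ hx) (p.leftMap_injective E hx))

theorem exists_factorizes_rightMap (E x : ℝ) :
    ∃ ψ, Factorizes (valMat (p.rightMap E x)) (derMat (p.rightMap E x)) ψ := by
  have hx := (projIcc p.a p.b p.a_lt_b.le x).2
  rw [rightMap, ← flow_projIcc]
  exact exists_factorizes (transpose_mul_comm_of_isotropic (p.symp_rightMap_self E _ hx))
    (det_complexFrame_ne_zero_of_isotropic (p.symp_rightMap_self E _ hx)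
      (p.rightMap_injective E hx))

/-- The matrices `P`, `Q` whose angles are the matching angles. -/
noncomputable def matchP (c E : ℝ) : Matrix (Fin n) (Fin n) ℝ :=
  (valMat (p.leftMap E c))ᵀ * derMat (p.rightMap E c) -
    (derMat (p.leftMap E c))ᵀ * valMat (p.rightMap E c)

/-- The second matrix of the matching pair. -/
noncomputable def matchQ (c E : ℝ) : Matrix (Fin n) (Fin n) ℝ :=
  (derMat (p.leftMap E c))ᵀ * derMat (p.rightMap E c) +
    (valMat (p.leftMap E c))ᵀ * valMat (p.rightMap E c)

theorem exists_factorizes_match {c : ℝ} (hc : c ∈ Icc p.a p.b) (E : ℝ) :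
    ∃ ψ, Factorizes (p.matchP c E) (p.matchQ c E) ψ :=
  exists_factorizes_matching
    (transpose_mul_comm_of_isotropic (p.symp_leftMap_self E _ hc))
    (det_complexFrame_ne_zero_of_isotropic (p.symp_leftMap_self E _ hc) (p.leftMap_injective E hc))
    (transpose_mul_comm_of_isotropic (p.symp_rightMap_self E _ hc))
    (det_complexFrame_ne_zero_of_isotropic (p.symp_rightMap_self E _ hc)
      (p.rightMap_injective E hc))

theorem continuous_match (c : ℝ) : Continuous (p.matchP c) ∧ Continuous (p.matchQ c) := by
  have hl : ∀ v, Continuous fun E => p.leftMap E c v := fun v =>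
    p.continuous_leftMap continuous_id continuous_const continuous_const
  have hr : ∀ v, Continuous fun E => p.rightMap E c v := fun v =>
    p.continuous_rightMap continuous_id continuous_const continuous_const
  have h1 := continuous_valMat hl
  have h2 := continuous_derMat hl
  have h3 := continuous_valMat hr
  have h4 := continuous_derMat hr
  exact ⟨(h1.matrix_transpose.matrix_mul h4).sub (h2.matrix_transpose.matrix_mul h3),
    (h2.matrix_transpose.matrix_mul h4).add (h1.matrix_transpose.matrix_mul h3)⟩

variable {p}

theorem AreMatchingAngles.hasEigenAngles {c E : ℝ} (hc : c ∈ Icc p.a p.b) {ω : Fin n → ℝ}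
    (h : p.AreMatchingAngles c E ω) : HasEigenAngles (p.matchP c E) (p.matchQ c E) ω := by
  obtain ⟨_, YL, dYL, YR, dYR, hL, hR, h1⟩ := h
  rwa [(hL.eq_leftMap hc).1, (hL.eq_leftMap hc).2, (hR.eq_rightMap hc).1,
    (hR.eq_rightMap hc).2] at h1

theorem AreLeftPhaseAngles.arePhaseAngles {E : ℝ} {φ : Fin n → ℝ → ℝ}
    (h : p.AreLeftPhaseAngles E φ) :
    p.ArePhaseAngles (fun x => valMat (p.leftMap E x)) (fun x => derMat (p.leftMap E x)) φ := by
  obtain ⟨Y, dY, hL, h1, _⟩ := h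
  refine ⟨h1.continuousOn, h1.ordered, h1.le_add_pi, fun x hx => ?_⟩
  have h2 := h1.angles x hx
  rwa [(hL.eq_leftMap hx).1, (hL.eq_leftMap hx).2] at h2

theorem AreRightPhaseAngles.arePhaseAngles {E : ℝ} {φ : Fin n → ℝ → ℝ}
    (h : p.AreRightPhaseAngles E φ) :
    p.ArePhaseAngles (fun x => valMat (p.rightMap E x)) (fun x => derMat (p.rightMap E x)) φ := by
  obtain ⟨Y, dY, hR, h1, _⟩ := h
  refine ⟨h1.continuousOn, h1.ordered, h1.le_add_pi, fun x hx => ?_⟩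
  have h2 := h1.angles x hx
  rwa [(hR.eq_rightMap hx).1, (hR.eq_rightMap hx).2] at h2

theorem arePhaseAngles_of_continuous {Y dY : ℝ → Matrix (Fin n) (Fin n) ℝ} {φ : ℝ → Fin n → ℝ}
    (hφ : Continuous φ) (ho : ∀ x, IsOrdered (φ x)) (ha : ∀ x, HasEigenAngles (Y x) (dY x) (φ x)) :
    p.ArePhaseAngles Y dY (fun j x => φ x j) :=
  ⟨fun j => ((continuous_apply j).comp hφ).continuousOn, fun x _ => (ho x).mono,
    fun x _ => (ho x).le_add_pi, fun x _ => ha x⟩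

variable (p)

theorem exists_areLeftPhaseAngles (E : ℝ) : ∃ φ, p.AreLeftPhaseAngles E φ := by
  have hl : ∀ v, Continuous fun x => p.leftMap E x v := fun v =>
    p.continuous_leftMap continuous_const continuous_id continuous_const
  obtain ⟨χ, hχ⟩ := p.exists_factorizes_leftMap E p.a
  obtain ⟨ψ, hψ, hχψ, hmem⟩ := exists_isOrdered_Ico χ
  obtain ⟨φ, h1, h2, h3, h4⟩ := exists_continuous_angles_of_base (continuous_valMat hl)
    (continuous_derMat hl) (p.exists_factorizes_leftMap E) p.a hψ
    (hχψ.hasEigenAngles hχ.hasEigenAngles)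
  exact ⟨fun j x => φ x j, _, _, p.isLeftSolution_leftMap E, arePhaseAngles_of_continuous h1 h2 h3,
    by simpa only [h4] using hmem⟩

theorem exists_areRightPhaseAngles (E : ℝ) : ∃ φ, p.AreRightPhaseAngles E φ := by
  have hl : ∀ v, Continuous fun x => p.rightMap E x v := fun v =>
    p.continuous_rightMap continuous_const continuous_id continuous_const
  obtain ⟨χ, hχ⟩ := p.exists_factorizes_rightMap E p.b
  obtain ⟨ψ, hψ, hχψ, hmem⟩ := exists_isOrdered_Ioc χ
  obtain ⟨φ, h1, h2, h3, h4⟩ := exists_continuous_angles_of_base (continuous_valMat hl)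
    (continuous_derMat hl) (p.exists_factorizes_rightMap E) p.b hψ
    (hχψ.hasEigenAngles hχ.hasEigenAngles)
  exact ⟨fun j x => φ x j, _, _, p.isRightSolution_rightMap E,
    arePhaseAngles_of_continuous h1 h2 h3, by simpa only [h4] using hmem⟩

theorem exists_areMatchingAngles {c : ℝ} (hc : c ∈ Icc p.a p.b) (E : ℝ) :
    ∃ ω, p.AreMatchingAngles c E ω := by
  obtain ⟨χ, hχ⟩ := p.exists_factorizes_match hc E
  obtain ⟨ψ, hψ, hχψ, hmem⟩ := exists_isOrdered_Ico χ
  exact ⟨ψ, hmem, _, _, _, _, p.isLeftSolution_leftMap E, p.isRightSolution_rightMap E,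
    hχψ.hasEigenAngles hχ.hasEigenAngles⟩

/-- The sum of phase angles depends continuously on a parameter, if it is constant at one point. -/
theorem continuous_sum_phaseAngles {T : ℝ → ℝ → (Fin n → ℝ) →L[ℝ] PhaseSpace n}
    (hT : ∀ v, Continuous fun q : ℝ × ℝ => T q.1 q.2 v)
    (hf : ∀ E x, ∃ ψ, Factorizes (valMat (T E x)) (derMat (T E x)) ψ)
    {φ : ℝ → Fin n → ℝ → ℝ}
    (hφ : ∀ E, p.ArePhaseAngles (fun x => valMat (T E x)) (fun x => derMat (T E x)) (φ E))
    {x₀ c : ℝ} (hx₀ : x₀ ∈ Icc p.a p.b) (hc : c ∈ Icc p.a p.b) {K : ℝ}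
    (hK : ∀ E, ∑ j, φ E j x₀ = K) : Continuous fun E => ∑ j, φ E j c := by
  have hd : Continuous fun q : ℝ × ℝ =>
      (complexFrame (valMat (T q.1 q.2)) (derMat (T q.1 q.2))).det := by
    refine Continuous.matrix_det ?_
    unfold complexFrame
    exact ((continuous_derMat hT).matrix_map Complex.continuous_ofReal).add
      (((continuous_valMat hT).matrix_map Complex.continuous_ofReal).const_smul Complex.I)
  obtain ⟨s, hs, hds⟩ := exists_continuous_arg hd fun q => (hf q.1 q.2).choose_spec.det_ne_zero
  have h1 : ∀ E, ∑ j, φ E j c = s (E, c) - s (E, x₀) + K := by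
    intro E
    -- For fixed E, the argument minus the sum of the angles is continuous in x with values in πℤ,
    -- so its value at c equals that at `x₀`, where the sum is K.
    have h2 := continuousOn_int_mul_pi_eq (S := Icc p.a p.b) isPreconnected_Icc
      (h := fun x => s (E, x) - ∑ j, φ E j x)
      ((by fun_prop : Continuous fun x => s (E, x)).continuousOn.sub
        (continuousOn_finsetSum _ fun j _ => (hφ E).continuousOn j))
      (fun x hx => by
        obtain ⟨ψ, hψ⟩ := hf E x
        obtain ⟨k, hk⟩ := hψ.exists_sum_eq ((hφ E).angles x hx) (hds (E, x))
        exact ⟨k, by rw [hk]; ring⟩) hc hx₀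
    simp only [hK] at h2
    linarith
  simp only [h1]
  fun_prop

/-- At `a` the frame does not depend on E, and the normalization to [0, π) makes the sum of the
angles there the same for all E. -/
theorem continuous_sum_leftPhaseAngles {φ : ℝ → Fin n → ℝ → ℝ}
    (hφ : ∀ E, p.AreLeftPhaseAngles E (φ E)) {c : ℝ} (hc : c ∈ Icc p.a p.b) :
    Continuous fun E => ∑ j, φ E j c := by
  have ha := left_mem_Icc.2 p.a_lt_b.le
  refine p.continuous_sum_phaseAngles (T := p.leftMap)
    (fun v => p.continuous_leftMap continuous_fst continuous_snd continuous_const)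
    p.exists_factorizes_leftMap (fun E => (hφ E).arePhaseAngles) ha hc
    (K := ∑ j, φ 0 j p.a) fun E => SameAngles.sum_eq (n := n) ?_ ?_
  · have h1 : p.leftMap 0 p.a = p.leftMap E p.a :=
      ContinuousLinearMap.ext fun v => by rw [leftMap_left, leftMap_left]
    have h2 := (hφ 0).arePhaseAngles.angles p.a ha
    rw [h1] at h2
    exact sameAngles_of_hasEigenAngles ((hφ E).arePhaseAngles.angles p.a ha) h2
  · intro i j
    obtain ⟨_, _, _, _, h1⟩ := hφ E
    obtain ⟨_, _, _, _, h2⟩ := hφ 0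
    rw [abs_lt]
    constructor <;> linarith [h1 i, h2 j, (h1 i).1, (h1 i).2, (h2 j).1, (h2 j).2]

theorem continuous_sum_rightPhaseAngles {φ : ℝ → Fin n → ℝ → ℝ}
    (hφ : ∀ E, p.AreRightPhaseAngles E (φ E)) {c : ℝ} (hc : c ∈ Icc p.a p.b) :
    Continuous fun E => ∑ j, φ E j c := by
  have hb := right_mem_Icc.2 p.a_lt_b.le
  refine p.continuous_sum_phaseAngles (T := p.rightMap)
    (fun v => p.continuous_rightMap continuous_fst continuous_snd continuous_const)
    p.exists_factorizes_rightMap (fun E => (hφ E).arePhaseAngles) hb hc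
    (K := ∑ j, φ 0 j p.b) fun E => SameAngles.sum_eq (n := n) ?_ ?_
  · have h1 : p.rightMap 0 p.b = p.rightMap E p.b :=
      ContinuousLinearMap.ext fun v => by rw [rightMap_right, rightMap_right]
    have h2 := (hφ 0).arePhaseAngles.angles p.b hb
    rw [h1] at h2
    exact sameAngles_of_hasEigenAngles ((hφ E).arePhaseAngles.angles p.b hb) h2
  · intro i j
    obtain ⟨_, _, _, _, h1⟩ := hφ E
    obtain ⟨_, _, _, _, h2⟩ := hφ 0
    rw [abs_lt]
    constructor <;> linarith [(h1 i).1, (h1 i).2, (h2 j).1, (h2 j).2]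

/-- The matching angles sum up to the difference of the phase angles, modulo `π`. -/
theorem exists_sum_sub_sum_eq {c E : ℝ} (hc : c ∈ Icc p.a p.b) {φL φR ω : Fin n → ℝ}
    (hL : HasEigenAngles (valMat (p.leftMap E c)) (derMat (p.leftMap E c)) φL)
    (hR : HasEigenAngles (valMat (p.rightMap E c)) (derMat (p.rightMap E c)) φR)
    (hω : HasEigenAngles (p.matchP c E) (p.matchQ c E) ω) :
    ∃ k : ℤ, ∑ j, φL j - ∑ j, φR j = ∑ j, ω j + k * Real.pi := by
  obtain ⟨ψL, hψL⟩ := p.exists_factorizes_leftMap E c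
  obtain ⟨ψR, hψR⟩ := p.exists_factorizes_rightMap E c
  obtain ⟨ψ, hψ⟩ := p.exists_factorizes_match hc E
  set zL := (complexFrame (valMat (p.leftMap E c)) (derMat (p.leftMap E c))).det with hzL
  set zR := (complexFrame (valMat (p.rightMap E c)) (derMat (p.rightMap E c))).det with hzR
  have h1 : ∀ z : ℂ, z = (‖z‖ : ℝ) * Complex.exp (Complex.I * (z.arg : ℝ)) := fun z => by
    rw [mul_comm Complex.I, Complex.norm_mul_exp_arg_mul_I]
  obtain ⟨k, hk⟩ := hψL.exists_sum_eq hL (h1 zL)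
  obtain ⟨l, hl⟩ := hψR.exists_sum_eq hR (h1 zR)
  have h2 : (complexFrame (p.matchP c E) (p.matchQ c E)).det =
      (‖zL‖ * ‖zR‖ : ℝ) * Complex.exp (Complex.I * (zL.arg - zR.arg : ℝ)) := by
    rw [matchP, matchQ, det_complexFrame_matching, ← hzL, ← hzR]
    conv_lhs => rw [h1 zL, h1 zR]
    rw [map_mul, Complex.conj_ofReal, ← Complex.exp_conj, map_mul, Complex.conj_I,
      Complex.conj_ofReal]
    push_cast
    rw [mul_sub, sub_eq_add_neg, Complex.exp_add, neg_mul]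
    ring
  obtain ⟨m, hm⟩ := hψ.exists_sum_eq hω h2
  refine ⟨m - k + l, ?_⟩
  push_cast
  linarith

end MultichannelProblem

/-! ### Monotonicity of the matching angles, and the multiplicity -/

namespace MultichannelProblem

open MeasureTheory Set Matrix EigenAngles Filter Topology

variable {n : ℕ}

/-- The rotation of the phase space by the angle `θ`. -/
noncomputable def rot (θ : ℝ) (w : PhaseSpace n) : PhaseSpace n :=
  (Real.cos θ • w.1 + Real.sin θ • w.2, Real.cos θ • w.2 - Real.sin θ • w.1)

theorem symp_rot (θ : ℝ) (w w' : PhaseSpace n) :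
    symp (rot θ w) w' =
      Real.cos θ * symp w w' - Real.sin θ * (w.1 ⬝ᵥ w'.1 + w.2 ⬝ᵥ w'.2) := by
  simp only [symp, rot, add_dotProduct, sub_dotProduct, smul_dotProduct, smul_eq_mul]
  ring

theorem dotProduct_self_nonneg' (u : Fin n → ℝ) : 0 ≤ u ⬝ᵥ u :=
  Finset.sum_nonneg fun _ _ => mul_self_nonneg _

variable (p : MultichannelProblem n)

/-- A nontrivial solution has positive norm on every interval. -/
theorem integral_flow_pos (E : ℝ) {w : PhaseSpace n} (hw : w ≠ 0) {u v : ℝ} (hu : p.a ≤ u)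
    (huv : u < v) (hv : v ≤ p.b) : 0 < ∫ t in u..v, (p.flow E t w).1 ⬝ᵥ (p.flow E t w).1 := by
  have hc : Continuous fun t => p.flow E t w :=
    p.continuous_flow_apply continuous_const continuous_id continuous_const
  refine intervalIntegral.integral_pos huv
    (((continuous_fst.comp hc).dotProduct (continuous_fst.comp hc)).continuousOn)
    (fun t _ => dotProduct_self_nonneg' _) ?_
  by_contra! hcon
  have h1 : ∀ t ∈ Icc u v, (p.flow E t w).1 = 0 := fun t ht =>
    dotProduct_self_eq_zero.1 (le_antisymm (hcon t ht) (dotProduct_self_nonneg' _))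
  obtain ⟨t, ht⟩ := nonempty_Ioo.2 huv
  have htm : t ∈ Icc p.a p.b := ⟨hu.trans ht.1.le, ht.2.le.trans hv⟩
  have h2 : HasDerivAt (fun t => (p.flow E t w).1) (p.flow E t w).2 t :=
    (p.isSolution_flow E w t htm).1.hasDerivAt
      (Icc_mem_nhds (hu.trans_lt ht.1) (ht.2.trans_le hv))
  have h3 : HasDerivAt (fun t => (p.flow E t w).1) 0 t := by
    refine (hasDerivAt_const t (0 : Fin n → ℝ)).congr_of_eventuallyEq ?_
    filter_upwards [Ioo_mem_nhds ht.1 ht.2] with s hs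
    exact h1 s (Ioo_subset_Icc_self hs)
  have h4 : p.flow E t w = 0 := Prod.ext (h1 t (Ioo_subset_Icc_self ht)) (h2.unique h3)
  refine hw ((ContinuousLinearMap.isUnit_iff_bijective.1 (p.isUnit_flow E htm)).1 ?_)
  rw [h4, map_zero]

/-- The data of the left solutions form a maximal isotropic subspace. -/
theorem exists_leftMap_eq (E : ℝ) {x : ℝ} (hx : x ∈ Icc p.a p.b) {z : PhaseSpace n}
    (hz : ∀ v, symp (p.leftMap E x v) z = 0) : ∃ w, p.leftMap E x w = z := by
  obtain ⟨z', rfl⟩ := (ContinuousLinearMap.isUnit_iff_bijective.1 (p.isUnit_flow E hx)).2 z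
  have h1 : p.A₁ *ᵥ z'.1 + p.A₂ *ᵥ z'.2 = 0 := by
    refine dotProduct_eq_zero _ fun v => ?_
    have h2 := hz v
    rw [leftMap_apply, symp_flow_self _ _ _ _ hx, symp_boundaryFrame] at h2
    rw [dotProduct_comm]
    linarith
  obtain ⟨w, hw⟩ := exists_boundaryFrame_eq p.conj_A p.rank_A h1
  exact ⟨w, by rw [leftMap_apply, hw]⟩

theorem dotProduct_match (c E θ : ℝ) (u v : Fin n → ℝ) :
    u ⬝ᵥ ((Real.cos θ • p.matchP c E - Real.sin θ • p.matchQ c E) *ᵥ v) =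
      - symp (p.leftMap E c u) (rot θ (p.rightMap E c v)) := by
  have h2 : ∀ (M : Matrix (Fin n) (Fin n) ℝ) (w : Fin n → ℝ), u ⬝ᵥ Mᵀ *ᵥ w = (M *ᵥ u) ⬝ᵥ w :=
    fun M w => by rw [dotProduct_mulVec, vecMul_transpose]
  simp only [matchP, matchQ, sub_mulVec, add_mulVec, smul_mulVec, dotProduct_sub, dotProduct_add,
    dotProduct_smul, ← mulVec_mulVec, h2, valMat_mulVec, derMat_mulVec, symp, rot, smul_eq_mul]
  ring

/-- The kernel of `cos θ P - sin θ Q` describes the intersection of the left data and the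
rotated right data. -/
theorem exists_leftMap_eq_rot {c E θ : ℝ} (hc : c ∈ Icc p.a p.b) {v : Fin n → ℝ}
    (hv : (Real.cos θ • p.matchP c E - Real.sin θ • p.matchQ c E) *ᵥ v = 0) :
    ∃ w, p.leftMap E c w = rot θ (p.rightMap E c v) := by
  refine p.exists_leftMap_eq E hc fun u => ?_
  have := p.dotProduct_match c E θ u v
  rw [hv, dotProduct_zero] at this
  linarith

theorem continuous_integral_leftMap {x y : ℝ} (w₀ : Fin n → ℝ) (E₀ : ℝ) :
    Continuous fun q : ℝ × (Fin n → ℝ) =>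
      ∫ t in x..y, (p.leftMap q.1 t q.2).1 ⬝ᵥ (p.leftMap E₀ t w₀).1 := by
  refine intervalIntegral.continuous_parametric_intervalIntegral_of_continuous' ?_ x y
  refine Continuous.dotProduct (continuous_fst.comp ?_) (continuous_fst.comp ?_)
  · exact p.continuous_leftMap (continuous_fst.comp continuous_fst) continuous_snd
      (continuous_snd.comp continuous_fst)
  · exact p.continuous_leftMap continuous_const continuous_snd continuous_const

theorem continuous_integral_rightMap {x y : ℝ} (w₀ : Fin n → ℝ) (E₀ : ℝ) :
    Continuous fun q : ℝ × (Fin n → ℝ) =>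
      ∫ t in x..y, (p.rightMap q.1 t q.2).1 ⬝ᵥ (p.rightMap E₀ t w₀).1 := by
  refine intervalIntegral.continuous_parametric_intervalIntegral_of_continuous' ?_ x y
  refine Continuous.dotProduct (continuous_fst.comp ?_) (continuous_fst.comp ?_)
  · exact p.continuous_rightMap (continuous_fst.comp continuous_fst) continuous_snd
      (continuous_snd.comp continuous_fst)
  · exact p.continuous_rightMap continuous_const continuous_snd continuous_const

/-- Near a pair of left and right data that match at `E₀`, matching angles have the sign of
`E - E₀`. -/
theorem eventually_sin_mul_pos_of_eq {c : ℝ} (hc : c ∈ Icc p.a p.b) (E₀ : ℝ) {v₀ w₀ : Fin n → ℝ}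
    (hw₀ : w₀ ≠ 0) (hv₀ : v₀ ≠ 0) (h₀ : p.leftMap E₀ c w₀ = p.rightMap E₀ c v₀) :
    ∀ᶠ q : (ℝ × ℝ) × (Fin n → ℝ) × (Fin n → ℝ) in 𝓝 ((E₀, 0), (v₀, w₀)),
      p.leftMap q.1.1 c q.2.2 = rot q.1.2 (p.rightMap q.1.1 c q.2.1) → q.1.1 ≠ E₀ →
      0 < Real.sin q.1.2 * (q.1.1 - E₀) := by
  -- Pairing with the matched data at E₀ yields sin θ · T = (E - E₀) · G. At the base point, T is
  -- the squared length of the common data and G is the sum of the squared norms of the left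
  -- solution on [a, c] and the right one on [c, b].
  set G : (ℝ × ℝ) × (Fin n → ℝ) × (Fin n → ℝ) → ℝ := fun q =>
    (∫ t in p.a..c, (p.leftMap q.1.1 t q.2.2).1 ⬝ᵥ (p.leftMap E₀ t w₀).1) +
      Real.cos q.1.2 *
        ∫ t in c..p.b, (p.rightMap q.1.1 t q.2.1).1 ⬝ᵥ (p.rightMap E₀ t v₀).1 with hG
  set T : (ℝ × ℝ) × (Fin n → ℝ) × (Fin n → ℝ) → ℝ := fun q =>
    (p.rightMap q.1.1 c q.2.1).1 ⬝ᵥ (p.rightMap E₀ c v₀).1 +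
      (p.rightMap q.1.1 c q.2.1).2 ⬝ᵥ (p.rightMap E₀ c v₀).2 with hT
  have hGc : Continuous G := by
    refine Continuous.add ?_ (Continuous.mul (by fun_prop) ?_)
    · exact (p.continuous_integral_leftMap w₀ E₀).comp
        (f := fun q : (ℝ × ℝ) × (Fin n → ℝ) × (Fin n → ℝ) => (q.1.1, q.2.2)) (by fun_prop)
    · exact (p.continuous_integral_rightMap v₀ E₀).comp
        (f := fun q : (ℝ × ℝ) × (Fin n → ℝ) × (Fin n → ℝ) => (q.1.1, q.2.1)) (by fun_prop)
  have hTc : Continuous T := by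
    have h1 : Continuous fun q : (ℝ × ℝ) × (Fin n → ℝ) × (Fin n → ℝ) =>
        p.rightMap q.1.1 c q.2.1 :=
      p.continuous_rightMap (by fun_prop) continuous_const (by fun_prop)
    exact ((continuous_fst.comp h1).dotProduct continuous_const).add
      ((continuous_snd.comp h1).dotProduct continuous_const)
  have hT0 : 0 < T ((E₀, 0), (v₀, w₀)) := by
    have h1 : p.rightMap E₀ c v₀ ≠ 0 := fun h => hv₀ (p.rightMap_injective E₀ hc (by rw [h, map_zero]))
    refine lt_of_le_of_ne (add_nonneg (dotProduct_self_nonneg' _) (dotProduct_self_nonneg' _)) ?_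
    intro h2
    have h3 := dotProduct_self_nonneg' (p.rightMap E₀ c v₀).1
    have h4 := dotProduct_self_nonneg' (p.rightMap E₀ c v₀).2
    simp only [hT] at h2
    exact h1 (Prod.ext (dotProduct_self_eq_zero.1 (by linarith))
      (dotProduct_self_eq_zero.1 (by linarith)))
  have hG0 : 0 < G ((E₀, 0), (v₀, w₀)) := by
    have h1 : 0 ≤ ∫ t in p.a..c, (p.leftMap E₀ t w₀).1 ⬝ᵥ (p.leftMap E₀ t w₀).1 :=
      intervalIntegral.integral_nonneg hc.1 fun t _ => dotProduct_self_nonneg' _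
    have h2 : 0 ≤ ∫ t in c..p.b, (p.rightMap E₀ t v₀).1 ⬝ᵥ (p.rightMap E₀ t v₀).1 :=
      intervalIntegral.integral_nonneg hc.2 fun t _ => dotProduct_self_nonneg' _
    simp only [hG, Real.cos_zero, one_mul]
    -- As c may be an end point, one of the two intervals may be degenerate; the left integral is
    -- positive if a < c, the right one if c = a.
    rcases hc.1.lt_or_eq with hac | hac
    · have h3 : boundaryFrame p.A₁ p.A₂ w₀ ≠ 0 := fun h =>
        hw₀ (boundaryFrame_injective p.rank_A (by rw [h, map_zero]))
      have h4 := p.integral_flow_pos E₀ h3 le_rfl hac hc.2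
      simp only [← leftMap_apply] at h4
      linarith
    · have h3 : p.backFlow E₀ (boundaryFrame p.B₁ p.B₂ v₀) ≠ 0 := fun h => by
        have h5 := p.flow_backFlow E₀ (boundaryFrame p.B₁ p.B₂ v₀)
        rw [h, map_zero] at h5
        exact hv₀ (boundaryFrame_injective p.rank_B (by rw [← h5, map_zero]))
      have h4 := p.integral_flow_pos E₀ h3 hc.1 (hac ▸ p.a_lt_b) le_rfl
      simp only [← rightMap_apply] at h4
      linarith
  filter_upwards [hTc.continuousAt.eventually (lt_mem_nhds hT0),
    hGc.continuousAt.eventually (lt_mem_nhds hG0)] with q hq1 hq2 hq hne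
  have h1 := p.symp_leftMap q.1.1 E₀ q.2.2 w₀ hc
  rw [hq, symp_rot, h₀, p.symp_rightMap _ _ _ _ hc] at h1
  have h2 : Real.sin q.1.2 * T q = (q.1.1 - E₀) * G q := by
    simp only [hT, hG]
    linarith
  have h3 : 0 < (q.1.1 - E₀) ^ 2 := by
    have := sub_ne_zero.2 hne
    positivity
  have h4 : 0 < (Real.sin q.1.2 * (q.1.1 - E₀)) * T q := by
    calc 0 < (q.1.1 - E₀) ^ 2 * G q := mul_pos h3 hq2
      _ = (Real.sin q.1.2 * (q.1.1 - E₀)) * T q := by linear_combination (-(q.1.1 - E₀)) * h2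
  exact pos_of_mul_pos_left h4 hq1.le

/-- Small matching angles near `E₀` have the sign of `E - E₀`. -/
theorem eventually_sin_mul_pos {c : ℝ} (hc : c ∈ Icc p.a p.b) (E₀ : ℝ) :
    ∀ᶠ q : ℝ × ℝ in 𝓝 (E₀, 0), q.1 ≠ E₀ →
      (∃ v ≠ 0, (Real.cos q.2 • p.matchP c q.1 - Real.sin q.2 • p.matchQ c q.1) *ᵥ v = 0) →
      0 < Real.sin q.2 * (q.1 - E₀) := by
  set S := Metric.sphere (0 : (Fin n → ℝ) × (Fin n → ℝ)) 1 with hS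
  have hSc : IsCompact S := isCompact_sphere _ _
  -- Unit vectors are used to get one neighbourhood of (E₀, 0) for all data. A unit vector whose
  -- data do not match at E₀ has a neighbourhood in which the rotated matching equation fails.
  have h1 := hSc.eventually_forall_of_forall_eventually (x₀ := ((E₀, 0) : ℝ × ℝ))
    (P := fun q z => p.leftMap q.1 c z.2 = rot q.2 (p.rightMap q.1 c z.1) → q.1 ≠ E₀ →
      0 < Real.sin q.2 * (q.1 - E₀)) (by
    rintro ⟨v₀, w₀⟩ hz
    by_cases h₀ : p.leftMap E₀ c w₀ = p.rightMap E₀ c v₀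
    · have hz0 : ((v₀, w₀) : (Fin n → ℝ) × (Fin n → ℝ)) ≠ 0 := by
        rintro h
        rw [hS, h] at hz
        simp at hz
      have hw₀ : w₀ ≠ 0 := by
        rintro rfl
        rw [map_zero] at h₀
        have : v₀ = 0 := p.rightMap_injective E₀ hc (by rw [← h₀, map_zero])
        exact hz0 (by rw [this]; rfl)
      have hv₀ : v₀ ≠ 0 := by
        rintro rfl
        rw [map_zero] at h₀
        exact hw₀ (p.leftMap_injective E₀ hc (by rw [h₀, map_zero]))
      exact p.eventually_sin_mul_pos_of_eq hc E₀ hw₀ hv₀ h₀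
    · have hR : Continuous fun q : (ℝ × ℝ) × (Fin n → ℝ) × (Fin n → ℝ) =>
          p.rightMap q.1.1 c q.2.1 :=
        p.continuous_rightMap (by fun_prop) continuous_const (by fun_prop)
      have h2 : ContinuousAt (fun q : (ℝ × ℝ) × (Fin n → ℝ) × (Fin n → ℝ) =>
          p.leftMap q.1.1 c q.2.2 - rot q.1.2 (p.rightMap q.1.1 c q.2.1))
          ((E₀, 0), (v₀, w₀)) := by
        refine Continuous.continuousAt (Continuous.sub ?_ ?_)
        · exact p.continuous_leftMap (by fun_prop) continuous_const (by fun_prop)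
        · unfold rot
          fun_prop
      have h3 := h2.eventually_ne (y := 0) (by
        simp only [rot, Real.cos_zero, Real.sin_zero, one_smul, zero_smul, add_zero, sub_zero]
        exact sub_ne_zero.2 h₀)
      filter_upwards [h3] with q hq hq'
      exact absurd (sub_eq_zero.2 hq') hq)
  filter_upwards [h1] with q hq hne
  rintro ⟨v, hv0, hv⟩
  obtain ⟨w, hw⟩ := p.exists_leftMap_eq_rot hc hv
  set r := ‖((v, w) : (Fin n → ℝ) × (Fin n → ℝ))‖ with hr
  have hr0 : r ≠ 0 := norm_ne_zero_iff.2 fun h => hv0 (congrArg Prod.fst h)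
  -- The matching equation is homogeneous in (v, w), so the pair may be normalized.
  refine hq (r⁻¹ • (v, w)) ?_ ?_ hne
  · rw [hS, mem_sphere_zero_iff_norm, norm_smul, norm_inv, Real.norm_eq_abs, ← hr,
      abs_of_nonneg (norm_nonneg _), inv_mul_cancel₀ hr0]
  · simp only [Prod.smul_fst, Prod.smul_snd, map_smul, hw]
    refine Prod.ext ?_ ?_
    · simp only [rot, Prod.smul_fst, Prod.smul_snd]
      module
    · simp only [rot, Prod.smul_fst, Prod.smul_snd]
      module

/-- The eigenfunctions are the right solutions with data in the kernel of `P`. -/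
theorem eigenspace_eq_map {c : ℝ} (hc : c ∈ Icc p.a p.b) (E : ℝ) :
    ∃ f : (Fin n → ℝ) →ₗ[ℝ] (Icc p.a p.b → Fin n → ℝ), Function.Injective f ∧
      p.eigenspace E = (LinearMap.ker (p.matchP c E).mulVecLin).map f := by
  have ha := left_mem_Icc.2 p.a_lt_b.le
  have hb := right_mem_Icc.2 p.a_lt_b.le
  -- At θ = 0 the kernel condition says that the right solution is symplectically orthogonal to all
  -- left data at c. As the flow preserves the form, this is the boundary condition at `a`.
  have hker : ∀ v, v ∈ LinearMap.ker (p.matchP c E).mulVecLin ↔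
      ∀ u, symp (p.leftMap E c u) (p.rightMap E c v) = 0 := by
    intro v
    have h1 : ∀ u, u ⬝ᵥ (p.matchP c E *ᵥ v) = - symp (p.leftMap E c u) (p.rightMap E c v) := by
      intro u
      simpa [rot] using p.dotProduct_match c E 0 u v
    rw [LinearMap.mem_ker, mulVecLin_apply]
    constructor
    · intro h u
      have h2 := h1 u
      rw [h, dotProduct_zero] at h2
      linarith
    · intro h
      refine dotProduct_eq_zero _ fun u => ?_
      rw [dotProduct_comm, h1, h, neg_zero]
  refine ⟨{ toFun := fun v x => (p.rightMap E x v).1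
            map_add' := fun u v => by funext x; simp
            map_smul' := fun r v => by funext x; simp }, ?_, ?_⟩
  · refine (injective_iff_map_eq_zero _).2 fun v hv => ?_
    by_contra hv0
    have h3 : p.backFlow E (boundaryFrame p.B₁ p.B₂ v) ≠ 0 := fun h => by
      have h5 := p.flow_backFlow E (boundaryFrame p.B₁ p.B₂ v)
      rw [h, map_zero] at h5
      exact hv0 (boundaryFrame_injective p.rank_B (by rw [← h5, map_zero]))
    have h4 := p.integral_flow_pos E h3 le_rfl p.a_lt_b le_rfl
    have h5 : ∫ t in p.a..p.b, (p.flow E t (p.backFlow E (boundaryFrame p.B₁ p.B₂ v))).1 ⬝ᵥ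
        (p.flow E t (p.backFlow E (boundaryFrame p.B₁ p.B₂ v))).1 = ∫ t in p.a..p.b, (0 : ℝ) := by
      refine intervalIntegral.integral_congr fun t ht => ?_
      rw [uIcc_of_le p.a_lt_b.le] at ht
      have h6 : (p.rightMap E t v).1 = 0 := congrFun hv ⟨t, ht⟩
      simp only [← rightMap_apply, h6, dotProduct_zero]
    rw [h5] at h4
    simp at h4
  · ext u
    rw [Submodule.mem_map]
    constructor
    · rintro ⟨y, dy, hy, ⟨hya, hyb⟩, hu⟩
      obtain ⟨v, hv⟩ := exists_boundaryFrame_eq p.conj_B p.rank_B (w := (y p.b, dy p.b)) hyb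
      have h1 : ∀ x ∈ Icc p.a p.b, p.rightMap E x v = (y x, dy x) := fun x hx => by
        rw [rightMap_apply, hv, hy.eq_flow hb, backFlow_flow, hy.eq_flow hx]
      refine ⟨v, (hker v).2 fun w => ?_, funext fun x => ?_⟩
      · rw [h1 c hc, hy.eq_flow hc, leftMap_apply, symp_flow_self _ _ _ _ hc, symp_boundaryFrame,
          hya]
        simp
      · change (p.rightMap E x v).1 = u x
        rw [h1 x x.2, hu]
    · rintro ⟨v, hv, rfl⟩
      rw [hker] at hv
      refine ⟨fun x => (p.rightMap E x v).1, fun x => (p.rightMap E x v).2,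
        p.isSolution_flow E _, ⟨?_, ?_⟩, fun x => rfl⟩
      · refine dotProduct_eq_zero _ fun w => ?_
        have h1 := hv w
        rw [leftMap_apply, rightMap_apply, symp_flow_self _ _ _ _ hc, symp_boundaryFrame] at h1
        simp only [dotProduct_comm _ w, rightMap_apply, flow_left]
        linarith
      · simp only [rightMap_right]
        exact boundary_boundaryFrame p.conj_B v

theorem multiplicity_eq {c : ℝ} (hc : c ∈ Icc p.a p.b) (E : ℝ) :
    p.multiplicity E = Module.finrank ℝ (LinearMap.ker (p.matchP c E).mulVecLin) := by
  obtain ⟨f, hf, h⟩ := p.eigenspace_eq_map hc E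
  rw [multiplicity, h]
  exact (LinearEquiv.finrank_eq (Submodule.equivMapOfInjective f hf _)).symm

/-- Finite dimension has to be established, because `finrank` is also 0 for spaces of infinite
dimension. -/
theorem isEigenvalue_iff (E : ℝ) : p.IsEigenvalue E ↔ p.multiplicity E ≠ 0 := by
  obtain ⟨f, hf, h⟩ := p.eigenspace_eq_map (left_mem_Icc.2 p.a_lt_b.le) E
  have : Module.Finite ℝ (p.eigenspace E) := by
    rw [h]
    infer_instance
  rw [IsEigenvalue, multiplicity, ne_eq, ne_eq, Submodule.finrank_eq_zero]

end MultichannelProblem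

/-- A function which is locally monotone at every point is monotone. -/
theorem monotone_of_locally {f : ℝ → ℝ}
    (h : ∀ x, ∃ ε > 0, (∀ y ∈ Set.Ioo (x - ε) x, f y ≤ f x) ∧
      ∀ y ∈ Set.Ioo x (x + ε), f x ≤ f y) : Monotone f := by
  intro a b hab
  -- The supremum s of S satisfies f a ≤ f s by monotonicity on the left of s; if s < b,
  -- monotonicity on the right of s would extend S beyond s.
  set S : Set ℝ := {y | y ∈ Set.Icc a b ∧ ∀ z ∈ Set.Icc a y, f a ≤ f z} with hS
  have haS : a ∈ S := ⟨⟨le_rfl, hab⟩, fun z hz => by rw [le_antisymm hz.2 hz.1]⟩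
  have hbdd : BddAbove S := ⟨b, fun y hy => hy.1.2⟩
  set s := sSup S with hs
  have has : a ≤ s := le_csSup hbdd haS
  have hsb : s ≤ b := csSup_le ⟨a, haS⟩ fun y hy => hy.1.2
  have hlt : ∀ z, a ≤ z → z < s → f a ≤ f z := fun z haz hzs => by
    obtain ⟨y, hy, hzy⟩ := exists_lt_of_lt_csSup ⟨a, haS⟩ hzs
    exact hy.2 z ⟨haz, hzy.le⟩
  obtain ⟨ε, hε, h1, h2⟩ := h s
  have hfs : f a ≤ f s := by
    rcases has.eq_or_lt with h3 | h3
    · rw [← h3]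
    · obtain ⟨z, hz1, hz2⟩ := exists_between (max_lt h3 (sub_lt_self s hε))
      exact (hlt z ((le_max_left _ _).trans hz1.le) hz2).trans
        (h1 z ⟨(le_max_right _ _).trans_lt hz1, hz2⟩)
  rcases hsb.eq_or_lt with h3 | h3
  · rwa [← h3]
  · exfalso
    obtain ⟨t, ht1, ht2⟩ := exists_between (lt_min h3 (lt_add_of_pos_right s hε))
    have htS : t ∈ S := by
      refine ⟨⟨has.trans ht1.le, ht2.le.trans (min_le_left _ _)⟩, fun z hz => ?_⟩
      rcases lt_trichotomy z s with hzs | hzs | hzs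
      · exact hlt z hz.1 hzs
      · rw [hzs]; exact hfs
      · exact hfs.trans (h2 z ⟨hzs, hz.2.trans_lt (ht2.trans_le (min_le_right _ _))⟩)
    exact absurd (le_csSup hbdd htS) (not_le.2 ht1)

/-! ### The jumps of the counting function -/

namespace EigenAngles

open Matrix

variable {n : ℕ}

/-- Bringing an angle into [0, π) subtracts π times the floor of its quotient by π. -/
theorem SameAngles.sum_eq_sub_floor {φ ω : Fin n → ℝ} (h : SameAngles φ ω)
    (hω : ∀ j, 0 ≤ ω j ∧ ω j < Real.pi) :
    ∑ j, ω j = ∑ j, φ j - Real.pi * ∑ j, (⌊φ j / Real.pi⌋ : ℝ) := by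
  obtain ⟨σ, k, hk⟩ := h.exists_perm
  have h1 : ∀ j, ω j = φ (σ j) - Real.pi * (⌊φ (σ j) / Real.pi⌋ : ℝ) := fun j => by
    have h2 : φ (σ j) / Real.pi = ω j / Real.pi - (k j : ℤ) := by
      rw [hk]
      field_simp [Real.pi_ne_zero]
      ring
    have h3 : ⌊ω j / Real.pi⌋ = 0 := Int.floor_eq_zero_iff.2
      ⟨div_nonneg (hω j).1 Real.pi_pos.le, (div_lt_one Real.pi_pos).2 (hω j).2⟩
    rw [h2, Int.floor_sub_intCast, h3, hk]
    push_cast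
    ring
  simp only [h1, Finset.sum_sub_distrib, ← Finset.mul_sum]
  rw [Equiv.sum_comp σ φ, Equiv.sum_comp σ fun j => (⌊φ j / Real.pi⌋ : ℝ)]

theorem exists_mulVec_eq_zero {P Q : Matrix (Fin n) (Fin n) ℝ} {φ : Fin n → ℝ}
    (h : HasEigenAngles P Q φ) (j : Fin n) :
    ∃ v ≠ 0, (Real.cos (φ j) • P - Real.sin (φ j) • Q) *ᵥ v = 0 := by
  have h1 : 0 < {i | ∃ k : ℤ, φ i = φ j + k * Real.pi}.ncard :=
    (Set.ncard_pos (Set.toFinite _)).2 ⟨j, 0, by simp⟩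
  rw [h (φ j)] at h1
  have := Module.finrank_pos_iff.1 h1
  obtain ⟨v, hv⟩ := exists_ne (0 : LinearMap.ker
    (mulVecLin (Real.cos (φ j) • P - Real.sin (φ j) • Q)))
  exact ⟨v, fun h => hv (Subtype.ext h), v.2⟩

end EigenAngles

namespace MultichannelProblem

open Set Matrix EigenAngles Filter Topology

variable {n : ℕ} (p : MultichannelProblem n)

/-- The continuous lift of the matching angles through `[0, π)` at `E₀`. -/
theorem exists_lift_matchingAngles {c : ℝ} (hc : c ∈ Icc p.a p.b) (E₀ : ℝ) :
    ∃ Ω : ℝ → Fin n → ℝ, Continuous Ω ∧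
      (∀ E, HasEigenAngles (p.matchP c E) (p.matchQ c E) (Ω E)) ∧
      (∀ j, 0 ≤ Ω E₀ j ∧ Ω E₀ j < Real.pi) := by
  obtain ⟨χ, hχ⟩ := p.exists_factorizes_match hc E₀
  obtain ⟨ψ, hψ, hχψ, hmem⟩ := exists_isOrdered_Ico χ
  obtain ⟨Ω, h1, _, h3, h4⟩ := exists_continuous_angles_of_base (p.continuous_match c).1
    (p.continuous_match c).2 (p.exists_factorizes_match hc) E₀ hψ
    (hχψ.hasEigenAngles hχ.hasEigenAngles)
  exact ⟨Ω, h1, h3, by simpa only [h4] using hmem⟩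

/-- The matching angles that vanish at `E₀` change sign there, from negative to positive. -/
theorem eventually_floor_eq {c : ℝ} (hc : c ∈ Icc p.a p.b) {E₀ : ℝ} {Ω : ℝ → Fin n → ℝ}
    (hΩ : Continuous Ω) (ha : ∀ E, HasEigenAngles (p.matchP c E) (p.matchQ c E) (Ω E))
    (h0 : ∀ j, 0 ≤ Ω E₀ j ∧ Ω E₀ j < Real.pi) (j : Fin n) :
    ∀ᶠ E in 𝓝 E₀, (E₀ < E → ⌊Ω E j / Real.pi⌋ = 0) ∧
      (E < E₀ → ⌊Ω E j / Real.pi⌋ = if Ω E₀ j = 0 then -1 else 0) := by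
  have hpi := Real.pi_pos
  have hcont : ContinuousAt (fun E => Ω E j) E₀ := ((continuous_apply j).comp hΩ).continuousAt
  have hfl : ∀ x : ℝ, 0 < x → x < Real.pi → ⌊x / Real.pi⌋ = 0 := fun x hx hx' =>
    Int.floor_eq_zero_iff.2 ⟨div_nonneg hx.le hpi.le, (div_lt_one hpi).2 hx'⟩
  have hlt := hcont.eventually (gt_mem_nhds (h0 j).2)
  rcases (h0 j).1.lt_or_eq with hj | hj
  · filter_upwards [hlt, hcont.eventually (lt_mem_nhds hj)] with E h1 h2
    rw [if_neg hj.ne', hfl _ h2 h1]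
    exact ⟨fun _ => rfl, fun _ => rfl⟩
  · have hgt := hcont.eventually (lt_mem_nhds (show -Real.pi < Ω E₀ j by linarith))
    have hpair : Tendsto (fun E => (E, Ω E j)) (𝓝 E₀) (𝓝 (E₀, 0)) := by
      rw [hj]
      exact tendsto_id.prodMk_nhds hcont
    filter_upwards [hlt, hgt, hpair.eventually (p.eventually_sin_mul_pos hc E₀)] with E h1 h2 h3
    have h4 := fun hne => h3 hne (exists_mulVec_eq_zero (ha E) j)
    rw [if_pos hj.symm]
    constructor
    · intro hE
      have h5 := h4 hE.ne'
      have h6 : 0 < Real.sin (Ω E j) := pos_of_mul_pos_left h5 (sub_pos.2 hE).le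
      refine hfl _ ?_ h1
      by_contra! h7
      exact absurd h6 (not_lt.2 (Real.sin_nonpos_of_nonpos_of_neg_pi_le h7 h2.le))
    · intro hE
      have h5 := h4 hE.ne
      have h6 : Real.sin (Ω E j) < 0 := by
        by_contra! h7
        nlinarith [mul_nonneg h7 (sub_pos.2 hE).le]
      have h7 : Ω E j < 0 := by
        by_contra! h7
        exact absurd h6 (not_lt.2 (Real.sin_nonneg_of_nonneg_of_le_pi h7 h1.le))
      rw [Int.floor_eq_iff]
      constructor
      · rw [le_div_iff₀ hpi]; push_cast; linarith
      · rw [div_lt_iff₀ hpi]; push_cast; linarith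

/-- The local behaviour of the counting function. -/
theorem exists_local_counting {c : ℝ} (hc : c ∈ Icc p.a p.b) {φL φR : ℝ → Fin n → ℝ → ℝ}
    {ω : ℝ → Fin n → ℝ} (hL : ∀ E, p.AreLeftPhaseAngles E (φL E))
    (hR : ∀ E, p.AreRightPhaseAngles E (φR E)) (hω : ∀ E, p.AreMatchingAngles c E (ω E))
    {I : ℝ → ℝ}
    (hI : ∀ E, I E = 1 / Real.pi * (∑ j, φL E j c - ∑ j, φR E j c - ∑ j, ω E j) + n) (E₀ : ℝ) :
    ∃ ε > 0, (∀ E ∈ Ioo (E₀ - ε) E₀, I E = I E₀ - p.multiplicity E₀) ∧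
      ∀ E ∈ Ioo E₀ (E₀ + ε), I E = I E₀ := by
  have hpi := Real.pi_ne_zero
  obtain ⟨Ω, hΩ, ha, h0⟩ := p.exists_lift_matchingAngles hc E₀
  -- With the continuous lift in place of ω, the bracket is continuous with values in πℤ, hence
  -- constant; reducing the lift to ω contributes the floors.
  have hIΩ : ∃ C : ℝ, ∀ E, I E = C + ∑ j, (⌊Ω E j / Real.pi⌋ : ℝ) := by
    have h1 : ∀ E E', ∑ j, φL E j c - ∑ j, φR E j c - ∑ j, Ω E j =
        ∑ j, φL E' j c - ∑ j, φR E' j c - ∑ j, Ω E' j := fun E E' => by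
      refine continuousOn_int_mul_pi_eq (S := univ) isPreconnected_univ
        (h := fun E => ∑ j, φL E j c - ∑ j, φR E j c - ∑ j, Ω E j)
        (Continuous.continuousOn (((p.continuous_sum_leftPhaseAngles hL hc).sub
          (p.continuous_sum_rightPhaseAngles hR hc)).sub
            (continuous_finsetSum _ fun j _ => (continuous_apply j).comp hΩ)))
        (fun E _ => ?_) (mem_univ E) (mem_univ E')
      obtain ⟨k, hk⟩ := p.exists_sum_sub_sum_eq hc ((hL E).arePhaseAngles.angles c hc)
        ((hR E).arePhaseAngles.angles c hc) (ha E)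
      exact ⟨k, by rw [hk]; ring⟩
    refine ⟨1 / Real.pi * (∑ j, φL E₀ j c - ∑ j, φR E₀ j c - ∑ j, Ω E₀ j) + n, fun E => ?_⟩
    rw [hI, ← h1 E E₀, (sameAngles_of_hasEigenAngles (ha E)
      ((hω E).hasEigenAngles hc)).sum_eq_sub_floor (hω E).1]
    field_simp
    ring
  obtain ⟨C, hC⟩ := hIΩ
  have hfl0 : ∀ j, ⌊Ω E₀ j / Real.pi⌋ = 0 := fun j => Int.floor_eq_zero_iff.2
    ⟨div_nonneg (h0 j).1 Real.pi_pos.le, (div_lt_one Real.pi_pos).2 (h0 j).2⟩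
  have hI0 : I E₀ = C := by simp [hC, hfl0]
  -- The multiplicity counts the angles congruent to 0; as those at E₀ lie in [0, π), these are the
  -- ones equal to 0.
  have hm : ∑ j, (if Ω E₀ j = 0 then (-1 : ℝ) else 0) = - p.multiplicity E₀ := by
    have h1 := ha E₀ 0
    rw [Real.cos_zero, Real.sin_zero, one_smul, zero_smul, sub_zero, ← p.multiplicity_eq hc] at h1
    have h2 : {j | ∃ k : ℤ, Ω E₀ j = 0 + k * Real.pi} =
        (Finset.univ.filter fun j => Ω E₀ j = 0 : Finset (Fin n)) := by
      ext j
      simp only [Finset.coe_filter, Finset.mem_univ, true_and, Set.mem_ofPred_eq, zero_add]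
      constructor
      · rintro ⟨k, hk⟩
        have h3 := hfl0 j
        rw [hk, mul_div_cancel_right₀ _ hpi, Int.floor_intCast] at h3
        rw [hk, h3]
        simp
      · intro h
        exact ⟨0, by simp [h]⟩
    rw [h2, Set.ncard_coe_finset] at h1
    rw [← Finset.sum_filter, Finset.sum_const, h1]
    simp
  have hev := eventually_all.2 fun j => p.eventually_floor_eq hc hΩ ha h0 j
  obtain ⟨ε, hε, h1⟩ := Metric.eventually_nhds_iff.1 hev
  refine ⟨ε, hε, fun E hE => ?_, fun E hE => ?_⟩
  · have h2 : dist E E₀ < ε := by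
      rw [Real.dist_eq, abs_lt]; constructor <;> linarith [hE.1, hE.2]
    rw [hC E, hI0, sub_eq_add_neg, ← hm]
    congr 1
    refine Finset.sum_congr rfl fun j _ => ?_
    rw [(h1 h2 j).2 hE.2]
    split_ifs <;> simp
  · have h2 : dist E E₀ < ε := by
      rw [Real.dist_eq, abs_lt]; constructor <;> linarith [hE.1, hE.2]
    rw [hC E, hI0]
    simp [(h1 h2 _).1 hE.1]

end MultichannelProblem

theorem mainTheorem1 (n : ℕ) (p : MultichannelProblem n) (c : ℝ) (hc : c ∈ Set.Icc p.a p.b) :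
    -- the normalized phase angles and the angles `ω_j` exist for every `E`
    ((∀ E, ∃ φ, p.AreLeftPhaseAngles E φ) ∧ (∀ E, ∃ φ, p.AreRightPhaseAngles E φ) ∧
      (∀ E, ∃ ω, p.AreMatchingAngles c E ω)) ∧
    ∀ (φL φR : ℝ → Fin n → ℝ → ℝ) (ω : ℝ → Fin n → ℝ),
      (∀ E, p.AreLeftPhaseAngles E (φL E)) →
      (∀ E, p.AreRightPhaseAngles E (φR E)) →
      (∀ E, p.AreMatchingAngles c E (ω E)) →
      ∀ I : ℝ → ℝ,
      (∀ E, I E = 1 / Real.pi * (∑ j, φL E j c - ∑ j, φR E j c - ∑ j, ω E j) + n) →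
        -- integer valued, nondecreasing, a step function
        (∀ E, ∃ k : ℤ, I E = k) ∧ Monotone I ∧ IsStepFunction I ∧
        -- the points of increase are the eigenvalues
        (∀ E, p.IsEigenvalue E ↔ ∀ ε > 0, ∃ E₁ ∈ Set.Ioo (E - ε) (E + ε),
          ∃ E₂ ∈ Set.Ioo (E - ε) (E + ε), I E₁ < I E₂) ∧
        -- `I` increases by the multiplicity when `E` passes through an eigenvalue
        (∀ E, p.IsEigenvalue E → ∃ ε > 0, ∀ E₁ ∈ Set.Ioo (E - ε) E, ∀ E₂ ∈ Set.Ioo E (E + ε),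
          I E₂ = I E₁ + p.multiplicity E) := by
  refine ⟨⟨p.exists_areLeftPhaseAngles, p.exists_areRightPhaseAngles,
    p.exists_areMatchingAngles hc⟩, fun φL φR ω hL hR hω I hI => ?_⟩
  have hloc := p.exists_local_counting hc hL hR hω hI
  refine ⟨fun E => ?_, monotone_of_locally fun E => ?_, fun E => ?_, fun E => ?_, fun E _ => ?_⟩
  · obtain ⟨k, hk⟩ := p.exists_sum_sub_sum_eq hc ((hL E).arePhaseAngles.angles c hc)
      ((hR E).arePhaseAngles.angles c hc) ((hω E).hasEigenAngles hc)
    refine ⟨k + n, ?_⟩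
    rw [hI, hk]
    have := Real.pi_ne_zero
    push_cast
    field_simp
    ring
  · obtain ⟨ε, hε, h1, h2⟩ := hloc E
    exact ⟨ε, hε, fun y hy => by rw [h1 y hy]; linarith [(p.multiplicity E).cast_nonneg (α := ℝ)],
      fun y hy => (h2 y hy).ge⟩
  · obtain ⟨ε, hε, h1, h2⟩ := hloc E
    exact ⟨ε, hε, ⟨_, h1⟩, ⟨_, h2⟩⟩
  · obtain ⟨ε, hε, h1, h2⟩ := hloc E
    rw [p.isEigenvalue_iff]
    constructor
    · intro hm δ hδ
      obtain ⟨E₁, h3, h4⟩ := exists_between (max_lt (sub_lt_self E hε) (sub_lt_self E hδ))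
      -- The point E itself serves as the second point: I takes its right-hand value at E, so the
      -- whole jump lies to its left.
      refine ⟨E₁, ⟨(le_max_right _ _).trans_lt h3, by linarith⟩, E, ⟨by linarith, by linarith⟩, ?_⟩
      rw [h1 E₁ ⟨(le_max_left _ _).trans_lt h3, h4⟩]
      have : (0 : ℝ) < p.multiplicity E := by exact_mod_cast Nat.pos_of_ne_zero hm
      linarith
    · intro h hm
      obtain ⟨E₁, hE₁, E₂, hE₂, hlt⟩ := h ε hε
      have h3 : ∀ x ∈ Set.Ioo (E - ε) (E + ε), I x = I E := fun x hx => by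
        rcases lt_trichotomy x E with h4 | h4 | h4
        · rw [h1 x ⟨hx.1, h4⟩, hm]
          simp
        · rw [h4]
        · exact h2 x ⟨h4, hx.2⟩
      rw [h3 E₁ hE₁, h3 E₂ hE₂] at hlt
      exact lt_irrefl _ hlt
  · obtain ⟨ε, hε, h1, h2⟩ := hloc E
    exact ⟨ε, hε, fun E₁ hE₁ E₂ hE₂ => by rw [h1 E₁ hE₁, h2 E₂ hE₂]; ring⟩
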